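/- Notation. For $\tau\in\mathbb H$ and $z\in\mathbb C$ put $q=e^{2\pi i\tau}$, $\zeta=e^{2\pi iz}$, $q^\alpha=e^{2\pi i\alpha\tau}$, $\zeta^\alpha=e^{2\pi i\alpha z}$; $\sqrt{\cdot}$ is the principal square root, $\operatorname{erf}(u)=\frac{2}{\sqrt\pi}\int_0^ue^{-t^2}\,dt$, $\eta$ is the Dedekind eta function and $\delta$ the Kronecker delta. Let $$h(\zeta;q)=(1-\zeta)\sum_{n\ge0}(-1)^n\zeta^{3n}q^{\frac{n(3n+1)}2}\left(1-\zeta^2q^{2n+1}\right).$$ The false Eisenstein series $h_k$, $k\ge1$, are the functions on $\mathbb H$ defined by the identity, for $z$ near $0$, $$-2i\sin(\pi z)\,q^{-\frac1{24}}\eta(\tau)\exp\Big(-\sum_{k\ge1}h_k(\tau)\frac{(2\pi iz)^k}{k!}\Big)=h(\zeta;q).$$ For $\tau,w\in\mathbb H$ and $\gamma=\begin{pmatrix}a&b\\c&d\end{pmatrix}\in\mathrm{SL}_2(\mathbb Z)$, let $$\widehat T(z;\tau,w)=i\sum_{n\in\mathbb Z}(-1)^n\left(1+\operatorname{erf}\left(-i\sqrt{\pi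 i(w-\tau)}\left(n+\tfrac12+\tfrac{\operatorname{Im}z}{\operatorname{Im}\tau}\right)\right)\right)q^{\frac12(n+\frac12)^2}\zeta^{n+\frac12},$$ $$\widehat H(z;\tau,w)=\tfrac i2\left(\zeta^{\frac12}-\zeta^{-\frac12}\right)q^{\frac18}\left(-\zeta\,\widehat T(3z+\tau;3\tau,3w)+\zeta^{-1}\,\widehat T(3z-\tau;3\tau,3w)\right),$$ $$A(\tau,w)=\frac1{2\pi i}\left[\frac{\partial}{\partial z}\widehat H(z;\tau,w)\right]_{z=0},$$ and, for $\tau\ne w$, $$\chi_{\tau,w}(\gamma)=\sqrt{\frac{i(w-\tau)}{(c\tau+d)(cw+d)}}\;\frac{\sqrt{c\tau+d}\,\sqrt{cw+d}}{\sqrt{i(w-\tau)}}.$$ Theorem. The functions $h_k$ exist (the identity above has a solution for each $\tau\in\mathbb H$), and there exist functions $\widehat h_k(\tau,w)$, $k\ge1$, of $\tau,w\in\mathbb H$ such that the following hold. (0) The $\widehat h_k$ are the exponential Taylor coefficients of $\widehat H$: if $\tau\ne w$ and $A(\tau,w)\ne0$, there are complex numbers $\widehat h_{k,\ell}(\tau,w)$,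 $(k,\ell)\in\mathbb N_0^2\setminus\{(0,0)\}$, with $\widehat h_{k,0}(\tau,w)=\widehat h_k(\tau,w)$ for $k\ge1$ and, for all $z$ near $0$, with an absolutely convergent sum, $$\widehat H(z;\tau,w)=2i\sin(\pi z)\,A(\tau,w)\exp\Big(-\sum_{(k,\ell)\ne(0,0)}\widehat h_{k,\ell}(\tau,w)\frac{(2\pi iz)^k}{k!}\frac{(2\pi i\overline z)^\ell}{\ell!}\Big).$$ (1) For $k\ge1$, $\gamma=\begin{pmatrix}a&b\\c&d\end{pmatrix}\in\Gamma_0(3)$ and all $\tau,w\in\mathbb H$ with $\tau\ne w$, $$\widehat h_k\left(\frac{a\tau+b}{c\tau+d},\frac{aw+b}{cw+d}\right)=\chi_{\tau,w}(\gamma)^k(c\tau+d)^k\,\widehat h_k(\tau,w)+\delta_{k,2}\frac{3ic}{2\pi}(c\tau+d).$$ (2) For $k\ge1$, $\tau\in\mathbb H$ and $\varepsilon>0$, $$\lim_{t\to\infty}\widehat h_k(\tau,\tau+it+\varepsilon)=h_k(\tau).$$ -/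

import Mathlib

open UpperHalfPlane hiding I
open Complex Filter Topology
open scoped Real MatrixGroups ComplexConjugate

namespace FalseEis

noncomputable section

/-- `e(x) = exp(2πix)`. Thus `ζ^α = e(αz)` and `q^α = e(ατ)` where `ζ = e(z)`, `q = e(τ)`. -/
def e (x : ℂ) : ℂ := Complex.exp (2 * π * I * x)

/-- The error function `erf(z) = (2/√π) ∫_0^z exp(-t²) dt` of a complex variable, the integral
being taken along the segment `t = sz`, `0 ≤ s ≤ 1`. -/
def erf (z : ℂ) : ℂ :=
  2 / (√π : ℝ) * ∫ s in (0 : ℝ)..1, z * Complex.exp (-((s : ℂ) * z) ^ 2)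

/-- The Jacobi theta function
`ϑ(z;τ) = i ∑_{n ∈ ℤ} (-1)^n q^{(n+1/2)²/2} ζ^{n+1/2}`. -/
def jacobiVartheta (z τ : ℂ) : ℂ :=
  I * ∑' n : ℤ, (-1 : ℂ) ^ n * e ((n + 1 / 2) ^ 2 / 2 * τ) * e ((n + 1 / 2) * z)

/-- The completed false theta function
`ψ̂(z;τ,w) = i ∑_{n ∈ ℤ} erf(-i √(πi(w-τ)) (n+1/2+z₂/τ₂)) (-1)^n q^{(n+1/2)²/2} ζ^{n+1/2}`,
where `z₂ = Im z`, `τ₂ = Im τ` and `√` is the principal square root. -/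
def psiHat (z τ w : ℂ) : ℂ :=
  I * ∑' n : ℤ,
    erf (-I * Complex.sqrt (π * I * (w - τ)) * (n + 1 / 2 + ((z.im / τ.im : ℝ) : ℂ))) *
      (-1 : ℂ) ^ n * e ((n + 1 / 2) ^ 2 / 2 * τ) * e ((n + 1 / 2) * z)

/-- `T̂(z;τ,w) = ϑ(z;τ) + ψ̂(z;τ,w)`. -/
def THat (z τ w : ℂ) : ℂ := jacobiVartheta z τ + psiHat z τ w

/-- `Ĥ(z;τ,w) = (i/2)(ζ^{1/2} - ζ^{-1/2}) q^{1/8} ∑_± ∓ ζ^{±1} T̂(3z ± τ; 3τ, 3w)`. -/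
def HHat (z τ w : ℂ) : ℂ :=
  I / 2 * (e (z / 2) - e (-z / 2)) * e (τ / 8) *
    (-e z * THat (3 * z + τ) (3 * τ) (3 * w) + e (-z) * THat (3 * z - τ) (3 * τ) (3 * w))

/-- The derivative of `Ĥ(x;τ,w)` with respect to `ζ = e(x)` at `x = 0`; as `dζ/dx = 2πi` there, it
is `(2πi)⁻¹` times the derivative with respect to `x`, which exists because `Ĥ` is
`ζ^{1/2} - ζ^{-1/2}` times a function of `x` that is continuous at `0`. -/
def HHatDeriv (τ w : ℂ) : ℂ := deriv (fun x : ℂ => HHat x τ w) 0 / (2 * π * I)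

/-- The false theta function
`h(ζ;q) = (1-ζ) ∑_{n ≥ 0} (-1)^n ζ^{3n} q^{n(3n+1)/2} (1 - ζ² q^{2n+1})`.
The natural number `n(3n+1)` is even, so the division in the exponent is exact. -/
def falseTheta (ζ q : ℂ) : ℂ :=
  (1 - ζ) * ∑' n : ℕ,
    (-1 : ℂ) ^ n * ζ ^ (3 * n) * q ^ (n * (3 * n + 1) / 2) * (1 - ζ ^ 2 * q ^ (2 * n + 1))

/-- The sequence `(a_k)_{k ≥ 1}` of complex numbers satisfies, for all `z` near `0`,
`-2i sin(πz) q^{-1/24} η(τ) exp(-∑_{k ≥ 1} a_k (2πiz)^k / k!) = h(ζ;q)`. -/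
def IsFalseEisensteinSeq (τ : ℂ) (a : ℕ+ → ℂ) : Prop :=
  ∀ᶠ z : ℂ in 𝓝 0, ∃ S : ℂ,
    HasSum (fun k : ℕ+ => a k * ((2 * π * I * z) ^ (k : ℕ) / ((k : ℕ).factorial : ℂ))) S ∧
    -2 * I * Complex.sin (π * z) * e (-τ / 24) * ModularForm.eta τ * Complex.exp (-S) =
      falseTheta (e z) (e τ)

/-- The defining identity determines the sequence. -/
theorem IsFalseEisensteinSeq.unique {τ : ℂ} (hτ : 0 < τ.im) {a b : ℕ+ → ℂ}
    (ha : IsFalseEisensteinSeq τ a) (hb : IsFalseEisensteinSeq τ b) : a = b := by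
  have hpi : (2 * π * I : ℂ) ≠ 0 := by simp [Real.pi_ne_zero, I_ne_zero]
  have heta : ModularForm.eta τ ≠ 0 := ModularForm.eta_ne_zero hτ
  let d : ℕ → ℂ := fun n =>
    if h : 0 < n then (a ⟨n, h⟩ - b ⟨n, h⟩) * ((2 * π * I) ^ n / (n.factorial : ℂ)) else 0
  have hd : ∀ k : ℕ+, d k = (a k - b k) * ((2 * π * I) ^ (k : ℕ) / ((k : ℕ).factorial : ℂ)) := by
    intro k
    exact dif_pos k.pos
  have hd0 : d 0 = 0 := by simp [d]
  let f : ℂ → ℂ := fun z => ∑' n : ℕ, z ^ n • d n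
  have hsum : ∀ᶠ z : ℂ in 𝓝 0, HasSum (fun n => z ^ n • d n) (f z) ∧
      (Complex.sin (π * z) ≠ 0 → Complex.exp (f z) = 1) := by
    filter_upwards [ha, hb] with z ⟨S, hS, hS'⟩ ⟨R, hR, hR'⟩
    have key : HasSum (fun n => z ^ n • d n) (S - R) := by
      have h1 := hS.sub hR
      refine (PNat.coe_injective.hasSum_iff (f := fun n : ℕ => z ^ n • d n) ?_).mp ?_
      · intro n hn
        have : n = 0 := by
          by_contra h0
          exact hn ⟨⟨n, Nat.pos_of_ne_zero h0⟩, rfl⟩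
        simp [this, hd0]
      · convert! h1 using 1
        funext k
        simp only [Function.comp, smul_eq_mul, hd, mul_pow]
        ring
    have hf : f z = S - R := key.tsum_eq
    rw [hf]
    refine ⟨key, fun hz => ?_⟩
    have hne : -2 * I * Complex.sin (π * z) * e (-τ / 24) * ModularForm.eta τ ≠ 0 := by
      simp [hz, heta, e, Complex.exp_ne_zero]
    have h2 := mul_left_cancel₀ hne (hS'.trans hR'.symm)
    rw [show S - R = -R - -S by ring, Complex.exp_sub, h2, div_self (Complex.exp_ne_zero _)]
  let p : FormalMultilinearSeries ℂ ℂ ℂ := FormalMultilinearSeries.ofScalars ℂ d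
  have hp : HasFPowerSeriesAt f p 0 := by
    rw [hasFPowerSeriesAt_iff]
    filter_upwards [hsum] with z hz
    simpa [p, FormalMultilinearSeries.coeff_ofScalars] using hz.1
  have hf0 : f 0 = 0 := by
    have := hp.coeff_zero 0
    simpa [p, hd0, eq_comm] using this
  have hcont : ∀ᶠ z : ℂ in 𝓝 0, ‖f z‖ < 1 := by
    have := hp.continuousAt.norm
    exact this.eventually_lt_const (by simp [hf0])
  have hz1 : ∀ᶠ z : ℂ in 𝓝 0, ‖z‖ < 1 :=
    continuous_norm.continuousAt.eventually_lt_const (by simp)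
  have hfz : f =ᶠ[𝓝 0] 0 := by
    filter_upwards [hsum, hcont, hz1] with z ⟨_, h2⟩ h3 h4
    by_cases hz : z = 0
    · simp [hz, hf0]
    have hs : Complex.sin (π * z) ≠ 0 := by
      intro h0
      obtain ⟨m, hm⟩ := Complex.sin_eq_zero_iff.mp h0
      have hzm : z = m := by
        have : (π : ℂ) ≠ 0 := by simp [Real.pi_ne_zero]
        exact mul_left_cancel₀ this (by rw [hm]; ring)
      rw [hzm] at h4 hz
      rw [Complex.norm_intCast] at h4
      have : |m| < 1 := by exact_mod_cast h4
      exact hz (by simp [Int.abs_lt_one_iff.mp this])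
    obtain ⟨m, hm⟩ := Complex.exp_eq_one_iff.mp (h2 hs)
    have hm0 : m = 0 := by
      by_contra hm0
      have h5 : (1 : ℝ) ≤ |(m : ℝ)| := by exact_mod_cast Int.one_le_abs hm0
      rw [hm, norm_mul, Complex.norm_intCast] at h3
      have h6 : ‖(2 * π * I : ℂ)‖ = 2 * π := by
        simp [abs_of_pos Real.pi_pos]
      rw [h6] at h3
      nlinarith [Real.pi_gt_three]
    simp [hm, hm0]
  have hp0 : p = 0 := (hp.congr hfz).eq_zero
  funext k
  have h7 : d k = 0 := by
    have : p.coeff k = 0 := by rw [hp0]; simp [FormalMultilinearSeries.coeff]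
    simpa [p, FormalMultilinearSeries.coeff_ofScalars] using this
  rw [hd] at h7
  have h8 : ((2 * π * I) ^ (k : ℕ) / ((k : ℕ).factorial : ℂ)) ≠ 0 :=
    div_ne_zero (pow_ne_zero _ hpi) (by exact_mod_cast Nat.factorial_ne_zero _)
  exact sub_eq_zero.mp ((mul_eq_zero.mp h7).resolve_right h8)

/-- The false Eisenstein series `h_k(τ)`, `k ≥ 1`: the sequence that is defined by the identity
`IsFalseEisensteinSeq`. There is at most one such sequence (`IsFalseEisensteinSeq.unique`). -/
def falseEisenstein (k : ℕ+) (τ : ℍ) : ℂ :=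
  Classical.epsilon (IsFalseEisensteinSeq (τ : ℂ)) k

/-- The double sequence `c (k, l)`, with `c (0, 0) = 0`, consists of the exponential Taylor
coefficients in `z` and `z̄` of `Ĥ`: for all `z` near `0`,
`Ĥ(z;τ,w) = 2i sin(πz) [∂Ĥ/∂ζ]_{z=0}
  exp(-∑_{(k,l) ≠ (0,0)} c (k, l) (2πiz)^k/k! (2πiz̄)^l/l!)`. -/
def IsCompletedCoeffs (τ w : ℂ) (c : ℕ × ℕ → ℂ) : Prop :=
  c (0, 0) = 0 ∧
  ∀ᶠ z : ℂ in 𝓝 0, ∃ S : ℂ,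
    HasSum (fun p : ℕ × ℕ => c p * ((2 * π * I * z) ^ p.1 / (p.1.factorial : ℂ)) *
      ((2 * π * I * conj z) ^ p.2 / (p.2.factorial : ℂ))) S ∧
    HHat z τ w = 2 * I * Complex.sin (π * z) * HHatDeriv τ w * Complex.exp (-S)

/-- The denominator `cτ + d` for `γ = (a, b; c, d)`. -/
def den (γ : SL(2, ℤ)) (τ : ℂ) : ℂ := ((γ 1 0 : ℤ) : ℂ) * τ + ((γ 1 1 : ℤ) : ℂ)

/-- The sign `χ_{τ,w}(γ) = √(i(w-τ)/((cτ+d)(cw+d))) √(cτ+d) √(cw+d) / √(i(w-τ))`, for `τ ≠ w`, with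
principal square roots. -/
def chi (τ w : ℂ) (γ : SL(2, ℤ)) : ℂ :=
  Complex.sqrt (I * (w - τ) / (den γ τ * den γ w)) *
    (Complex.sqrt (den γ τ) * Complex.sqrt (den γ w)) / Complex.sqrt (I * (w - τ))

end

end FalseEis

/-! In the coordinates z = Aτ + B the series in Ĥ become, up to an explicit exponential, sums over x
= n + 1/2 + A of (-1)^n exp(πi x²τ + 2πi xB), with or without an error function of x. With A and B
as independent complex numbers these sums are holomorphic, and `thetaChar` is modular, SL₂(ℤ) acting
linearly on (A, B) (`exists_thetaSym_smul`). Differentiating in (A, B) gives the companion weighted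
by x, of weight 3/2 (`thetaSymD_smul`).

The error function makes the false theta series an Eichler integral: `psiChar` is a multiple of the
integral of the weight 3/2 series along the segment from τ to w, in the coordinate y with y² = i(v -
τ) at the point v (`psiChar_eq_thetaPrim`). A change of variable gives it the same multiplier as
`thetaChar` (`thetaPrim_smul`), provided that the root of i(w - τ) is transported by dividing by
√(cτ+d)√(cw+d). The sign χ measures how far the principal root departs from this rule.

Dividing Ĥ by 2i sin(πz) and replacing z̄ by a free variable u gives `polarH`, continuous and entire
in each variable. At the origin it equals -q^{-1/24}η(τ), by Euler's pentagonal number theorem, so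
it has a logarithm there with a double power series (`exists_hasSum_log_double`); ĥ_k is read off at
u = 0.

On 3τ the group Γ₀(3) permutes the shifts ±1/3 of A modulo 1, so `polarH` at u = 0 transforms like a
Jacobi form: z is rescaled by cτ+d, with a constant factor and the exponential of a multiple of z²
(`exists_polarH_smul`). In the logarithm the constant disappears and z² contributes to k = 2 only. A
sign χ = -1 negates the `psiChar` part, which by parity amounts to z ↦ -z; hence the factor χ^k.

For w = τ + it + ε with t → ∞, 1 + erf tends to 2 for n ≥ 0 and to 0 for n < 0, exponentially fast
and uniformly for z near 0. The limit of `polarH` is h/(2i sin πz), and the logarithmic coefficients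
converge by Weierstrass' theorem. -/

namespace FalseEis

noncomputable section

/-! ### Theta series with complex characteristics: convergence, holomorphy, shifts. -/

/-- The general term of the theta series with characteristics `(A, B)`. -/
def thetaTerm (A B τ : ℂ) (n : ℤ) : ℂ :=
  (-1) ^ n * cexp (π * I * ((n + 1 / 2 + A) ^ 2 * τ + 2 * (n + 1 / 2 + A) * B))

/-- The theta series with complex characteristics
`∑ (-1)^n exp(πi x²τ + 2πi x B)`, `x = n + 1/2 + A`. -/
def thetaChar (A B τ : ℂ) : ℂ := ∑' n : ℤ, thetaTerm A B τ n

/-- The weight `3/2` companion `∑ (-1)^n x exp(πi x²τ + 2πi x B)`, `x = n + 1/2 + A`. -/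
def thetaCharD (A B τ : ℂ) : ℂ := ∑' n : ℤ, (n + 1 / 2 + A) * thetaTerm A B τ n

lemma neg_one_zpow_norm (n : ℤ) : ‖(-1 : ℂ) ^ n‖ = 1 := by simp

lemma exists_summable_thetaTerm_bound {R δ : ℝ} (hR : 0 ≤ R) (hδ : 0 < δ) :
    ∃ u : ℤ → ℝ, Summable u ∧ ∀ (n : ℤ) (A B τ : ℂ), ‖A‖ ≤ R → ‖B‖ ≤ R → ‖τ‖ ≤ R → δ ≤ τ.im →
      ‖thetaTerm A B τ n‖ ≤ u n ∧ ‖(n + 1 / 2 + A) * thetaTerm A B τ n‖ ≤ u n := by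
  -- With κ = 1/2 + A the exponent is n²τ + n(2κτ + 2B) + (κ²τ + 2κB); C₁ and C₂ bound the last two
  -- brackets. The factor |n| + (R + 2) below dominates |x| and is at least 1, so that one majorant
  -- serves both series.
  set C₁ : ℝ := 2 * (R + 1) * R + 2 * R with hC₁
  set C₂ : ℝ := (R + 1) ^ 2 * R + 2 * (R + 1) * R with hC₂
  refine ⟨fun n => Real.exp (π * C₂) * ((|n| + (R + 2)) *
    Real.exp (-π * (δ * n ^ 2 - 2 * (C₁ / 2) * |n|))), ?_, ?_⟩
  · refine Summable.mul_left _ ?_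
    have h0 := (summable_pow_mul_jacobiTheta₂_term_bound (C₁ / 2) hδ 0).mul_left (R + 2)
    have h1 := summable_pow_mul_jacobiTheta₂_term_bound (C₁ / 2) hδ 1
    refine (h1.add h0).congr fun n => ?_
    push_cast
    ring
  · intro n A B τ hA hB hτ hδτ
    have hκ : ‖1 / 2 + A‖ ≤ R + 1 := by
      refine (norm_add_le _ _).trans ?_
      norm_num
      linarith
    have hx : ‖(n : ℂ) + 1 / 2 + A‖ ≤ |(n : ℝ)| + (R + 2) := by
      rw [add_assoc]
      refine (norm_add_le _ _).trans ?_
      rw [Complex.norm_intCast]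
      linarith
    have hn : ‖(n : ℂ)‖ = |(n : ℝ)| := Complex.norm_intCast n
    have hterm : ‖thetaTerm A B τ n‖ ≤ Real.exp (π * C₂) *
        Real.exp (-π * (δ * n ^ 2 - 2 * (C₁ / 2) * |n|)) := by
      rw [thetaTerm, norm_mul, neg_one_zpow_norm, one_mul, Complex.norm_exp, ← Real.exp_add]
      apply Real.exp_le_exp.mpr
      have e1 : (π * I * ((n + 1 / 2 + A) ^ 2 * τ + 2 * (n + 1 / 2 + A) * B) : ℂ) =
          ((π : ℝ) : ℂ) * (I * (((n ^ 2 : ℤ) : ℂ) * τ + (n * (2 * (1 / 2 + A) * τ + 2 * B) +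
            ((1 / 2 + A) ^ 2 * τ + 2 * (1 / 2 + A) * B)))) := by
        push_cast
        ring
      rw [e1, Complex.re_ofReal_mul]
      have e2 : ∀ v : ℂ, (I * v).re = -v.im := fun v => by simp
      rw [e2, Complex.add_im, Complex.add_im]
      have h3 : (((n ^ 2 : ℤ) : ℂ) * τ).im = n ^ 2 * τ.im := by
        rw [show ((n ^ 2 : ℤ) : ℂ) = (((n : ℝ) ^ 2 : ℝ) : ℂ) by push_cast; ring, Complex.im_ofReal_mul]
      have h4 : -((n : ℂ) * (2 * (1 / 2 + A) * τ + 2 * B)).im ≤ |(n : ℝ)| * C₁ := by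
        refine (neg_le_abs _).trans ((Complex.abs_im_le_norm _).trans ?_)
        rw [norm_mul, hn]
        gcongr
        refine (norm_add_le _ _).trans ?_
        simp only [norm_mul, Complex.norm_ofNat]
        rw [hC₁]
        gcongr
      have h5 : -(((1 / 2 + A) ^ 2 * τ + 2 * (1 / 2 + A) * B)).im ≤ C₂ := by
        refine (neg_le_abs _).trans ((Complex.abs_im_le_norm _).trans ?_)
        refine (norm_add_le _ _).trans ?_
        simp only [norm_mul, norm_pow, Complex.norm_ofNat]
        rw [hC₂]
        gcongr
      have h6 : (n : ℝ) ^ 2 * δ ≤ n ^ 2 * τ.im := by gcongr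
      rw [h3]
      have : -((n : ℝ) ^ 2 * τ.im + (((n : ℂ) * (2 * (1 / 2 + A) * τ + 2 * B)).im +
          ((1 / 2 + A) ^ 2 * τ + 2 * (1 / 2 + A) * B).im)) ≤
          C₂ - (δ * n ^ 2 - 2 * (C₁ / 2) * |n|) := by
        push_cast
        linarith
      have := mul_le_mul_of_nonneg_left this Real.pi_pos.le
      linarith
    have h0 : (0 : ℝ) ≤ |(n : ℝ)| := abs_nonneg _
    constructor
    · refine hterm.trans (mul_le_mul_of_nonneg_left ?_ (Real.exp_nonneg _))
      refine le_mul_of_one_le_left (Real.exp_nonneg _) ?_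
      push_cast
      linarith
    · rw [norm_mul]
      push_cast
      refine (mul_le_mul hx hterm (norm_nonneg _) (by positivity)).trans (le_of_eq ?_)
      push_cast
      ring

lemma hasSum_thetaChar (A B : ℂ) {τ : ℂ} (hτ : 0 < τ.im) :
    HasSum (thetaTerm A B τ) (thetaChar A B τ) := by
  obtain ⟨u, hu, h⟩ := exists_summable_thetaTerm_bound
    (R := ‖A‖ + ‖B‖ + ‖τ‖) (by positivity) hτ
  refine (hu.of_norm_bounded fun n => (h n A B τ ?_ ?_ ?_ le_rfl).1).hasSum <;>
    linarith [norm_nonneg A, norm_nonneg B, norm_nonneg τ]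

lemma hasSum_thetaCharD (A B : ℂ) {τ : ℂ} (hτ : 0 < τ.im) :
    HasSum (fun n : ℤ => (n + 1 / 2 + A) * thetaTerm A B τ n) (thetaCharD A B τ) := by
  obtain ⟨u, hu, h⟩ := exists_summable_thetaTerm_bound
    (R := ‖A‖ + ‖B‖ + ‖τ‖) (by positivity) hτ
  refine (hu.of_norm_bounded fun n => (h n A B τ ?_ ?_ ?_ le_rfl).2).hasSum <;>
    linarith [norm_nonneg A, norm_nonneg B, norm_nonneg τ]

/-- A sum whose terms obey the same bounds as those of the theta series is holomorphic along
holomorphic families of characteristics. -/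
lemma differentiableOn_tsum_thetaTerm_mul {a b c : ℂ → ℂ} {U : Set ℂ} (hU : IsOpen U)
    (ha : DifferentiableOn ℂ a U) (hb : DifferentiableOn ℂ b U) (hc : DifferentiableOn ℂ c U)
    (hc' : ∀ z ∈ U, 0 < (c z).im) (D : Bool) :
    DifferentiableOn ℂ (fun z => ∑' n : ℤ, (if D then (n + 1 / 2 + a z) else 1) *
      thetaTerm (a z) (b z) (c z) n) U := by
  intro z₀ hz₀
  set R : ℝ := ‖a z₀‖ + ‖b z₀‖ + ‖c z₀‖ + 1
  have p1 := norm_nonneg (a z₀)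
  have p2 := norm_nonneg (b z₀)
  have p3 := norm_nonneg (c z₀)
  have hca := (ha z₀ hz₀).differentiableAt (hU.mem_nhds hz₀) |>.continuousAt
  have hcb := (hb z₀ hz₀).differentiableAt (hU.mem_nhds hz₀) |>.continuousAt
  have hcc := (hc z₀ hz₀).differentiableAt (hU.mem_nhds hz₀) |>.continuousAt
  have him : ContinuousAt (fun z => (c z).im) z₀ := Complex.continuous_im.continuousAt.comp hcc
  have hev : ∀ᶠ z in 𝓝 z₀, (‖a z‖ < R ∧ ‖b z‖ < R ∧ ‖c z‖ < R ∧ (c z₀).im / 2 < (c z).im) ∧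
      z ∈ U := by
    refine ((hca.norm.eventually_lt_const (by simp only [R]; linarith)).and
      ((hcb.norm.eventually_lt_const (by simp only [R]; linarith)).and
      ((hcc.norm.eventually_lt_const (by simp only [R]; linarith)).and
      (him.eventually_const_lt (by linarith [hc' z₀ hz₀]))))).and (hU.mem_nhds hz₀)
  obtain ⟨V, hV, hVo, hzV⟩ := eventually_nhds_iff.mp hev
  obtain ⟨u, hu, h⟩ := exists_summable_thetaTerm_bound (R := R) (δ := (c z₀).im / 2)
    (by simp only [R]; linarith) (by linarith [hc' z₀ hz₀])
  have hVU : V ⊆ U := fun z hz => (hV z hz).2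
  refine ((differentiableOn_tsum_of_summable_norm hu (fun n => ?_) hVo fun n z hz => ?_).differentiableAt
    (hVo.mem_nhds hzV)).differentiableWithinAt
  · have ha' := ha.mono hVU
    have hb' := hb.mono hVU
    have hc'' := hc.mono hVU
    refine DifferentiableOn.mul (by cases D <;> simp only [Bool.false_eq_true, if_true, if_false] <;> fun_prop) ?_
    simp only [thetaTerm]
    fun_prop
  · obtain ⟨⟨h1, h2, h3, h4⟩, -⟩ := hV z hz
    have := h n (a z) (b z) (c z) h1.le h2.le h3.le h4.le
    cases D
    · simpa using this.1
    · simpa using this.2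

lemma differentiableOn_thetaChar {a b c : ℂ → ℂ} {U : Set ℂ} (hU : IsOpen U)
    (ha : DifferentiableOn ℂ a U) (hb : DifferentiableOn ℂ b U) (hc : DifferentiableOn ℂ c U)
    (hc' : ∀ z ∈ U, 0 < (c z).im) :
    DifferentiableOn ℂ (fun z => thetaChar (a z) (b z) (c z)) U := by
  simpa [thetaChar] using differentiableOn_tsum_thetaTerm_mul hU ha hb hc hc' false

lemma differentiableOn_thetaCharD {a b c : ℂ → ℂ} {U : Set ℂ} (hU : IsOpen U)
    (ha : DifferentiableOn ℂ a U) (hb : DifferentiableOn ℂ b U) (hc : DifferentiableOn ℂ c U)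
    (hc' : ∀ z ∈ U, 0 < (c z).im) :
    DifferentiableOn ℂ (fun z => thetaCharD (a z) (b z) (c z)) U := by
  simpa [thetaCharD] using differentiableOn_tsum_thetaTerm_mul hU ha hb hc hc' true

lemma continuous_thetaChar {X : Type*} [TopologicalSpace X] {a b : X → ℂ} {τ : ℂ}
    (ha : Continuous a) (hb : Continuous b) (hτ : 0 < τ.im) :
    Continuous fun x => thetaChar (a x) (b x) τ := by
  rw [continuous_iff_continuousAt]
  intro x₀
  set R : ℝ := ‖a x₀‖ + ‖b x₀‖ + ‖τ‖ + 1 with hR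
  have p1 := norm_nonneg (a x₀)
  have p2 := norm_nonneg (b x₀)
  have p3 := norm_nonneg τ
  obtain ⟨V, hV, hVo, hzV⟩ := eventually_nhds_iff.mp
    ((ha.norm.continuousAt.eventually_lt_const (show ‖a x₀‖ < R by linarith)).and
      (hb.norm.continuousAt.eventually_lt_const (show ‖b x₀‖ < R by linarith)))
  obtain ⟨u, hu, h⟩ := exists_summable_thetaTerm_bound (R := R) (by linarith) hτ
  refine (continuousOn_tsum (fun n => ?_) hu fun n x hx => ?_).continuousAt (hVo.mem_nhds hzV)
  · simp only [thetaTerm]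
    fun_prop
  · exact (h n _ _ _ (hV x hx).1.le (hV x hx).2.le (by linarith) le_rfl).1

lemma neg_one_zpow_sub_one_sub (n : ℤ) : (-1 : ℂ) ^ (-1 - n) = -(-1) ^ n := by
  rw [zpow_sub₀ (by norm_num), zpow_neg_one]
  rcases Int.even_or_odd n with h | h
  · simp [h.neg_one_zpow]
  · simp [h.neg_one_zpow]

/-- The reflection n ↦ -1 - n negates n + 1/2 and flips the sign (-1)^n; this makes `thetaChar` odd
in its characteristics. -/
lemma thetaTerm_neg (A B τ : ℂ) (n : ℤ) :
    thetaTerm (-A) (-B) τ n = -thetaTerm A B τ (-1 - n) := by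
  simp only [thetaTerm, neg_one_zpow_sub_one_sub]
  push_cast
  rw [show (n + 1 / 2 + -A) ^ 2 * τ + 2 * (n + 1 / 2 + -A) * -B =
    (-1 - n + 1 / 2 + A) ^ 2 * τ + 2 * (-1 - n + 1 / 2 + A) * B by ring]
  ring

lemma thetaTerm_add_int_left (A B τ : ℂ) (m n : ℤ) :
    thetaTerm (A + m) B τ n = (-1) ^ m * thetaTerm A B τ (n + m) := by
  simp only [thetaTerm, zpow_add₀ (show (-1 : ℂ) ≠ 0 by norm_num)]
  have : (-1 : ℂ) ^ m * (-1) ^ m = 1 := by rw [← mul_zpow]; simp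
  push_cast
  rw [show (n : ℂ) + m + 1 / 2 + A = n + 1 / 2 + (A + m) by ring]
  linear_combination (-1 : ℂ) ^ n * cexp (π * I * ((n + 1 / 2 + (A + m)) ^ 2 * τ +
    2 * (n + 1 / 2 + (A + m)) * B)) * (-this)

lemma exp_pi_mul_I_mul_int (m : ℤ) : cexp (π * I * m) = (-1) ^ m := by
  rw [mul_comm, Complex.exp_int_mul, Complex.exp_pi_mul_I]

lemma thetaTerm_add_int_right (A B τ : ℂ) (m n : ℤ) :
    thetaTerm A (B + m) τ n = (-1) ^ m * cexp (2 * π * I * A * m) * thetaTerm A B τ n := by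
  simp only [thetaTerm]
  rw [← exp_pi_mul_I_mul_int m]
  have h : cexp (2 * π * I * ((n * m : ℤ) : ℂ)) = 1 := by
    rw [mul_comm, Complex.exp_int_mul_two_pi_mul_I]
  have : (π * I * ((n + 1 / 2 + A) ^ 2 * τ + 2 * (n + 1 / 2 + A) * (B + m)) : ℂ) =
    π * I * m + 2 * π * I * A * m + π * I * ((n + 1 / 2 + A) ^ 2 * τ + 2 * (n + 1 / 2 + A) * B) +
      2 * π * I * ((n * m : ℤ) : ℂ) := by
    push_cast; ring
  rw [this, Complex.exp_add _ (2 * π * I * ((n * m : ℤ) : ℂ)), h, Complex.exp_add, Complex.exp_add]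
  ring

lemma thetaChar_neg (A B τ : ℂ) : thetaChar (-A) (-B) τ = -thetaChar A B τ := by
  simp only [thetaChar, thetaTerm_neg, tsum_neg]
  rw [← (Equiv.subLeft (-1 : ℤ)).tsum_eq (fun n => thetaTerm A B τ n)]
  rfl

lemma thetaChar_add_int_left (A B τ : ℂ) (m : ℤ) :
    thetaChar (A + m) B τ = (-1) ^ m * thetaChar A B τ := by
  simp only [thetaChar, thetaTerm_add_int_left, tsum_mul_left]
  rw [← (Equiv.addRight m).tsum_eq (fun n => thetaTerm A B τ n)]
  rfl

lemma thetaChar_add_int_right (A B τ : ℂ) (m : ℤ) :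
    thetaChar A (B + m) τ = (-1) ^ m * cexp (2 * π * I * A * m) * thetaChar A B τ := by
  simp only [thetaChar, thetaTerm_add_int_right, tsum_mul_left]

/-- The theta series with characteristics in terms of Mathlib's two-variable theta function. -/
lemma thetaChar_eq_jacobiTheta₂ (A B τ : ℂ) :
    thetaChar A B τ = cexp (π * I * ((1 / 2 + A) ^ 2 * τ + 2 * (1 / 2 + A) * B)) *
      jacobiTheta₂ ((1 / 2 + A) * τ + B + 1 / 2) τ := by
  simp only [thetaChar, jacobiTheta₂, ← tsum_mul_left]
  refine tsum_congr fun n => ?_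
  rw [thetaTerm, jacobiTheta₂_term, ← exp_pi_mul_I_mul_int, ← Complex.exp_add, ← Complex.exp_add]
  congr 1
  ring

/-! ### Modularity of the theta series under SL₂(ℤ). -/

lemma den_ne_zero (γ : SL(2, ℤ)) (τ : ℍ) : den γ τ ≠ 0 := by
  have := UpperHalfPlane.denom_ne_zero (γ : GL (Fin 2) ℝ) τ
  simpa [UpperHalfPlane.denom, den] using this

lemma coe_sl2_smul (γ : SL(2, ℤ)) (τ : ℍ) :
    ((γ • τ : ℍ) : ℂ) = (((γ 0 0 : ℤ) : ℂ) * τ + ((γ 0 1 : ℤ) : ℂ)) / den γ τ := by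
  rw [UpperHalfPlane.coe_specialLinearGroup_apply]
  simp [den]

lemma sl2_det (γ : SL(2, ℤ)) : γ 0 0 * γ 1 1 - γ 0 1 * γ 1 0 = 1 := by
  rw [← Matrix.det_fin_two]; exact γ.det_coe

lemma sl2_det_complex (γ : SL(2, ℤ)) :
    ((γ 0 0 : ℤ) : ℂ) * ((γ 1 1 : ℤ) : ℂ) - ((γ 0 1 : ℤ) : ℂ) * ((γ 1 0 : ℤ) : ℂ) = 1 := by
  exact_mod_cast sl2_det γ

lemma den_mul (γ γ' : SL(2, ℤ)) (τ : ℍ) :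
    den (γ * γ') τ = den γ ((γ' • τ : ℍ) : ℂ) * den γ' τ := by
  have h := den_ne_zero γ' τ
  rw [coe_sl2_smul]
  rw [den, den, div_eq_mul_inv]
  have : (den γ' τ)⁻¹ * den γ' τ = 1 := inv_mul_cancel₀ h
  simp only [Matrix.SpecialLinearGroup.coe_mul, Matrix.mul_apply, Fin.sum_univ_two]
  push_cast
  have h2 : den γ' τ = ((γ' 1 0 : ℤ) : ℂ) * τ + ((γ' 1 1 : ℤ) : ℂ) := rfl
  linear_combination (-((γ 1 0 : ℤ) : ℂ) * (((γ' 0 0 : ℤ) : ℂ) * τ + ((γ' 0 1 : ℤ) : ℂ))) * this -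
    ((γ 1 1 : ℤ) : ℂ) * h2

lemma continuous_sl2_smul (γ : SL(2, ℤ)) : Continuous fun τ : ℍ => γ • τ := by
  rw [UpperHalfPlane.isEmbedding_coe.continuous_iff]
  have : ((↑) : ℍ → ℂ) ∘ (fun τ : ℍ => γ • τ) = fun τ : ℍ =>
      (((γ 0 0 : ℤ) : ℂ) * τ + ((γ 0 1 : ℤ) : ℂ)) / den γ τ := funext fun τ => coe_sl2_smul γ τ
  rw [this]
  refine Continuous.div ?_ ?_ fun τ => den_ne_zero γ τ
  · fun_prop
  · simp only [den]
    fun_prop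

/-- The theta series with the normalization that makes its modular transformation linear in the
characteristics. -/
def thetaSym (A B τ : ℂ) : ℂ := cexp (-π * I * A * B) * thetaChar A B τ

/-- The weight `3/2` companion of `thetaSym`. -/
def thetaSymD (A B τ : ℂ) : ℂ := cexp (-π * I * A * B) * thetaCharD A B τ

/-- Modularity of `thetaSym` under `γ`, with a continuous multiplier that is a square root of a
multiple of `cτ + d`. -/
def ThetaLaw (γ : SL(2, ℤ)) : Prop :=
  ∃ (r : ℍ → ℂ) (M : ℂ), Continuous r ∧ M ≠ 0 ∧ (∀ τ : ℍ, r τ ^ 2 = M * den γ τ) ∧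
    ∀ (τ : ℍ) (A B : ℂ), thetaSym A B (γ • τ : ℍ) =
      r τ * thetaSym ((γ 0 0 : ℤ) * A + (γ 1 0 : ℤ) * B) ((γ 0 1 : ℤ) * A + (γ 1 1 : ℤ) * B) τ

lemma thetaLaw_one : ThetaLaw 1 :=
  ⟨fun _ => 1, 1, continuous_const, one_ne_zero, fun τ => by simp [den], fun τ A B => by simp⟩

lemma thetaLaw_mul {γ γ' : SL(2, ℤ)} (h : ThetaLaw γ) (h' : ThetaLaw γ') :
    ThetaLaw (γ * γ') := by
  obtain ⟨r, M, hr, hM, hsq, hl⟩ := h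
  obtain ⟨r', M', hr', hM', hsq', hl'⟩ := h'
  refine ⟨fun τ => r (γ' • τ) * r' τ, M * M', (hr.comp (continuous_sl2_smul γ')).mul hr',
    mul_ne_zero hM hM', fun τ => ?_, fun τ A B => ?_⟩
  · rw [mul_pow, hsq, hsq', den_mul]; ring
  · rw [mul_smul, hl, hl', mul_assoc]
    congr 2
    simp only [Matrix.SpecialLinearGroup.coe_mul, Matrix.mul_apply, Fin.sum_univ_two]
    push_cast
    congr 1 <;> ring

lemma thetaLaw_inv {γ : SL(2, ℤ)} (h : ThetaLaw γ) : ThetaLaw γ⁻¹ := by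
  obtain ⟨r, M, hr, hM, hsq, hl⟩ := h
  have hr0 : ∀ τ, r τ ≠ 0 := fun τ h0 => by
    have := hsq τ
    rw [h0, zero_pow two_ne_zero, eq_comm] at this
    exact mul_ne_zero hM (den_ne_zero γ τ) this
  refine ⟨fun τ => (r (γ⁻¹ • τ))⁻¹, M⁻¹, (hr.comp (continuous_sl2_smul γ⁻¹)).inv₀ fun _ => hr0 _,
    inv_ne_zero hM, fun τ => ?_, fun τ A B => ?_⟩
  · have h1 : den γ ((γ⁻¹ • τ : ℍ) : ℂ) * den γ⁻¹ τ = 1 := by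
      rw [← den_mul, mul_inv_cancel]; simp [den]
    rw [inv_pow, hsq, mul_inv, eq_inv_of_mul_eq_one_right h1]
  · have e00 : (γ⁻¹) 0 0 = γ 1 1 := by simp [Matrix.SpecialLinearGroup.coe_inv, Matrix.adjugate_fin_two]
    have e01 : (γ⁻¹) 0 1 = -γ 0 1 := by simp [Matrix.SpecialLinearGroup.coe_inv, Matrix.adjugate_fin_two]
    have e10 : (γ⁻¹) 1 0 = -γ 1 0 := by simp [Matrix.SpecialLinearGroup.coe_inv, Matrix.adjugate_fin_two]
    have e11 : (γ⁻¹) 1 1 = γ 0 0 := by simp [Matrix.SpecialLinearGroup.coe_inv, Matrix.adjugate_fin_two]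
    rw [e00, e01, e10, e11]
    have hd := sl2_det_complex γ
    have := hl (γ⁻¹ • τ) ((γ 1 1 : ℤ) * A + (-γ 1 0 : ℤ) * B) ((-γ 0 1 : ℤ) * A + (γ 0 0 : ℤ) * B)
    rw [smul_inv_smul] at this
    rw [this, inv_mul_cancel_left₀ (hr0 _)]
    push_cast
    congr 1
    · linear_combination -A * hd
    · linear_combination -B * hd

lemma thetaLaw_T : ThetaLaw ModularGroup.T := by
  refine ⟨fun _ => cexp (π * I / 4), cexp (π * I / 4) ^ 2, continuous_const, by simp, fun τ => ?_,
    fun τ A B => ?_⟩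
  · simp [den, ModularGroup.T]
  · rw [UpperHalfPlane.modular_T_smul, UpperHalfPlane.coe_vadd]
    simp only [thetaSym, thetaChar, ← tsum_mul_left]
    refine tsum_congr fun n => ?_
    -- Since (n + 1/2)² = n(n+1) + 1/4 with n(n+1) even, the translation costs only exp(πi/4) and
    -- moves B to A + B.
    have h : cexp (2 * π * I * ((n * (n + 1) / 2 : ℤ) : ℂ)) = 1 := by
      rw [mul_comm, Complex.exp_int_mul_two_pi_mul_I]
    have h2 : (n : ℂ) * (n + 1) = 2 * ((n * (n + 1) / 2 : ℤ) : ℂ) := by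
      have := Int.two_mul_ediv_two_of_even (Int.even_mul_succ_self n)
      exact_mod_cast this.symm
    simp only [thetaTerm, ModularGroup.T]
    simp only [Matrix.of_apply, Matrix.cons_val', Matrix.cons_val_zero,
      Matrix.cons_val_one, Matrix.cons_val_fin_one, Int.cast_one, Int.cast_zero, one_mul, zero_mul,
      add_zero, Complex.ofReal_one]
    rw [mul_left_comm, ← Complex.exp_add, mul_left_comm (cexp (-π * I * A * (A + B))),
      mul_left_comm (cexp (π * I / 4)), ← Complex.exp_add, ← Complex.exp_add]
    congr 1
    rw [show -π * I * A * B + π * I * ((n + 1 / 2 + A) ^ 2 * (1 + (τ : ℂ)) + 2 * (n + 1 / 2 + A) * B) =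
      π * I / 4 + (-π * I * A * (A + B) + π * I * ((n + 1 / 2 + A) ^ 2 * (τ : ℂ) +
        2 * (n + 1 / 2 + A) * (A + B))) + 2 * π * I * ((n * (n + 1) / 2 : ℤ) : ℂ) by
        linear_combination (π * I) * h2, Complex.exp_add _ (2 * π * I * _), h, mul_one]

lemma thetaLaw_S : ThetaLaw ModularGroup.S := by
  refine ⟨fun τ => -I * (-I * (τ : ℂ)) ^ (1 / 2 : ℂ), I, ?_, I_ne_zero, fun τ => ?_,
    fun τ A B => ?_⟩
  · refine continuous_const.mul ?_
    refine Continuous.cpow (by fun_prop) continuous_const fun τ => ?_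
    left
    simp [τ.im_pos]
  · rw [mul_pow, ← Complex.cpow_nat_mul]
    simp [den, ModularGroup.S]
  · have hτ := UpperHalfPlane.ne_zero τ
    have hc : (-I * (τ : ℂ)) ^ (1 / 2 : ℂ) ≠ 0 := by
      simp [Complex.cpow_eq_zero_iff, hτ]
    -- S carries (A, B) to (B, -A); the theta argument (1/2 + B)τ - A + 1/2 exceeds the point used
    -- here by the period 1.
    have hf := jacobiTheta₂_functional_equation ((B + 1 / 2) * τ - A - 1 / 2) τ
    rw [coe_sl2_smul]
    simp only [den, ModularGroup.S, Matrix.SpecialLinearGroup.coe_mk, Matrix.of_apply,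
      Matrix.cons_val', Matrix.cons_val_zero, Matrix.cons_val_one, Matrix.cons_val_fin_one,
      Int.cast_one, Int.cast_zero, one_mul, zero_mul, zero_add, add_zero, Int.cast_neg,
      neg_one_mul]
    simp only [thetaSym, thetaChar_eq_jacobiTheta₂]
    rw [show (1 / 2 + B) * (τ : ℂ) + -A + 1 / 2 = ((B + 1 / 2) * τ - A - 1 / 2) + 1 by ring,
      jacobiTheta₂_add_left, hf,
      show (1 / 2 + A) * (-1 / (τ : ℂ)) + B + 1 / 2 = ((B + 1 / 2) * τ - A - 1 / 2) / τ by
        field_simp; ring]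
    have hI : -I = cexp (-(π / 2) * I) := by
      rw [neg_mul, Complex.exp_neg, Complex.exp_pi_div_two_mul_I]; simp
    generalize jacobiTheta₂ (((B + 1 / 2) * τ - A - 1 / 2) / τ) (-1 / τ) = J
    generalize (-I * (τ : ℂ)) ^ (1 / 2 : ℂ) = s at hc ⊢
    have hexp : cexp (-π * I * A * B) * cexp (π * I * ((1 / 2 + A) ^ 2 * (-1 / (τ : ℂ)) +
        2 * (1 / 2 + A) * B)) = cexp (-(π / 2) * I) * (cexp (-π * I * B * -A) *
        (cexp (π * I * ((1 / 2 + B) ^ 2 * τ + 2 * (1 / 2 + B) * -A)) *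
          cexp (-π * I * ((B + 1 / 2) * τ - A - 1 / 2) ^ 2 / τ))) := by
      simp only [← Complex.exp_add]
      congr 1
      field_simp
      ring
    rw [← hI] at hexp
    rw [← mul_assoc, hexp]
    field_simp

/-- Principal roots are multiplicative only up to sign. Requiring just that the square of the
multiplier be a multiple of cτ+d makes the law stable under products and inverses, so the generators
suffice. -/
theorem thetaLaw (γ : SL(2, ℤ)) : ThetaLaw γ := by
  have : γ ∈ Subgroup.closure {ModularGroup.S, ModularGroup.T} := by
    simp [SpecialLinearGroup.SL2Z_generators]
  induction this using Subgroup.closure_induction with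
  | one => exact thetaLaw_one
  | mem g hg =>
    rcases hg with rfl | rfl
    · exact thetaLaw_S
    · exact thetaLaw_T
  | mul g h _ _ ig ih => exact thetaLaw_mul ig ih
  | inv g _ ig => exact thetaLaw_inv ig

lemma sqrt_sq (z : ℂ) : Complex.sqrt z ^ 2 = z := by
  rw [Complex.sqrt, ← Complex.cpow_nat_mul]; simp

lemma sqrt_ne_zero {z : ℂ} (hz : z ≠ 0) : Complex.sqrt z ≠ 0 := fun h => by
  have := sqrt_sq z
  rw [h] at this
  exact hz (by simpa using this.symm)

lemma den_im (γ : SL(2, ℤ)) (τ : ℂ) : (den γ τ).im = γ 1 0 * τ.im := by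
  simp [den]

/-- For c ≠ 0 the values cτ+d stay off the real axis, hence off the branch cut; for c = 0 they are
constant, possibly on the cut. -/
lemma continuous_sqrt_den (γ : SL(2, ℤ)) : Continuous fun τ : ℍ => Complex.sqrt (den γ τ) := by
  by_cases hc : γ 1 0 = 0
  · have : ∀ τ : ℍ, den γ τ = ((γ 1 1 : ℤ) : ℂ) := fun τ => by simp [den, hc]
    simp only [this]
    exact continuous_const
  · rw [continuous_iff_continuousAt]
    intro τ
    refine ContinuousAt.comp (f := fun τ : ℍ => den γ τ) (Complex.continuousAt_sqrt (Or.inr ?_)) ?_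
    · rw [den_im]
      exact mul_ne_zero (by exact_mod_cast hc) τ.im_ne_zero
    · simp only [den]
      fun_prop

/-- Modularity of the theta series with the principal square root of `cτ + d`. -/
theorem exists_thetaSym_smul (γ : SL(2, ℤ)) : ∃ m : ℂ, m ≠ 0 ∧ ∀ (τ : ℍ) (A B : ℂ),
    thetaSym A B (γ • τ : ℍ) = m * Complex.sqrt (den γ τ) *
      thetaSym ((γ 0 0 : ℤ) * A + (γ 1 0 : ℤ) * B) ((γ 0 1 : ℤ) * A + (γ 1 1 : ℤ) * B) τ := by
  obtain ⟨r, M, hr, hM, hsq, hl⟩ := thetaLaw γ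
  have hs0 : ∀ τ : ℍ, Complex.sqrt (den γ τ) ≠ 0 := fun τ => sqrt_ne_zero (den_ne_zero γ τ)
  have hq : Continuous fun τ : ℍ => r τ / Complex.sqrt (den γ τ) :=
    hr.div₀ (continuous_sqrt_den γ) hs0
  have hq2 : ∀ τ : ℍ, (r τ / Complex.sqrt (den γ τ)) ^ 2 = M := fun τ => by
    rw [div_pow, hsq, sqrt_sq, mul_div_cancel_right₀ _ (den_ne_zero γ τ)]
  set m : ℂ := r UpperHalfPlane.I / Complex.sqrt (den γ UpperHalfPlane.I) with hm
  have hm2 : m ^ 2 = M := hq2 _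
  have hm0 : m ≠ 0 := fun h => hM (by rw [← hm2, h]; simp)
  -- The quotient is continuous with constant square, so it takes only the values ±m and cannot
  -- change sign on the connected space ℍ.
  have hconst : ∀ τ : ℍ, r τ / Complex.sqrt (den γ τ) = m := by
    have hcl : IsClopen {τ : ℍ | r τ / Complex.sqrt (den γ τ) = m} := by
      refine ⟨isClosed_eq hq continuous_const, ?_⟩
      have : {τ : ℍ | r τ / Complex.sqrt (den γ τ) = m} =
          {τ : ℍ | r τ / Complex.sqrt (den γ τ) = -m}ᶜ := by
        ext τ
        simp only [Set.mem_ofPred_eq, Set.mem_compl_iff]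
        constructor
        · intro h h'
          exact hm0 (self_eq_neg.mp (h.symm.trans h'))
        · intro h
          exact (sq_eq_sq_iff_eq_or_eq_neg.mp ((hq2 τ).trans hm2.symm)).resolve_right h
      rw [this, isOpen_compl_iff]
      exact isClosed_eq hq continuous_const
    have := hcl.eq_univ ⟨UpperHalfPlane.I, rfl⟩
    exact fun τ => Set.eq_univ_iff_forall.mp this τ
  refine ⟨m, hm0, fun τ A B => ?_⟩
  rw [hl, ← hconst τ, div_mul_cancel₀ _ (hs0 τ)]

/-- In the direction (c, d) the exponent πi(x²τ + 2xB) has derivative 2πi(x(cτ+d) + cB): this is the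
source of the additional factor cτ+d in weight 3/2. -/
lemma deriv_thetaChar (A B c d : ℂ) {τ : ℂ} (hτ : 0 < τ.im) :
    HasDerivAt (fun h => thetaChar (A + c * h) (B + d * h) τ)
      (2 * π * I * ((c * τ + d) * thetaCharD A B τ + c * B * thetaChar A B τ)) 0 := by
  set R : ℝ := ‖A‖ + ‖B‖ + ‖τ‖ + 1 with hR
  have p1 := norm_nonneg A
  have p2 := norm_nonneg B
  have p3 := norm_nonneg τ
  have ha : Continuous fun h : ℂ => A + c * h := by fun_prop
  have hb : Continuous fun h : ℂ => B + d * h := by fun_prop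
  obtain ⟨V, hV, hVo, hzV⟩ := eventually_nhds_iff.mp
    (((ha.norm.tendsto 0).eventually_lt_const (show ‖A + c * 0‖ < R by
      rw [mul_zero, add_zero]; linarith)).and
      ((hb.norm.tendsto 0).eventually_lt_const (show ‖B + d * 0‖ < R by
      rw [mul_zero, add_zero]; linarith)))
  obtain ⟨u, hu, h⟩ := exists_summable_thetaTerm_bound (R := R) (by linarith) hτ
  have hdiff : ∀ n, Differentiable ℂ fun h => thetaTerm (A + c * h) (B + d * h) τ n := fun n => by
    simp only [thetaTerm]; fun_prop
  have hs := hasSum_deriv_of_summable_norm hu (fun n => (hdiff n).differentiableOn) hVo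
    (fun n z hz => (h n _ _ _ (hV z hz).1.le (hV z hz).2.le (by linarith) le_rfl).1) hzV
  have hd : DifferentiableAt ℂ (fun h => thetaChar (A + c * h) (B + d * h) τ) 0 :=
    (differentiableOn_thetaChar isOpen_univ (by fun_prop) (by fun_prop) (by fun_prop)
      (fun _ _ => hτ)).differentiableAt univ_mem
  refine hd.hasDerivAt.congr_deriv (hs.unique ?_)
  have key := (((hasSum_thetaCharD A B hτ).mul_left (c * τ + d)).add
    ((hasSum_thetaChar A B hτ).mul_left (c * B))).mul_left (2 * π * I)
  refine Eq.subst (motive := fun f => HasSum f _) (funext fun n => ?_) key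
  have h1 : HasDerivAt (fun h : ℂ => A + c * h) c 0 := by
    simpa using ((hasDerivAt_id (0 : ℂ)).const_mul c).const_add A
  have h2 : HasDerivAt (fun h : ℂ => B + d * h) d 0 := by
    simpa using ((hasDerivAt_id (0 : ℂ)).const_mul d).const_add B
  have h3 : HasDerivAt (fun h : ℂ => (n : ℂ) + 1 / 2 + (A + c * h)) c 0 := h1.const_add _
  have h4 := (((((h3.pow 2).mul_const τ).add ((h3.const_mul 2).mul h2)).const_mul
    (π * I)).cexp).const_mul ((-1 : ℂ) ^ n)
  refine Eq.trans ?_ h4.deriv.symm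
  simp [thetaTerm]
  ring

/-- Modularity of the weight `3/2` companion, with the same constant. -/
theorem thetaSymD_smul {γ : SL(2, ℤ)} {m : ℂ} (hm : ∀ (τ : ℍ) (A B : ℂ),
    thetaSym A B (γ • τ : ℍ) = m * Complex.sqrt (den γ τ) *
      thetaSym ((γ 0 0 : ℤ) * A + (γ 1 0 : ℤ) * B) ((γ 0 1 : ℤ) * A + (γ 1 1 : ℤ) * B) τ)
    (τ : ℍ) (A B : ℂ) :
    thetaSymD A B (γ • τ : ℍ) = m * Complex.sqrt (den γ τ) * den γ τ *
      thetaSymD ((γ 0 0 : ℤ) * A + (γ 1 0 : ℤ) * B) ((γ 0 1 : ℤ) * A + (γ 1 1 : ℤ) * B) τ := by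
  have key : ∀ (A B c d : ℂ) (τ : ℍ), HasDerivAt (fun h => thetaSym (A + c * h) (B + d * h) τ)
      (2 * π * I * ((c * τ + d) * thetaSymD A B τ) + π * I * (c * B - d * A) * thetaSym A B τ)
      0 := by
    intro A B c d τ
    have h1 : HasDerivAt (fun h : ℂ => A + c * h) c 0 := by
      simpa using ((hasDerivAt_id (0 : ℂ)).const_mul c).const_add A
    have h2 : HasDerivAt (fun h : ℂ => B + d * h) d 0 := by
      simpa using ((hasDerivAt_id (0 : ℂ)).const_mul d).const_add B
    have h3 := (((h1.const_mul (-π * I)).mul h2).cexp).mul (deriv_thetaChar A B c d τ.im_pos)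
    refine h3.congr_deriv ?_
    simp only [thetaSym, thetaSymD, Pi.mul_apply, mul_zero, add_zero]
    ring
  -- Moving B alone on the left moves the transformed pair in the direction (c, d) on the right. The
  -- undifferentiated terms then cancel because the determinant is 1.
  have hl := key A B 0 1 (γ • τ)
  have hr := (key ((γ 0 0 : ℤ) * A + (γ 1 0 : ℤ) * B) ((γ 0 1 : ℤ) * A + (γ 1 1 : ℤ) * B)
    (γ 1 0 : ℤ) (γ 1 1 : ℤ) τ).const_mul (m * Complex.sqrt (den γ τ))
  have he : (fun h => thetaSym (A + 0 * h) (B + 1 * h) (γ • τ : ℍ)) = fun h : ℂ =>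
      m * Complex.sqrt (den γ τ) *
      thetaSym ((γ 0 0 : ℤ) * A + (γ 1 0 : ℤ) * B + (γ 1 0 : ℤ) * h)
        ((γ 0 1 : ℤ) * A + (γ 1 1 : ℤ) * B + (γ 1 1 : ℤ) * h) τ := by
    funext h
    rw [hm]
    congr 2 <;> ring
  rw [he] at hl
  have := hl.unique hr
  rw [hm] at this
  have hpi : (2 * π * I : ℂ) ≠ 0 := by simp [Real.pi_ne_zero, I_ne_zero]
  have hd := sl2_det_complex γ
  apply mul_left_cancel₀ hpi
  rw [show ((γ 1 0 : ℤ) : ℂ) * τ + ((γ 1 1 : ℤ) : ℂ) = den γ τ from rfl] at this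
  linear_combination this - (π * I * m * Complex.sqrt (den γ τ) * A *
    thetaSym ((γ 0 0 : ℤ) * A + (γ 1 0 : ℤ) * B) ((γ 0 1 : ℤ) * A + (γ 1 1 : ℤ) * B) τ) * hd

/-! ### Primitives along segments and the error function. -/

/-- On an open set that is star-shaped about `0`, integration along segments gives a primitive. -/
lemma hasDerivAt_segmentIntegral {f : ℂ → ℂ} {U : Set ℂ} (hU : IsOpen U)
    (hstar : ∀ y ∈ U, ∀ t ∈ Set.Icc (0 : ℝ) 1, (t : ℂ) * y ∈ U) (hf : DifferentiableOn ℂ f U)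
    {y : ℂ} (hy : y ∈ U) :
    HasDerivAt (fun y => ∫ t in (0 : ℝ)..1, y * f (t * y)) (f y) y := by
  set K : Set ℂ := (fun t : ℝ => (t : ℂ) * y) '' Set.Icc 0 1
  have hK : IsCompact K := isCompact_Icc.image (by fun_prop)
  have hKU : K ⊆ U := by
    rintro _ ⟨t, ht, rfl⟩
    exact hstar y hy t ht
  obtain ⟨δ, hδ, hδU⟩ := hK.exists_cthickening_subset_open hU hKU
  have hK' : IsCompact (Metric.cthickening δ K) := hK.cthickening
  have hf' : DifferentiableOn ℂ (deriv f) U := hf.deriv hU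
  have hmem : ∀ x ∈ Metric.ball y δ, ∀ t ∈ Set.Icc (0 : ℝ) 1, (t : ℂ) * x ∈ Metric.cthickening δ K := by
    intro x hx t ht
    refine Metric.mem_cthickening_of_dist_le _ ((t : ℂ) * y) _ _ ⟨t, ht, rfl⟩ ?_
    rw [dist_eq_norm, ← mul_sub, norm_mul, Complex.norm_real, Real.norm_of_nonneg ht.1]
    have : ‖x - y‖ < δ := by simpa [dist_eq_norm] using hx
    nlinarith [norm_nonneg (x - y), ht.1, ht.2]
  obtain ⟨M, hM⟩ := hK'.exists_bound_of_continuousOn (hf.continuousOn.mono hδU)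
  obtain ⟨M', hM'⟩ := hK'.exists_bound_of_continuousOn (hf'.continuousOn.mono hδU)
  have hcont : ∀ x ∈ Metric.ball y δ, ContinuousOn (fun t : ℝ => x * f (t * x)) (Set.Icc 0 1) := by
    intro x hx
    refine continuousOn_const.mul (hf.continuousOn.comp (by fun_prop) fun t ht => hδU (hmem x hx t ht))
  have hcont' : ContinuousOn (fun t : ℝ => f (t * y) + y * (t * deriv f (t * y))) (Set.Icc 0 1) := by
    have hm : Set.MapsTo (fun t : ℝ => (t : ℂ) * y) (Set.Icc 0 1) U := fun t ht => hstar y hy t ht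
    have h1 : ContinuousOn (fun t : ℝ => (t : ℂ) * y) (Set.Icc 0 1) := by fun_prop
    have h2 := hf.continuousOn.comp h1 hm
    have h3 := hf'.continuousOn.comp h1 hm
    exact h2.add (continuousOn_const.mul ((by fun_prop : ContinuousOn (fun t : ℝ => (t : ℂ)) _).mul h3))
  have hsub : Set.uIoc (0 : ℝ) 1 ⊆ Set.Icc 0 1 := by
    rw [Set.uIoc_of_le zero_le_one]; exact Set.Ioc_subset_Icc_self
  have main := intervalIntegral.hasDerivAt_integral_of_dominated_loc_of_deriv_le
    (μ := MeasureTheory.volume) (a := (0 : ℝ)) (b := 1)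
    (F := fun (x : ℂ) (t : ℝ) => x * f (t * x))
    (F' := fun (x : ℂ) (t : ℝ) => f (t * x) + x * (t * deriv f (t * x)))
    (x₀ := y) (s := Metric.ball y δ) (bound := fun _ => M + (‖y‖ + δ) * M')
    (Metric.ball_mem_nhds y hδ)
    (eventually_of_mem (Metric.ball_mem_nhds y hδ) fun x hx =>
      ((hcont x hx).mono hsub).aestronglyMeasurable measurableSet_uIoc)
    ((hcont y (Metric.mem_ball_self hδ)).intervalIntegrable_of_Icc zero_le_one)
    ((hcont'.mono hsub).aestronglyMeasurable measurableSet_uIoc)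
    (Eventually.of_forall fun t ht x hx => by
      have ht' := hsub ht
      have h1 := hM _ (hmem x hx t ht')
      have h2 := hM' _ (hmem x hx t ht')
      have h3 : ‖x‖ ≤ ‖y‖ + δ := by
        have : ‖x - y‖ < δ := by simpa [dist_eq_norm] using hx
        calc ‖x‖ = ‖y + (x - y)‖ := by ring_nf
          _ ≤ ‖y‖ + ‖x - y‖ := norm_add_le _ _
          _ ≤ _ := by linarith
      refine (norm_add_le _ _).trans (add_le_add h1 ?_)
      rw [norm_mul, norm_mul, Complex.norm_real, Real.norm_of_nonneg ht'.1]
      refine mul_le_mul h3 ?_ (by have := ht'.1; positivity) (by positivity)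
      exact (mul_le_of_le_one_left (norm_nonneg _) ht'.2).trans h2)
    intervalIntegrable_const
    (Eventually.of_forall fun t ht x hx => by
      have hd := (hf.differentiableAt (hU.mem_nhds (hδU (hmem x hx t (hsub ht))))).hasDerivAt
      have h1 : HasDerivAt (fun x : ℂ => (t : ℂ) * x) t x := by
        simpa using (hasDerivAt_id x).const_mul (t : ℂ)
      refine ((hasDerivAt_id x).mul (hd.comp x h1)).congr_deriv ?_
      simp only [Function.comp_apply, id]
      ring)
  refine main.2.congr_deriv ?_
  -- The integrand differentiated in y is itself the t-derivative of t f(ty), so its integral is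
  -- f(y).
  have hprim : ∀ t ∈ Set.uIcc (0 : ℝ) 1, HasDerivAt (fun t : ℝ => (t : ℂ) * f (t * y))
      (f (t * y) + y * (t * deriv f (t * y))) t := by
    intro t ht
    rw [Set.uIcc_of_le zero_le_one] at ht
    have hd := (hf.differentiableAt (hU.mem_nhds (hstar y hy t ht))).hasDerivAt
    have h0 : HasDerivAt (fun t : ℝ => (t : ℂ)) 1 t := Complex.ofRealCLM.hasDerivAt
    have h1 : HasDerivAt (fun t : ℝ => (t : ℂ) * y) y t := by
      simpa using h0.mul_const y
    refine (h0.mul (hd.comp t h1)).congr_deriv ?_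
    simp
    ring
  rw [intervalIntegral.integral_eq_sub_of_hasDerivAt hprim
    (hcont'.intervalIntegrable_of_Icc zero_le_one)]
  simp

lemma hasDerivAt_erf (z : ℂ) : HasDerivAt erf (2 / (√π : ℝ) * cexp (-z ^ 2)) z := by
  refine (hasDerivAt_segmentIntegral (f := fun y => cexp (-y ^ 2)) isOpen_univ
    (fun _ _ _ _ => trivial) ?_ (Set.mem_univ z)).const_mul (2 / ((√π : ℝ) : ℂ))
  fun_prop

lemma differentiable_erf : Differentiable ℂ erf := fun z => (hasDerivAt_erf z).differentiableAt

lemma erf_neg (z : ℂ) : erf (-z) = -erf z := by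
  simp [erf]

/-! ### The Eichler integral of the weight 3/2 theta series. -/

/-- The set of `s` with `τ - i s²` in the upper half-plane. -/
def sqDomain (τ : ℂ) : Set ℂ := {s | 0 < (τ - I * s ^ 2).im}

lemma isOpen_sqDomain (τ : ℂ) : IsOpen (sqDomain τ) :=
  isOpen_lt continuous_const (by fun_prop)

/-- The point τ - i(ts)² lies on the line from τ to τ - is² at parameter t². Hence, for τ in the
upper half-plane, `sqDomain τ` is star-shaped about 0, and along the path the imaginary part never
drops below its smaller end value. -/
lemma im_sub_I_mul_sq (τ s : ℂ) (t : ℝ) :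
    (τ - I * (t * s) ^ 2).im = (1 - t ^ 2) * τ.im + t ^ 2 * (τ - I * s ^ 2).im := by
  rw [mul_pow, ← Complex.ofReal_pow]
  simp only [Complex.sub_im, Complex.mul_im, Complex.I_re, Complex.I_im, Complex.re_ofReal_mul,
    zero_mul, one_mul, zero_add]
  ring

lemma min_le_im_sub {τ s : ℂ} {t : ℝ} (ht : t ∈ Set.Icc (0 : ℝ) 1) :
    min τ.im (τ - I * s ^ 2).im ≤ (τ - I * (t * s) ^ 2).im := by
  rw [im_sub_I_mul_sq]
  have h1 := min_le_left τ.im (τ - I * s ^ 2).im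
  have h2 := min_le_right τ.im (τ - I * s ^ 2).im
  have h3 : 0 ≤ 1 - t ^ 2 := by nlinarith [ht.1, ht.2]
  nlinarith [sq_nonneg t]

lemma mul_mem_sqDomain {τ s : ℂ} (hτ : 0 < τ.im) (hs : s ∈ sqDomain τ) {t : ℝ}
    (ht : t ∈ Set.Icc (0 : ℝ) 1) : (t : ℂ) * s ∈ sqDomain τ :=
  (lt_min hτ hs).trans_le (min_le_im_sub ht)

lemma norm_sub_I_mul_sq_le (τ s : ℂ) {t : ℝ} (ht : t ∈ Set.Icc (0 : ℝ) 1) :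
    ‖τ - I * (t * s) ^ 2‖ ≤ ‖τ‖ + ‖s‖ ^ 2 := by
  refine (norm_sub_le _ _).trans ?_
  simp only [norm_mul, norm_pow, Complex.norm_I, one_mul, Complex.norm_real,
    Real.norm_of_nonneg ht.1]
  have : t * ‖s‖ ≤ ‖s‖ := mul_le_of_le_one_left (norm_nonneg _) ht.2
  have := pow_le_pow_left₀ (mul_nonneg ht.1 (norm_nonneg s)) this 2
  linarith

/-- The primitive `∫₀ˢ Θ_D(τ - i y²) dy` of the weight `3/2` theta series. -/
def thetaPrim (A B τ s : ℂ) : ℂ :=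
  ∫ t in (0 : ℝ)..1, s * thetaCharD A B (τ - I * (t * s) ^ 2)

lemma differentiableOn_thetaCharD_sub (A B τ : ℂ) :
    DifferentiableOn ℂ (fun y => thetaCharD A B (τ - I * y ^ 2)) (sqDomain τ) :=
  differentiableOn_thetaCharD (isOpen_sqDomain τ) (by fun_prop) (by fun_prop) (by fun_prop)
    fun _ hz => hz

lemma hasDerivAt_thetaPrim (A B : ℂ) {τ s : ℂ} (hτ : 0 < τ.im) (hs : s ∈ sqDomain τ) :
    HasDerivAt (thetaPrim A B τ) (thetaCharD A B (τ - I * s ^ 2)) s :=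
  hasDerivAt_segmentIntegral (f := fun y => thetaCharD A B (τ - I * y ^ 2)) (isOpen_sqDomain τ)
    (fun _ hy _ ht => mul_mem_sqDomain hτ hy ht) (differentiableOn_thetaCharD_sub A B τ) hs

lemma hasDerivAt_sqrt_den (γ : SL(2, ℤ)) {w : ℂ} (hw : 0 < w.im) :
    HasDerivAt (fun w => Complex.sqrt (den γ w))
      ((γ 1 0 : ℤ) / (2 * Complex.sqrt (den γ w))) w := by
  by_cases hc : γ 1 0 = 0
  · have : ∀ w : ℂ, den γ w = ((γ 1 1 : ℤ) : ℂ) := fun w => by simp [den, hc]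
    simp only [this, hc, Int.cast_zero, zero_div]
    exact hasDerivAt_const _ _
  · have him : (den γ w).im ≠ 0 := by
      rw [den_im]
      exact mul_ne_zero (by exact_mod_cast hc) hw.ne'
    have hd : HasDerivAt (den γ) ((γ 1 0 : ℤ) : ℂ) w := by
      exact (((hasDerivAt_id w).const_mul ((γ 1 0 : ℤ) : ℂ)).add_const
        ((γ 1 1 : ℤ) : ℂ)).congr_deriv (mul_one _)
    refine ((Complex.hasDerivAt_sqrt (Or.inr him)).comp w hd).congr_deriv ?_
    rw [Complex.sqrt, show (-1 / 2 : ℂ) = -(2⁻¹) by norm_num, Complex.cpow_neg]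
    field_simp

lemma coe_smul_sub_coe_smul (γ : SL(2, ℤ)) (τ w : ℍ) :
    ((γ • w : ℍ) : ℂ) - (γ • τ : ℍ) = (w - τ) / (den γ τ * den γ w) := by
  have h1 := den_ne_zero γ τ
  have h2 := den_ne_zero γ w
  have hd := sl2_det_complex γ
  rw [coe_sl2_smul, coe_sl2_smul, div_sub_div _ _ h2 h1, div_eq_div_iff (mul_ne_zero h2 h1)
    (mul_ne_zero h1 h2)]
  have e1 : den γ τ = ((γ 1 0 : ℤ) : ℂ) * τ + ((γ 1 1 : ℤ) : ℂ) := rfl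
  have e2 : den γ w = ((γ 1 0 : ℤ) : ℂ) * w + ((γ 1 1 : ℤ) : ℂ) := rfl
  have : (((γ 0 0 : ℤ) : ℂ) * w + ((γ 0 1 : ℤ) : ℂ)) * den γ τ -
      den γ w * (((γ 0 0 : ℤ) : ℂ) * τ + ((γ 0 1 : ℤ) : ℂ)) = w - τ := by
    rw [e1, e2]
    linear_combination ((w : ℂ) - τ) * hd
  rw [this]
  ring

/-- Modularity of the primitive: its multiplier is that of the theta series of weight `1/2`. -/
theorem thetaPrim_smul {γ : SL(2, ℤ)} {m : ℂ} (hm : ∀ (τ : ℍ) (A B : ℂ),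
    thetaSymD A B (γ • τ : ℍ) = m * Complex.sqrt (den γ τ) * den γ τ *
      thetaSymD ((γ 0 0 : ℤ) * A + (γ 1 0 : ℤ) * B) ((γ 0 1 : ℤ) * A + (γ 1 1 : ℤ) * B) τ)
    (τ w : ℍ) {s : ℂ} (hs : s ^ 2 = I * (w - τ)) (A B : ℂ) :
    cexp (-π * I * A * B) * thetaPrim A B (γ • τ : ℍ)
        (s / (Complex.sqrt (den γ τ) * Complex.sqrt (den γ w))) =
      m * Complex.sqrt (den γ τ) *
        (cexp (-π * I * ((γ 0 0 : ℤ) * A + (γ 1 0 : ℤ) * B) *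
          ((γ 0 1 : ℤ) * A + (γ 1 1 : ℤ) * B)) *
        thetaPrim ((γ 0 0 : ℤ) * A + (γ 1 0 : ℤ) * B) ((γ 0 1 : ℤ) * A + (γ 1 1 : ℤ) * B) τ s) := by
  set A' : ℂ := (γ 0 0 : ℤ) * A + (γ 1 0 : ℤ) * B with hA'
  set B' : ℂ := (γ 0 1 : ℤ) * A + (γ 1 1 : ℤ) * B with hB'
  -- φ carries the path coordinate based at τ to the one based at γτ: γτ - iφ(y)² = γ(τ - iy²). Its
  -- value at y = s belongs to the endpoint w.
  set φ : ℂ → ℂ := fun y => y / (Complex.sqrt (den γ τ) * Complex.sqrt (den γ (τ - I * y ^ 2))) with hφ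
  have hws : (τ : ℂ) - I * s ^ 2 = w := by
    rw [hs]; linear_combination (-(w - τ : ℂ)) * I_mul_I
  have hsD : s ∈ sqDomain τ := by
    change 0 < (_ : ℂ).im
    rw [hws]; exact w.im_pos
  have hsqτ : Complex.sqrt (den γ τ) ≠ 0 := sqrt_ne_zero (den_ne_zero γ τ)
  set g : ℂ → ℂ := fun y => cexp (-π * I * A * B) * thetaPrim A B (γ • τ : ℍ) (φ y) -
    m * Complex.sqrt (den γ τ) * (cexp (-π * I * A' * B') * thetaPrim A' B' τ y) with hg
  have hderiv : ∀ y ∈ sqDomain τ, HasDerivAt g 0 y := by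
    intro y hy
    set v : ℍ := ⟨τ - I * y ^ 2, hy⟩ with hv
    have hvc : (v : ℂ) = τ - I * y ^ 2 := rfl
    have hsqv : Complex.sqrt (den γ v) ≠ 0 := sqrt_ne_zero (den_ne_zero γ v)
    have hval : ((γ • τ : ℍ) : ℂ) - I * φ y ^ 2 = (γ • v : ℍ) := by
      have h1 := coe_smul_sub_coe_smul γ τ v
      have h2 : φ y ^ 2 = y ^ 2 / (den γ τ * den γ v) := by
        simp only [hφ, div_pow, mul_pow, sqrt_sq, hvc]
      rw [h2]
      linear_combination -h1 + hvc / (den γ τ * den γ v)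
    have hφD : φ y ∈ sqDomain (γ • τ : ℍ) := by
      change 0 < (_ : ℂ).im
      rw [hval]; exact (γ • v).im_pos
    have h1 : HasDerivAt (fun y : ℂ => (τ : ℂ) - I * y ^ 2) (-(2 * I * y)) y := by
      refine (((hasDerivAt_id y).pow 2).const_mul I |>.const_sub (τ : ℂ)).congr_deriv ?_
      simp
      ring
    have h2 := (hasDerivAt_sqrt_den γ (w := τ - I * y ^ 2) hy).comp y h1
    -- This derivative cancels the factor √(cv+d)(cv+d) of the weight 3/2 law at v and leaves
    -- √(cτ+d). Both sides of the claim thus have the same derivative, and both vanish at y = 0.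
    have hφ' : HasDerivAt φ (Complex.sqrt (den γ τ) / (Complex.sqrt (den γ v) * den γ v)) y := by
      refine ((hasDerivAt_id y).div (h2.const_mul (Complex.sqrt (den γ τ)))
        (mul_ne_zero hsqτ hsqv)).congr_deriv ?_
      have e1 : den γ τ = den γ v + I * ((γ 1 0 : ℤ) : ℂ) * y ^ 2 := by
        simp only [den, hvc]; ring
      have e2 := sqrt_sq (den γ v)
      have e3 := sqrt_sq (den γ τ)
      simp only [Function.comp_apply, id, ← hvc]
      have hdv := den_ne_zero γ v
      rw [div_eq_div_iff (pow_ne_zero 2 (mul_ne_zero hsqτ hsqv)) (mul_ne_zero hsqv hdv)]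
      set a := Complex.sqrt (den γ τ)
      set b := Complex.sqrt (den γ v)
      field_simp
      rw [← e2] at e1 ⊢
      rw [← e3] at e1
      linear_combination (-b ^ 2) * e1
    have h3 := ((hasDerivAt_thetaPrim A B (γ • τ).im_pos hφD).comp y hφ').const_mul
      (cexp (-π * I * A * B))
    have h4 := ((hasDerivAt_thetaPrim A' B' τ.im_pos hy).const_mul
      (cexp (-π * I * A' * B'))).const_mul (m * Complex.sqrt (den γ τ))
    refine (h3.sub h4).congr_deriv ?_
    rw [hval]
    have h5 := hm v A B
    simp only [thetaSymD, ← hA', ← hB'] at h5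
    rw [← mul_assoc, h5, ← hvc]
    have hdv := den_ne_zero γ v
    field_simp
    ring
  have h0 : g 0 = 0 := by simp [hg, hφ, thetaPrim]
  have hconst : g ((1 : ℝ) * s) = g ((0 : ℝ) * s) := by
    refine constant_of_has_deriv_right_zero (f := fun t : ℝ => g (t * s)) (a := 0) (b := 1)
      ?_ ?_ 1 (by simp)
    · intro t ht
      exact (((hderiv _ (mul_mem_sqDomain τ.im_pos hsD ht)).continuousAt).comp
        (f := fun t : ℝ => (t : ℂ) * s) (by fun_prop)).continuousWithinAt
    · intro t ht
      have h0 : HasDerivAt (fun t : ℝ => (t : ℂ)) 1 t := Complex.ofRealCLM.hasDerivAt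
      have := (hderiv _ (mul_mem_sqDomain τ.im_pos hsD ⟨ht.1, ht.2.le⟩)).comp t (h0.mul_const s)
      simpa using! this.hasDerivWithinAt
  rw [Complex.ofReal_one, one_mul, Complex.ofReal_zero, zero_mul, h0] at hconst
  have := sub_eq_zero.mp hconst
  simpa only [hφ, hws] using this

/-! ### Completed false theta series with characteristics. -/

/-- The general term of the completed false theta series with characteristics. -/
def psiTerm (A B τ s : ℂ) (n : ℤ) : ℂ :=
  erf (-I * (√π : ℝ) * s * (n + 1 / 2 + A)) * thetaTerm A B τ n

/-- The completed false theta series with characteristics. -/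
def psiChar (A B τ s : ℂ) : ℂ := ∑' n : ℤ, psiTerm A B τ s n

lemma sqrt_pi_ne_zero : ((√π : ℝ) : ℂ) ≠ 0 := by
  exact_mod_cast (Real.sqrt_pos.mpr Real.pi_pos).ne'

lemma sqrt_pi_sq : ((√π : ℝ) : ℂ) ^ 2 = π := by
  exact_mod_cast Real.sq_sqrt Real.pi_pos.le

/-- The Gaussian in the error function is exp(π(tsx)²), which is exactly the effect on the theta
term of moving τ to τ - i(ts)². -/
lemma psiTerm_eq_integral (A B τ s : ℂ) (n : ℤ) : psiTerm A B τ s n =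
    -2 * I * ∫ t in (0 : ℝ)..1,
      s * ((n + 1 / 2 + A) * thetaTerm A B (τ - I * (t * s) ^ 2) n) := by
  rw [psiTerm, erf, mul_assoc, ← intervalIntegral.integral_mul_const,
    ← intervalIntegral.integral_const_mul, ← intervalIntegral.integral_const_mul]
  refine intervalIntegral.integral_congr fun t _ => ?_
  simp only [thetaTerm]
  have e : cexp (π * I * ((n + 1 / 2 + A) ^ 2 * (τ - I * (t * s) ^ 2) + 2 * (n + 1 / 2 + A) * B)) =
      cexp (-((t : ℂ) * (-I * (√π : ℝ) * s * (n + 1 / 2 + A))) ^ 2) *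
      cexp (π * I * ((n + 1 / 2 + A) ^ 2 * τ + 2 * (n + 1 / 2 + A) * B)) := by
    rw [← Complex.exp_add]
    congr 1
    linear_combination I ^ 2 * (t * s * (n + 1 / 2 + A)) ^ 2 * sqrt_pi_sq
  rw [e]
  have := sqrt_pi_ne_zero
  field_simp

/-- The error function alone may grow like a Gaussian when Im w < Im τ. The integral form bounds its
product with the theta term, since the path stays at height at least the smaller of its end heights.
-/
lemma exists_summable_psiTerm_bound {R : ℝ} (hR : 0 ≤ R) {τ s : ℂ} (hτ : 0 < τ.im)
    (hs : s ∈ sqDomain τ) : ∃ u : ℤ → ℝ, Summable u ∧ ∀ (n : ℤ) (A B : ℂ), ‖A‖ ≤ R → ‖B‖ ≤ R →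
      ‖psiTerm A B τ s n‖ ≤ u n ∧ ∀ t ∈ Set.Icc (0 : ℝ) 1,
        ‖s * ((n + 1 / 2 + A) * thetaTerm A B (τ - I * (t * s) ^ 2) n)‖ ≤ u n := by
  have h0 : 0 ≤ ‖τ‖ + ‖s‖ ^ 2 := by positivity
  obtain ⟨u, hu, h⟩ := exists_summable_thetaTerm_bound (R := R + (‖τ‖ + ‖s‖ ^ 2)) (by positivity)
    (lt_min hτ hs)
  have key : ∀ (n : ℤ) (A B : ℂ), ‖A‖ ≤ R → ‖B‖ ≤ R → ∀ t ∈ Set.Icc (0 : ℝ) 1,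
      ‖s * ((n + 1 / 2 + A) * thetaTerm A B (τ - I * (t * s) ^ 2) n)‖ ≤ ‖s‖ * u n := by
    intro n A B hA hB t ht
    rw [norm_mul]
    gcongr
    have := norm_sub_I_mul_sq_le τ s ht
    exact (h n A B _ (by linarith) (by linarith) (by linarith) (min_le_im_sub ht)).2
  have hpos : ∀ n, 0 ≤ u n := fun n => (norm_nonneg _).trans
    (h n 0 0 τ (by rw [norm_zero]; linarith) (by rw [norm_zero]; linarith)
      (by nlinarith [norm_nonneg s]) (min_le_left _ _)).1
  refine ⟨fun n => 2 * (‖s‖ * u n), (hu.mul_left _).mul_left _, fun n A B hA hB =>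
    ⟨?_, fun t ht => (key n A B hA hB t ht).trans ?_⟩⟩
  · rw [psiTerm_eq_integral, norm_mul]
    have : ‖(-2 * I : ℂ)‖ = 2 := by simp
    rw [this]
    refine mul_le_mul_of_nonneg_left ?_ zero_le_two
    have := intervalIntegral.norm_integral_le_of_norm_le_const (a := (0 : ℝ)) (b := 1)
      (C := ‖s‖ * u n)
      (f := fun t : ℝ => s * ((n + 1 / 2 + A) * thetaTerm A B (τ - I * (t * s) ^ 2) n))
      fun t ht => key n A B hA hB t
        (by rw [Set.uIoc_of_le zero_le_one] at ht; exact ⟨ht.1.le, ht.2⟩)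
    simpa using this
  · have := mul_nonneg (norm_nonneg s) (hpos n)
    linarith

lemma hasSum_psiChar (A B : ℂ) {τ s : ℂ} (hτ : 0 < τ.im) (hs : s ∈ sqDomain τ) :
    HasSum (psiTerm A B τ s) (psiChar A B τ s) := by
  obtain ⟨u, hu, h⟩ := exists_summable_psiTerm_bound
    (R := ‖A‖ + ‖B‖) (by positivity) hτ hs
  refine (hu.of_norm_bounded fun n => (h n A B ?_ ?_).1).hasSum
  · linarith [norm_nonneg B]
  · linarith [norm_nonneg A]

/-- For s² = i(w - τ) the path τ - i(ts)² runs from τ to w, so the modularity of the error function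
series is reduced to that of `thetaPrim`. -/
lemma psiChar_eq_thetaPrim (A B : ℂ) {τ s : ℂ} (hτ : 0 < τ.im) (hs : s ∈ sqDomain τ) :
    psiChar A B τ s = -2 * I * thetaPrim A B τ s := by
  obtain ⟨u, hu, h⟩ := exists_summable_psiTerm_bound
    (R := ‖A‖ + ‖B‖) (by positivity) hτ hs
  have hA : ‖A‖ ≤ ‖A‖ + ‖B‖ := by linarith [norm_nonneg B]
  have hB : ‖B‖ ≤ ‖A‖ + ‖B‖ := by linarith [norm_nonneg A]
  have hsub : Set.uIoc (0 : ℝ) 1 ⊆ Set.Icc 0 1 := by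
    rw [Set.uIoc_of_le zero_le_one]; exact Set.Ioc_subset_Icc_self
  have := intervalIntegral.hasSum_integral_of_dominated_convergence (a := 0) (b := 1)
    (μ := MeasureTheory.volume)
    (F := fun (n : ℤ) (t : ℝ) => s * ((n + 1 / 2 + A) * thetaTerm A B (τ - I * (t * s) ^ 2) n))
    (f := fun t : ℝ => s * thetaCharD A B (τ - I * (t * s) ^ 2)) (fun n _ => u n)
    (fun n => by
      refine Continuous.aestronglyMeasurable ?_
      simp only [thetaTerm]
      fun_prop)
    (fun n => Eventually.of_forall fun t ht => (h n A B hA hB).2 t (hsub ht))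
    (Eventually.of_forall fun t ht => hu) intervalIntegrable_const
    (Eventually.of_forall fun t ht => (hasSum_thetaCharD A B (mul_mem_sqDomain hτ hs (hsub ht))).mul_left s)
  have h2 := this.mul_left (-2 * I)
  simp only [← psiTerm_eq_integral] at h2
  exact h2.tsum_eq

lemma differentiable_psiChar {a b : ℂ → ℂ} {τ s : ℂ} (ha : Differentiable ℂ a)
    (hb : Differentiable ℂ b) (hτ : 0 < τ.im) (hs : s ∈ sqDomain τ) :
    Differentiable ℂ fun z => psiChar (a z) (b z) τ s := by
  intro z₀
  set R : ℝ := ‖a z₀‖ + ‖b z₀‖ + 1 with hR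
  have p1 := norm_nonneg (a z₀)
  have p2 := norm_nonneg (b z₀)
  obtain ⟨V, hV, hVo, hzV⟩ := eventually_nhds_iff.mp
    (((ha.continuous.norm.tendsto z₀).eventually_lt_const (show ‖a z₀‖ < R by linarith)).and
      ((hb.continuous.norm.tendsto z₀).eventually_lt_const (show ‖b z₀‖ < R by linarith)))
  obtain ⟨u, hu, h⟩ := exists_summable_psiTerm_bound (R := R) (by linarith) hτ hs
  refine (differentiableOn_tsum_of_summable_norm hu (fun n => ?_) hVo
    fun n z hz => (h n _ _ (hV z hz).1.le (hV z hz).2.le).1).differentiableAt (hVo.mem_nhds hzV)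
  refine Differentiable.differentiableOn ?_
  simp only [psiTerm, thetaTerm]
  exact (differentiable_erf.comp (by fun_prop)).mul (by fun_prop)

lemma continuous_psiChar {X : Type*} [TopologicalSpace X] {a b : X → ℂ} {τ s : ℂ}
    (ha : Continuous a) (hb : Continuous b) (hτ : 0 < τ.im) (hs : s ∈ sqDomain τ) :
    Continuous fun x => psiChar (a x) (b x) τ s := by
  rw [continuous_iff_continuousAt]
  intro x₀
  set R : ℝ := ‖a x₀‖ + ‖b x₀‖ + 1 with hR
  have p1 := norm_nonneg (a x₀)
  have p2 := norm_nonneg (b x₀)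
  obtain ⟨V, hV, hVo, hzV⟩ := eventually_nhds_iff.mp
    (((ha.norm.tendsto x₀).eventually_lt_const (show ‖a x₀‖ < R by linarith)).and
      ((hb.norm.tendsto x₀).eventually_lt_const (show ‖b x₀‖ < R by linarith)))
  obtain ⟨u, hu, h⟩ := exists_summable_psiTerm_bound (R := R) (by linarith) hτ hs
  refine (continuousOn_tsum (fun n => ?_) hu
    fun n z hz => (h n _ _ (hV z hz).1.le (hV z hz).2.le).1).continuousAt (hVo.mem_nhds hzV)
  refine Continuous.continuousOn ?_
  simp only [psiTerm, thetaTerm]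
  exact (differentiable_erf.continuous.comp (by fun_prop)).mul (by fun_prop)

/-- The odd error function offsets the sign in `thetaTerm_neg`, so this series is even where
`thetaChar` is odd. That contrast removes it at the origin (`polarH_zero`) and explains χ
(`polarH_neg`). -/
lemma psiChar_neg (A B τ s : ℂ) : psiChar (-A) (-B) τ s = psiChar A B τ s := by
  rw [psiChar, psiChar, ← (Equiv.subLeft (-1 : ℤ)).tsum_eq]
  refine tsum_congr fun n => ?_
  simp only [psiTerm, Equiv.subLeft_apply, thetaTerm_neg]
  rw [show -1 - (-1 - n) = n by ring]
  push_cast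
  rw [show -I * (√π : ℝ) * s * (-1 - n + 1 / 2 + -A) = -(-I * (√π : ℝ) * s * (n + 1 / 2 + A)) by ring,
    erf_neg]
  ring

lemma psiChar_neg_right (A B τ s : ℂ) : psiChar A B τ (-s) = -psiChar A B τ s := by
  rw [psiChar, psiChar, ← tsum_neg]
  refine tsum_congr fun n => ?_
  simp only [psiTerm]
  rw [show -I * (√π : ℝ) * -s * (n + 1 / 2 + A) = -(-I * (√π : ℝ) * s * (n + 1 / 2 + A)) by ring,
    erf_neg]
  ring

lemma psiChar_add_int_left (A B τ s : ℂ) (m : ℤ) :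
    psiChar (A + m) B τ s = (-1) ^ m * psiChar A B τ s := by
  rw [psiChar, psiChar, ← tsum_mul_left, ← (Equiv.addRight m).tsum_eq fun n => _ * psiTerm A B τ s n]
  refine tsum_congr fun n => ?_
  simp only [psiTerm, thetaTerm_add_int_left, Equiv.coe_addRight]
  push_cast
  rw [show (n : ℂ) + m + 1 / 2 + A = n + 1 / 2 + (A + m) by ring]
  ring

lemma psiChar_add_int_right (A B τ s : ℂ) (m : ℤ) :
    psiChar A (B + m) τ s = (-1) ^ m * cexp (2 * π * I * A * m) * psiChar A B τ s := by
  rw [psiChar, psiChar, ← tsum_mul_left]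
  refine tsum_congr fun n => ?_
  simp only [psiTerm, thetaTerm_add_int_right]
  ring

lemma mem_sqDomain {τ w : ℍ} {s : ℂ} (hs : s ^ 2 = I * (w - τ)) : s ∈ sqDomain τ := by
  change 0 < (_ : ℂ).im
  have : (τ : ℂ) - I * s ^ 2 = w := by
    rw [hs]; linear_combination (-(w - τ : ℂ)) * I_mul_I
  rw [this]
  exact w.im_pos

/-- Joint modularity of the theta series and the completed false theta series. -/
theorem exists_theta_psi_smul (γ : SL(2, ℤ)) : ∃ m : ℂ, m ≠ 0 ∧ ∀ (τ w : ℍ) (s A B : ℂ),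
    s ^ 2 = I * (w - τ) →
    cexp (-π * I * A * B) * thetaChar A B (γ • τ : ℍ) = m * Complex.sqrt (den γ τ) *
      (cexp (-π * I * ((γ 0 0 : ℤ) * A + (γ 1 0 : ℤ) * B) *
          ((γ 0 1 : ℤ) * A + (γ 1 1 : ℤ) * B)) *
        thetaChar ((γ 0 0 : ℤ) * A + (γ 1 0 : ℤ) * B) ((γ 0 1 : ℤ) * A + (γ 1 1 : ℤ) * B) τ) ∧
    cexp (-π * I * A * B) * psiChar A B (γ • τ : ℍ)
        (s / (Complex.sqrt (den γ τ) * Complex.sqrt (den γ w))) = m * Complex.sqrt (den γ τ) *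
      (cexp (-π * I * ((γ 0 0 : ℤ) * A + (γ 1 0 : ℤ) * B) *
          ((γ 0 1 : ℤ) * A + (γ 1 1 : ℤ) * B)) *
        psiChar ((γ 0 0 : ℤ) * A + (γ 1 0 : ℤ) * B) ((γ 0 1 : ℤ) * A + (γ 1 1 : ℤ) * B) τ s) := by
  obtain ⟨m, hm0, hm⟩ := exists_thetaSym_smul γ
  refine ⟨m, hm0, fun τ w s A B hs => ⟨hm τ A B, ?_⟩⟩
  -- The transported s is some root of i(γw - γτ), not always the principal one.
  have hs' : (s / (Complex.sqrt (den γ τ) * Complex.sqrt (den γ w))) ^ 2 =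
      I * (((γ • w : ℍ) : ℂ) - (γ • τ : ℍ)) := by
    rw [div_pow, mul_pow, sqrt_sq, sqrt_sq, coe_smul_sub_coe_smul, hs]
    ring
  rw [psiChar_eq_thetaPrim A B (γ • τ).im_pos (mem_sqDomain hs'),
    psiChar_eq_thetaPrim _ _ τ.im_pos (mem_sqDomain hs)]
  linear_combination (-2 * I) * thetaPrim_smul (thetaSymD_smul hm) τ w hs A B

/-! ### The pentagonal number theorem and the eta function. -/

lemma norm_prod_one_sub_pow_le {q : ℂ} (hq : ‖q‖ < 1) (k n : ℕ) :
    ‖∏ i ∈ Finset.range (n + 1), (1 - q ^ (k + i + 1))‖ ≤ Real.exp (1 - ‖q‖)⁻¹ := by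
  have h0 := norm_nonneg q
  rw [norm_prod]
  calc ∏ i ∈ Finset.range (n + 1), ‖1 - q ^ (k + i + 1)‖
      ≤ ∏ i ∈ Finset.range (n + 1), Real.exp (‖q‖ ^ i) := by
        refine Finset.prod_le_prod (fun _ _ => norm_nonneg _) fun i _ => ?_
        refine (norm_sub_le _ _).trans ?_
        rw [norm_one, norm_pow]
        have h1 : ‖q‖ ^ (k + i + 1) ≤ ‖q‖ ^ i := pow_le_pow_of_le_one h0 hq.le (by omega)
        linarith [Real.add_one_le_exp (‖q‖ ^ i)]
    _ = Real.exp (∑ i ∈ Finset.range (n + 1), ‖q‖ ^ i) := (Real.exp_sum _ _).symm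
    _ ≤ _ := by
        rw [← tsum_geometric_of_lt_one h0 hq]
        exact Real.exp_le_exp.mpr ((summable_geometric_of_lt_one h0 hq).sum_le_tsum _
          fun i _ => pow_nonneg h0 i)

lemma le_pentagonal_neg (k : ℕ) : k ≤ pentagonal (-k) := by
  have h := two_mul_natCast_pentagonal_neg (k : ℤ)
  have : (k : ℤ) ≤ pentagonal (-(k : ℤ)) := by nlinarith [Int.natCast_nonneg k]
  exact_mod_cast this

lemma le_pentagonal_add_one (k : ℕ) : k ≤ pentagonal (k + 1) := by
  have h := two_mul_natCast_pentagonal ((k : ℤ) + 1)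
  have : (k : ℤ) ≤ pentagonal ((k : ℤ) + 1) := by nlinarith [Int.natCast_nonneg k]
  exact_mod_cast this

/-- Euler's pentagonal number theorem for complex numbers. -/
theorem tprod_one_sub_pow_eq_pentagonal {q : ℂ} (hq : ‖q‖ < 1) :
    ∏' n : ℕ, (1 - q ^ (n + 1)) =
      ∑' k : ℕ, (-1) ^ k * (q ^ pentagonal (-k) - q ^ pentagonal (k + 1)) := by
  have h0 := norm_nonneg q
  have hgeo := summable_geometric_of_lt_one h0 hq
  -- The majorant does not depend on k, so it serves both for summability in n and for the vanishing
  -- of the remainder as k → ∞.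
  have hterm : ∀ k n : ℕ, ‖q ^ ((k + 1) * n) * ∏ i ∈ Finset.range (n + 1), (1 - q ^ (k + i + 1))‖ ≤
      ‖q‖ ^ n * Real.exp (1 - ‖q‖)⁻¹ := by
    intro k n
    rw [norm_mul, norm_pow]
    refine mul_le_mul (pow_le_pow_of_le_one h0 hq.le (by nlinarith)) (norm_prod_one_sub_pow_le hq k n)
      (norm_nonneg _) (by positivity)
  refine Pentagonal.tprod_one_sub_pow (tendsto_pow_atTop_nhds_zero_of_norm_lt_one hq)
    (fun k => (hgeo.mul_right _).of_norm_bounded (hterm k)) (fun k => ?_) ?_ ?_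
  · have : Summable fun n : ℕ => ‖-q ^ (n + k + 1)‖ := by
      refine (hgeo.mul_right (‖q‖ ^ (k + 1))).congr fun n => ?_
      rw [norm_neg, norm_pow, ← pow_add, add_assoc]
    simpa [sub_eq_add_neg] using multipliable_one_add_of_summable this
  · refine (hgeo.mul_left 2).of_norm_bounded fun k => ?_
    rw [norm_mul, norm_pow, norm_neg, norm_one, one_pow, one_mul]
    refine (norm_sub_le _ _).trans ?_
    rw [norm_pow, norm_pow]
    have h1 := pow_le_pow_of_le_one h0 hq.le (le_pentagonal_neg k)
    have h2 := pow_le_pow_of_le_one h0 hq.le (le_pentagonal_add_one k)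
    linarith
  · have hb : ∀ k : ℕ, ‖∑' n : ℕ, q ^ ((k + 1) * n) * ∏ i ∈ Finset.range (n + 1),
        (1 - q ^ (k + i + 1))‖ ≤ ∑' n : ℕ, ‖q‖ ^ n * Real.exp (1 - ‖q‖)⁻¹ := fun k =>
      tsum_of_norm_bounded (hgeo.mul_right _).hasSum (hterm k)
    refine squeeze_zero_norm (a := fun k : ℕ => ‖q‖ ^ k *
      ∑' n : ℕ, ‖q‖ ^ n * Real.exp (1 - ‖q‖)⁻¹) (fun k => ?_) ?_
    · rw [norm_mul, norm_mul, norm_pow, norm_neg, norm_one, one_pow, one_mul, norm_pow]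
      refine mul_le_mul (pow_le_pow_of_le_one h0 hq.le ?_) (hb k) (norm_nonneg _) (by positivity)
      rw [Nat.le_div_iff_mul_le two_pos]
      nlinarith
    · simpa using (tendsto_pow_atTop_nhds_zero_of_lt_one h0 hq).mul_const
        (∑' n : ℕ, ‖q‖ ^ n * Real.exp (1 - ‖q‖)⁻¹)

lemma norm_e_lt_one (τ : ℍ) : ‖e τ‖ < 1 := by
  rw [e, Complex.norm_exp]
  simp only [Real.exp_lt_one_iff]
  have := τ.im_pos
  have h : (2 * π * I * (τ : ℂ)).re = -(2 * π * τ.im) := by simp [UpperHalfPlane.coe_im]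
  rw [h]
  have := Real.pi_pos
  have : 0 < 2 * π * τ.im := by positivity
  linarith

lemma eta_eq_pentagonal (τ : ℍ) : ModularForm.eta τ = e (τ / 24) *
    ∑' k : ℕ, (-1) ^ k * (e τ ^ pentagonal (-k) - e τ ^ pentagonal (k + 1)) := by
  rw [← tprod_one_sub_pow_eq_pentagonal (norm_e_lt_one τ), ModularForm.eta]
  congr 1
  · rw [Function.Periodic.qParam, e]
    congr 1
    push_cast
    ring
  · simp only [ModularForm.eta_q_eq_pow, e]

/-- The theta constant with characteristic `1/3` is the eta function. -/
lemma thetaChar_one_third (τ : ℍ) : thetaChar (1 / 3) 0 (3 * τ) = -ModularForm.eta τ := by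
  have him : 0 < (3 * (τ : ℂ)).im := by simpa using τ.im_pos
  have hs := hasSum_thetaChar (1 / 3) 0 him
  -- At n = -k - 1 one has x = -(k + 1/6), and 3x²/2 = k(3k+1)/2 + 1/24. Pairing k with -(k+1)
  -- yields the two exponents in Euler's series.
  have hterm : ∀ k : ℤ, thetaTerm (1 / 3) 0 (3 * τ) (-k - 1) =
      -e (τ / 24) * ((-1) ^ k * e τ ^ pentagonal (-k)) := by
    intro k
    have hp : (2 * (pentagonal (-k) : ℂ)) = k * (3 * k + 1) := by
      exact_mod_cast two_mul_natCast_pentagonal_neg k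
    have hsgn : (-1 : ℂ) ^ (-k - 1) = -(-1) ^ k := by
      rw [show -k - 1 = -1 - k by ring, neg_one_zpow_sub_one_sub]
    rw [thetaTerm, hsgn, e, e, ← Complex.exp_nat_mul]
    push_cast
    rw [show (π * I * ((-k - 1 + 1 / 2 + 1 / 3) ^ 2 * (3 * τ) + 2 * (-k - 1 + 1 / 2 + 1 / 3) * 0) : ℂ) =
      2 * π * I * (τ / 24) + (pentagonal (-k) : ℂ) * (2 * π * I * τ) by
        linear_combination (-(π * I * τ)) * hp, Complex.exp_add]
    ring
  have h1 := (((Equiv.neg ℤ).trans (Equiv.subRight 1)).hasSum_iff.mpr hs).nat_add_neg_add_one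
  simp only [Function.comp_apply, Equiv.trans_apply, Equiv.neg_apply, Equiv.subRight_apply,
    hterm] at h1
  rw [eta_eq_pentagonal, ← h1.tsum_eq, ← neg_mul, ← tsum_mul_left]
  refine tsum_congr fun k => ?_
  rw [neg_neg, zpow_neg, zpow_add_one₀ (by norm_num), zpow_natCast]
  rcases Nat.even_or_odd k with h | h <;> simp [h.neg_one_pow] <;> ring

/-! ### Logarithmic Taylor coefficients in one variable. -/

/-- The `k`-th derivative at `0` of `log (g z / g 0)`. -/
def logCoeff (g : ℂ → ℂ) (k : ℕ) : ℂ := iteratedDeriv k (fun z => Complex.log (g z / g 0)) 0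

lemma iteratedDeriv_eq_of_hasSum {f : ℂ → ℂ} {a : ℕ → ℂ}
    (h : ∀ᶠ z : ℂ in 𝓝 0, HasSum (fun n => a n * z ^ n) (f z)) (n : ℕ) :
    iteratedDeriv n f 0 = n.factorial * a n := by
  have hp : HasFPowerSeriesAt f (FormalMultilinearSeries.ofScalars ℂ a) 0 := by
    rw [hasFPowerSeriesAt_iff]
    filter_upwards [h] with z hz
    simpa [FormalMultilinearSeries.coeff_ofScalars, mul_comm] using hz
  have h2 := hp.analyticAt.hasFPowerSeriesAt
  have := congrArg (fun p => p.coeff n) (hp.eq_formalMultilinearSeries h2)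
  simp only [FormalMultilinearSeries.coeff_ofScalars] at this
  have h3 : (n.factorial : ℂ) ≠ 0 := by exact_mod_cast n.factorial_ne_zero
  rw [this]
  field_simp

lemma hasSum_of_analyticAt {f : ℂ → ℂ} (hf : AnalyticAt ℂ f 0) :
    ∀ᶠ z : ℂ in 𝓝 0, HasSum (fun n => iteratedDeriv n f 0 / n.factorial * z ^ n) (f z) := by
  have := hasFPowerSeriesAt_iff.mp hf.hasFPowerSeriesAt
  filter_upwards [this] with z hz
  simpa [FormalMultilinearSeries.coeff_ofScalars, mul_comm] using hz

lemma analyticAt_log_div {g : ℂ → ℂ} (hg : AnalyticAt ℂ g 0) (h0 : g 0 ≠ 0) :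
    AnalyticAt ℂ (fun z => Complex.log (g z / g 0)) 0 := by
  refine (hg.div analyticAt_const h0).clog ?_
  rw [Pi.div_apply, div_self h0]
  exact Complex.one_mem_slitPlane

lemma hasSum_logCoeff {g : ℂ → ℂ} (hg : AnalyticAt ℂ g 0) (h0 : g 0 ≠ 0) :
    ∀ᶠ z : ℂ in 𝓝 0, HasSum (fun k : ℕ+ => logCoeff g k / (k : ℕ).factorial * z ^ (k : ℕ))
      (Complex.log (g z / g 0)) := by
  filter_upwards [hasSum_of_analyticAt (analyticAt_log_div hg h0)] with z hz
  refine (PNat.coe_injective.hasSum_iff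
    (f := fun n : ℕ => logCoeff g n / n.factorial * z ^ n) ?_).mpr hz
  intro n hn
  have : n = 0 := by
    by_contra h
    exact hn ⟨⟨n, Nat.pos_of_ne_zero h⟩, rfl⟩
  simp [this, logCoeff, div_self h0]

/-- Normalizing by the value at 0 discards K, the rescaling of z gives c^k, and the exponent bz²
adds its second derivative. This turns a Jacobi transformation in z into weight k, with an anomaly
at k = 2. -/
lemma logCoeff_congr_exp_sq {g g₁ : ℂ → ℂ} {K b c : ℂ} (hg : AnalyticAt ℂ g 0) (h0 : g 0 ≠ 0)
    (hK : K ≠ 0) (h : ∀ z, g₁ z = K * cexp (b * z ^ 2) * g (c * z)) (k : ℕ+) :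
    logCoeff g₁ k = c ^ (k : ℕ) * logCoeff g k + if k = 2 then 2 * b else 0 := by
  have hc : Tendsto (fun z : ℂ => c * z) (𝓝 0) (𝓝 0) := by
    have : Continuous fun z : ℂ => c * z := by fun_prop
    simpa using this.tendsto 0
  have hA := analyticAt_log_div hg h0
  have hsmall : Tendsto (fun z : ℂ => b * z ^ 2 + Complex.log (g (c * z) / g 0)) (𝓝 0) (𝓝 0) := by
    have h1 : Tendsto (fun z : ℂ => b * z ^ 2) (𝓝 0) (𝓝 0) := by
      have : Continuous fun z : ℂ => b * z ^ 2 := by fun_prop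
      simpa using this.tendsto 0
    have h2 := hA.continuousAt.tendsto.comp hc
    simp only [div_self h0, Complex.log_one] at h2
    simpa using h1.add h2
  have hg0 : ∀ᶠ z in 𝓝 (0 : ℂ), g (c * z) ≠ 0 :=
    (hg.continuousAt.tendsto.comp hc).eventually_ne h0
  have him : ∀ᶠ z in 𝓝 (0 : ℂ), ‖b * z ^ 2 + Complex.log (g (c * z) / g 0)‖ < π := by
    have := hsmall.norm
    rw [norm_zero] at this
    exact this.eventually_lt_const Real.pi_pos
  have hs := iteratedDeriv_eq_of_hasSum (f := fun z => Complex.log (g₁ z / g₁ 0))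
    (a := fun n => c ^ n * (logCoeff g n / n.factorial) + if n = 2 then b else 0) ?_ k
  · rw [logCoeff, hs]
    have h3 : ((k : ℕ).factorial : ℂ) ≠ 0 := by exact_mod_cast (k : ℕ).factorial_ne_zero
    rw [mul_add, mul_left_comm, mul_div_cancel₀ _ h3]
    congr 1
    by_cases hk : k = 2
    · subst hk
      simp
    · have : (k : ℕ) ≠ 2 := fun h => hk (PNat.coe_injective h)
      simp [hk, this]
  · filter_upwards [hc.eventually (hasSum_of_analyticAt hA), hg0, him] with z hz hgz hi
    have e1 : Complex.log (g₁ z / g₁ 0) = Complex.log (g (c * z) / g 0) + b * z ^ 2 := by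
      have : g₁ z / g₁ 0 = cexp (b * z ^ 2 + Complex.log (g (c * z) / g 0)) := by
        rw [Complex.exp_add, Complex.exp_log (div_ne_zero hgz h0), h, h]
        simp only [mul_zero, ne_eq, OfNat.ofNat_ne_zero, not_false_eq_true, zero_pow, Complex.exp_zero,
          mul_one]
        field_simp
      rw [this, Complex.log_exp, add_comm]
      · have := (abs_lt.mp ((Complex.abs_im_le_norm _).trans_lt hi)).1
        exact this
      · exact (abs_lt.mp ((Complex.abs_im_le_norm _).trans_lt hi)).2.le
    rw [e1]
    have h2 : HasSum (fun n : ℕ => (if n = 2 then b else 0) * z ^ n) (b * z ^ 2) := by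
      convert hasSum_ite_eq 2 (b * z ^ 2) using 2 with n
      split_ifs with hn
      · rw [hn]
      · simp
    refine Eq.subst (motive := fun f => HasSum f _) (funext fun n => ?_) (hz.add h2)
    simp only [logCoeff]
    ring

/-- Joint limits pass through quotients and logarithms by the usual limit laws; for a continuous
limit function they amount to locally uniform convergence. -/
lemma tendstoLocallyUniformlyOn_of_tendsto {ι : Type*} {l : Filter ι} {F : ι → ℂ → ℂ} {f : ℂ → ℂ}
    {s : Set ℂ} (hf : ContinuousOn f s)
    (h : ∀ x ∈ s, Tendsto (fun p : ι × ℂ => F p.1 p.2) (l ×ˢ 𝓝[s] x) (𝓝 (f x))) :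
    TendstoLocallyUniformlyOn F f l s := by
  rw [tendstoLocallyUniformlyOn_iff_forall_tendsto]
  intro x hx
  exact (((hf x hx).tendsto.comp tendsto_snd).prodMk_nhds (h x hx)).mono_right (nhds_le_uniformity _)

lemma tendsto_iteratedDeriv {ι : Type*} {l : Filter ι} {U : Set ℂ} (hU : IsOpen U) (k : ℕ) :
    ∀ {F : ι → ℂ → ℂ} {f : ℂ → ℂ}, TendstoLocallyUniformlyOn F f l U →
      (∀ᶠ t in l, DifferentiableOn ℂ (F t) U) → ∀ x ∈ U,
      Tendsto (fun t => iteratedDeriv k (F t) x) l (𝓝 (iteratedDeriv k f x)) := by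
  induction k with
  | zero => intro F f h _ x hx; simpa using h.tendsto_at hx
  | succ k ih =>
    intro F f h hd x hx
    simp only [iteratedDeriv_succ']
    exact ih (h.deriv hd hU) (hd.mono fun t ht => ht.deriv hU) x hx

/-- On a small disc the normalized functions stay in the slit plane, so their logarithms are
eventually holomorphic and converge locally uniformly; all derivatives then converge. -/
lemma tendsto_logCoeff {ι : Type*} {l : Filter ι} {F : ι → ℂ → ℂ} {f : ℂ → ℂ} {r : ℝ} (hr : 0 < r)
    (hF : TendstoUniformlyOn F f l (Metric.ball 0 r)) (hd : ∀ t, Differentiable ℂ (F t))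
    (hf : ContinuousOn f (Metric.ball 0 r)) (h0 : f 0 ≠ 0) (k : ℕ) :
    Tendsto (fun t => logCoeff (F t) k) l (𝓝 (logCoeff f k)) := by
  have hb : Metric.ball (0 : ℂ) r ∈ 𝓝 0 := Metric.ball_mem_nhds 0 hr
  have hpos : 0 < ‖f 0‖ := norm_pos_iff.mpr h0
  have hev : ∀ᶠ z in 𝓝 (0 : ℂ), ‖f z - f 0‖ < ‖f 0‖ / 4 := by
    have : Tendsto (fun z => ‖f z - f 0‖) (𝓝 0) (𝓝 ‖f 0 - f 0‖) :=
      ((hf.continuousAt hb).tendsto.sub_const _).norm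
    refine this.eventually_lt_const ?_
    rw [sub_self, norm_zero]; positivity
  obtain ⟨ε, hε, hball⟩ := Metric.eventually_nhds_iff_ball.mp (hev.and hb)
  have hsub : Metric.ball (0 : ℂ) ε ⊆ Metric.ball 0 r := fun z hz => (hball z hz).2
  have hz0 : (0 : ℂ) ∈ Metric.ball (0 : ℂ) ε := Metric.mem_ball_self hε
  have hslit : ∀ v : ℂ, ‖v - 1‖ < 1 → v ∈ Complex.slitPlane := fun v hv => by
    left
    have := (abs_lt.mp ((Complex.abs_re_le_norm (v - 1)).trans_lt hv)).1
    simp at this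
    exact this
  have hdiv : ∀ v v₀ : ℂ, ‖v - v₀‖ < ‖v₀‖ → v / v₀ ∈ Complex.slitPlane := fun v v₀ h => by
    have hv : 0 < ‖v₀‖ := (norm_nonneg _).trans_lt h
    refine hslit _ ?_
    rw [div_sub_one (norm_pos_iff.mp hv), norm_div, div_lt_one hv]
    exact h
  have hf0 : ∀ z ∈ Metric.ball (0 : ℂ) ε, f z / f 0 ∈ Complex.slitPlane := fun z hz =>
    hdiv _ _ (by linarith [(hball z hz).1])
  have hF0 : Tendsto (fun t => F t 0) l (𝓝 (f 0)) := hF.tendsto_at (hsub hz0)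
  have hFd : ∀ᶠ t in l, DifferentiableOn ℂ (fun z => Complex.log (F t z / F t 0))
      (Metric.ball 0 ε) := by
    -- The variation of F_t is below 1/4 + 1/8 + 1/8 = 1/2 of |f(0)|, while |F_t(0)| is at least 7/8
    -- of it.
    filter_upwards [Metric.tendstoUniformlyOn_iff.mp hF (‖f 0‖ / 8) (by positivity)] with t ht
    intro z hz
    have h1 := ht z (hsub hz)
    have h2 := ht 0 (hsub hz0)
    have h3 := (hball z hz).1
    rw [dist_eq_norm] at h1 h2
    have h4 : ‖F t z - F t 0‖ < ‖F t 0‖ := by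
      have e1 : ‖F t z - F t 0‖ ≤ ‖f z - f 0‖ + ‖f z - F t z‖ + ‖f 0 - F t 0‖ := by
        rw [show F t z - F t 0 = (f z - f 0) - (f z - F t z) + (f 0 - F t 0) by ring]
        exact (norm_add_le _ _).trans (add_le_add_left (norm_sub_le _ _) _)
      have e2 : ‖f 0‖ ≤ ‖F t 0‖ + ‖f 0 - F t 0‖ := by
        have := norm_add_le (F t 0) (f 0 - F t 0)
        rwa [add_sub_cancel] at this
      linarith
    exact (((hd t z).div_const _).clog (hdiv _ _ h4)).differentiableWithinAt
  have hFu := hF.mono hsub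
  have hfc := hf.mono hsub
  refine tendsto_iteratedDeriv Metric.isOpen_ball k (tendstoLocallyUniformlyOn_of_tendsto ?_ ?_)
    hFd 0 hz0
  · intro z hz
    exact ((hfc z hz).div_const _).clog (hf0 z hz)
  · intro x hx
    have h1 : Tendsto (fun p : ι × ℂ => F p.1 p.2) (l ×ˢ 𝓝[Metric.ball 0 ε] x) (𝓝 (f x)) :=
      ((hfc x hx).tendsto.comp tendsto_snd).congr_uniformity
        (tendstoLocallyUniformlyOn_iff_forall_tendsto.mp hFu.tendstoLocallyUniformlyOn x hx)
    exact (h1.div (hF0.comp tendsto_fst) h0).clog (hf0 x hx)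

/-! ### Double power series in two variables. -/

/-- The `n`-th Taylor coefficient at `0`, as a mean over the circle of radius `R`. -/
def circleCoeff (R : ℝ) (f : ℂ → ℂ) (n : ℕ) : ℂ :=
  (2 * π : ℂ)⁻¹ * ∫ θ in (0 : ℝ)..2 * π, f (circleMap 0 R θ) * ((circleMap 0 R θ)⁻¹) ^ n

lemma hasSum_circleCoeff {R : ℝ} (hR : 0 < R) {f : ℂ → ℂ}
    (hc : ContinuousOn f (Metric.closedBall 0 R)) (hd : DifferentiableOn ℂ f (Metric.ball 0 R))
    {z : ℂ} (hz : ‖z‖ < R) : HasSum (fun n => circleCoeff R f n * z ^ n) (f z) := by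
  have hcl : DiffContOnCl ℂ f (Metric.ball 0 R) := by
    refine ⟨hd, ?_⟩
    rwa [closure_ball _ hR.ne']
  have h1 := hcl.two_pi_i_inv_smul_circleIntegral_sub_inv_smul (w := z) (by simpa using hz)
  have h2 := (hasSum_two_pi_I_cauchyPowerSeries_integral (f := f) (c := 0) (R := R) (w := z)
    ((hc.mono Metric.sphere_subset_closedBall).circleIntegrable hR.le) hz).mul_left (2 * π * I)⁻¹
  rw [zero_add] at h2
  rw [smul_eq_mul] at h1
  rw [h1] at h2
  refine Eq.subst (motive := fun g => HasSum g _) (funext fun n => ?_) h2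
  have hI := I_ne_zero
  rw [circleCoeff, circleIntegral, mul_assoc (2 * π : ℂ)⁻¹ _ (z ^ n),
    ← intervalIntegral.integral_mul_const, mul_inv (2 * π : ℂ) I, mul_assoc,
    ← intervalIntegral.integral_const_mul]
  congr 1
  refine intervalIntegral.integral_congr fun θ _ => ?_
  have hne : circleMap 0 R θ ≠ 0 := circleMap_ne_center hR.ne'
  simp only [deriv_circleMap, sub_zero, smul_eq_mul]
  field_simp
  rw [div_pow, div_pow, one_pow]
  ring

lemma norm_circleCoeff_le {R M : ℝ} (hR : 0 < R) {f : ℂ → ℂ}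
    (hf : ∀ θ, ‖f (circleMap 0 R θ)‖ ≤ M) (n : ℕ) : ‖circleCoeff R f n‖ ≤ M * (R⁻¹) ^ n := by
  have h := intervalIntegral.norm_integral_le_of_norm_le_const (a := (0 : ℝ)) (b := 2 * π)
    (C := M * (R⁻¹) ^ n) (f := fun θ : ℝ => f (circleMap 0 R θ) * ((circleMap 0 R θ)⁻¹) ^ n)
    fun θ _ => by
      rw [norm_mul, norm_pow, norm_inv, norm_circleMap_zero, abs_of_pos hR]
      exact mul_le_mul_of_nonneg_right (hf θ) (by positivity)
  have hpi := Real.pi_pos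
  rw [circleCoeff, norm_mul, norm_inv, norm_mul, Complex.norm_ofNat, Complex.norm_real,
    Real.norm_of_nonneg hpi.le]
  rw [sub_zero, abs_of_pos (by positivity)] at h
  calc (2 * π)⁻¹ * _ ≤ (2 * π)⁻¹ * (M * R⁻¹ ^ n * (2 * π)) := by gcongr
    _ = _ := by field_simp

/-- A continuous, separately holomorphic function of two variables is the sum of an absolutely
convergent double power series. -/
theorem exists_hasSum_double {R : ℝ} (hR : 0 < R) {F : ℂ → ℂ → ℂ}
    (hc : ContinuousOn (fun p : ℂ × ℂ => F p.1 p.2) (Metric.closedBall 0 R ×ˢ Metric.closedBall 0 R))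
    (h1 : ∀ u ∈ Metric.closedBall (0 : ℂ) R, DifferentiableOn ℂ (fun z => F z u) (Metric.ball 0 R))
    (h2 : ∀ z ∈ Metric.closedBall (0 : ℂ) R, DifferentiableOn ℂ (F z) (Metric.ball 0 R)) :
    ∃ a : ℕ × ℕ → ℂ, ∀ z u : ℂ, ‖z‖ < R → ‖u‖ < R →
      HasSum (fun p : ℕ × ℕ => a p * z ^ p.1 * u ^ p.2) (F z u) := by
  have hcm : ∀ θ : ℝ, circleMap 0 R θ ∈ Metric.closedBall (0 : ℂ) R := fun θ =>
    circleMap_mem_closedBall 0 hR.le θ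
  have hc1 : ∀ u ∈ Metric.closedBall (0 : ℂ) R, ContinuousOn (fun z => F z u) (Metric.closedBall 0 R) :=
    fun u hu => hc.comp (f := fun z => (z, u)) (by fun_prop) fun z hz => ⟨hz, hu⟩
  have hc2 : ∀ z ∈ Metric.closedBall (0 : ℂ) R, ContinuousOn (F z) (Metric.closedBall 0 R) :=
    fun z hz => hc.comp (f := fun u => (z, u)) (by fun_prop) fun u hu => ⟨hz, hu⟩
  obtain ⟨M, hM⟩ := ((isCompact_closedBall (0 : ℂ) R).prod
    (isCompact_closedBall (0 : ℂ) R)).exists_bound_of_continuousOn hc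
  have hM' : ∀ z u, z ∈ Metric.closedBall (0 : ℂ) R → u ∈ Metric.closedBall (0 : ℂ) R → ‖F z u‖ ≤ M :=
    fun z u hz hu => hM (z, u) ⟨hz, hu⟩
  have hM0 : 0 ≤ M := (norm_nonneg _).trans (hM' _ _ (hcm 0) (hcm 0))
  have hb : ∀ z ∈ Metric.closedBall (0 : ℂ) R, ∀ l, ‖circleCoeff R (F z) l‖ ≤ M * (R⁻¹) ^ l :=
    fun z hz l => norm_circleCoeff_le hR (fun θ => hM' _ _ hz (hcm θ)) l
  have hbc : ∀ l, Continuous fun θ : ℝ => circleCoeff R (F (circleMap 0 R θ)) l := by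
    intro l
    refine continuous_const.mul
      (intervalIntegral.continuous_parametric_intervalIntegral_of_continuous' ?_ _ _)
    refine Continuous.mul ?_ ?_
    · exact hc.comp_continuous (f := fun p : ℝ × ℝ => (circleMap 0 R p.1, circleMap 0 R p.2))
        (by fun_prop) fun p => ⟨hcm _, hcm _⟩
    · refine Continuous.pow (Continuous.inv₀ (by fun_prop) fun p => circleMap_ne_center hR.ne') _
  -- Iterated Cauchy means: F(ζ, u) is expanded in u on the circle |ζ| = R and integrated term by
  -- term. The bound M R^{-k-l} gives absolute convergence.
  refine ⟨fun p => circleCoeff R (fun ζ => circleCoeff R (F ζ) p.2) p.1, fun z u hz hu => ?_⟩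
  have hu' : u ∈ Metric.closedBall (0 : ℂ) R := by simpa using hu.le
  have hr : ‖u‖ * R⁻¹ < 1 := by rw [← div_eq_mul_inv]; exact (div_lt_one hR).mpr hu
  have hrz : ‖z‖ * R⁻¹ < 1 := by rw [← div_eq_mul_inv]; exact (div_lt_one hR).mpr hz
  have hgu := summable_geometric_of_lt_one (by positivity) hr
  have hgz := summable_geometric_of_lt_one (by positivity) hrz
  have hsummable : Summable fun p : ℕ × ℕ =>
      circleCoeff R (fun ζ => circleCoeff R (F ζ) p.2) p.1 * z ^ p.1 * u ^ p.2 := by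
    refine ((hgz.mul_of_nonneg hgu (fun _ => by positivity) (fun _ => by positivity)).mul_left
      M).of_norm_bounded fun p => ?_
    have := norm_circleCoeff_le (M := M * (R⁻¹) ^ p.2) hR
      (f := fun ζ => circleCoeff R (F ζ) p.2) (fun θ => hb _ (hcm θ) _) p.1
    rw [norm_mul, norm_mul, norm_pow, norm_pow, mul_pow, mul_pow]
    calc _ ≤ M * R⁻¹ ^ p.2 * R⁻¹ ^ p.1 * ‖z‖ ^ p.1 * ‖u‖ ^ p.2 := by gcongr
      _ = _ := by ring
  have hinner : ∀ k, HasSum (fun l => circleCoeff R (fun ζ => circleCoeff R (F ζ) l) k * u ^ l)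
      (circleCoeff R (fun ζ => F ζ u) k) := by
    intro k
    have := intervalIntegral.hasSum_integral_of_dominated_convergence (a := 0) (b := 2 * π)
      (μ := MeasureTheory.volume)
      (F := fun (l : ℕ) (θ : ℝ) => circleCoeff R (F (circleMap 0 R θ)) l *
        ((circleMap 0 R θ)⁻¹) ^ k * u ^ l)
      (f := fun θ : ℝ => F (circleMap 0 R θ) u * ((circleMap 0 R θ)⁻¹) ^ k)
      (fun l _ => M * (R⁻¹) ^ k * (‖u‖ * R⁻¹) ^ l)
      (fun l => (((hbc l).mul ((Continuous.inv₀ (by fun_prop)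
        fun θ => circleMap_ne_center hR.ne').pow k)).mul continuous_const).aestronglyMeasurable)
      (fun l => Eventually.of_forall fun θ _ => by
        rw [norm_mul, norm_mul, norm_pow, norm_pow, norm_inv, norm_circleMap_zero, abs_of_pos hR]
        calc _ ≤ M * R⁻¹ ^ l * R⁻¹ ^ k * ‖u‖ ^ l := by gcongr; exact hb _ (hcm θ) l
          _ = _ := by rw [mul_pow]; ring)
      (Eventually.of_forall fun θ _ => hgu.mul_left _) intervalIntegrable_const
      (Eventually.of_forall fun θ _ => by
        have := (hasSum_circleCoeff hR (hc2 _ (hcm θ)) (h2 _ (hcm θ)) hu).mul_right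
          (((circleMap 0 R θ)⁻¹) ^ k)
        refine Eq.subst (motive := fun g => HasSum g _) (funext fun n => ?_) this
        ring)
    refine Eq.subst (motive := fun g => HasSum g _) (funext fun l => ?_)
      (this.mul_left (2 * π : ℂ)⁻¹)
    rw [circleCoeff, intervalIntegral.integral_mul_const, mul_assoc]
  refine (hsummable.hasSum_iff).mpr ?_
  rw [hsummable.tsum_prod]
  have houter := hasSum_circleCoeff hR (hc1 u hu') (h1 u hu') hz
  rw [← houter.tsum_eq]
  refine tsum_congr fun k => ?_
  rw [mul_comm, ← (hinner k).tsum_eq, ← tsum_mul_left]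
  refine tsum_congr fun l => ?_
  ring

/-- The double power series of the logarithm of a separately entire function that does not vanish
at the origin; its pure powers of the first variable are the one-variable coefficients. -/
theorem exists_hasSum_log_double {G : ℂ → ℂ → ℂ} (hc : Continuous fun p : ℂ × ℂ => G p.1 p.2)
    (h1 : ∀ u, Differentiable ℂ fun z => G z u) (h2 : ∀ z, Differentiable ℂ (G z))
    (h0 : G 0 0 ≠ 0) : ∃ a : ℕ × ℕ → ℂ, (∀ k, a (k, 0) = logCoeff (fun z => G z 0) k / k.factorial) ∧
      ∃ R > 0, ∀ z u : ℂ, ‖z‖ < R → ‖u‖ < R →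
        G z u ≠ 0 ∧ HasSum (fun p : ℕ × ℕ => a p * z ^ p.1 * u ^ p.2) (Complex.log (G z u / G 0 0)) := by
  have hq : Continuous fun p : ℂ × ℂ => G p.1 p.2 / G 0 0 := hc.div_const _
  have hev : ∀ᶠ p in 𝓝 ((0 : ℂ), (0 : ℂ)), G p.1 p.2 / G 0 0 ∈ Complex.slitPlane :=
    hq.continuousAt.eventually_mem (Complex.isOpen_slitPlane.mem_nhds (by
      simp only [div_self h0]
      exact Complex.one_mem_slitPlane))
  obtain ⟨ε, hε, hball⟩ := Metric.eventually_nhds_iff_ball.mp hev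
  have hmem : ∀ z ∈ Metric.closedBall (0 : ℂ) (ε / 2), ∀ u ∈ Metric.closedBall (0 : ℂ) (ε / 2),
      G z u / G 0 0 ∈ Complex.slitPlane := by
    intro z hz u hu
    refine hball (z, u) ?_
    rw [Metric.mem_ball, Prod.dist_eq]
    refine max_lt ?_ ?_
    · exact (Metric.mem_closedBall.mp hz).trans_lt (by linarith)
    · exact (Metric.mem_closedBall.mp hu).trans_lt (by linarith)
  have hR : 0 < ε / 2 := by positivity
  obtain ⟨a, ha⟩ := exists_hasSum_double (F := fun z u => Complex.log (G z u / G 0 0)) hR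
    (hq.continuousOn.clog fun p hp => hmem _ hp.1 _ hp.2)
    (fun u hu z hz => (((h1 u z).div_const _).clog
      (hmem _ (Metric.ball_subset_closedBall hz) _ hu)).differentiableWithinAt)
    (fun z hz u hu => (((h2 z u).div_const _).clog
      (hmem _ hz _ (Metric.ball_subset_closedBall hu))).differentiableWithinAt)
  refine ⟨a, fun k => ?_, ε / 2, hR, fun z u hz hu => ⟨fun h => ?_, ha z u hz hu⟩⟩
  · have hk : (k.factorial : ℂ) ≠ 0 := by exact_mod_cast k.factorial_ne_zero
    rw [eq_div_iff hk, mul_comm, logCoeff]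
    refine (iteratedDeriv_eq_of_hasSum (a := fun k => a (k, 0)) ?_ k).symm
    filter_upwards [Metric.ball_mem_nhds (0 : ℂ) hR] with z hz
    -- At u = 0 only the terms with l = 0 survive, as 0^0 = 1.
    have h := ha z 0 (by simpa using hz) (by simpa using hR)
    have hinj : Function.Injective fun k : ℕ => (k, 0) := fun _ _ h => congrArg Prod.fst h
    have := (hinj.hasSum_iff (f := fun p : ℕ × ℕ => a p * z ^ p.1 * (0 : ℂ) ^ p.2) ?_).mpr h
    · simpa [Function.comp_def] using this
    · rintro ⟨k, l⟩ hkl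
      have : l ≠ 0 := fun hl => hkl ⟨k, by simp [hl]⟩
      simp [this]
  · have := hmem z (by simpa using hz.le) u (by simpa using hu.le)
    rw [h, zero_div] at this
    exact Complex.slitPlane_ne_zero this rfl

/-! ### Ĥ in terms of characteristics, with z̄ made an independent variable. -/

lemma sqrt_ofReal_mul {r : ℝ} (hr : 0 < r) (z : ℂ) :
    Complex.sqrt (r * z) = (√r : ℝ) * Complex.sqrt z := by
  rcases eq_or_ne z 0 with rfl | hz
  · simp
  have hr' : (r : ℂ) ≠ 0 := by exact_mod_cast hr.ne'
  have h2 : cexp (((Real.log r : ℝ) : ℂ) / 2) = ((√r : ℝ) : ℂ) := by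
    rw [Real.sqrt_eq_rpow, Real.rpow_def_of_pos hr]
    push_cast
    congr 1
    ring
  rw [sqrt_eq_exp (mul_ne_zero hr' hz), sqrt_eq_exp hz, Complex.log_ofReal_mul hr hz, add_div,
    Complex.exp_add, h2]

lemma jacobiVartheta_eq (A B τ : ℂ) : jacobiVartheta (A * τ + B) τ =
    I * (cexp (-π * I * (A ^ 2 * τ + 2 * A * B)) * thetaChar A B τ) := by
  rw [jacobiVartheta, thetaChar, ← tsum_mul_left (a := cexp _)]
  congr 1
  refine tsum_congr fun n => ?_
  rw [thetaTerm, e, e, mul_assoc, ← Complex.exp_add, mul_left_comm (cexp _) ((-1 : ℂ) ^ n),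
    ← Complex.exp_add]
  congr 2
  ring

/-- The prefactor completes the square in x = n + 1/2 + A. For `jacobiVartheta_eq` any splitting z =
Aτ + B will do; here A also sits inside the error function and must be Im z / Im τ. -/
lemma psiHat_eq {z τ w A B : ℂ} (hA : ((z.im / τ.im : ℝ) : ℂ) = A) (hB : z = A * τ + B) :
    psiHat z τ w = I * (cexp (-π * I * (A ^ 2 * τ + 2 * A * B)) *
      psiChar A B τ (Complex.sqrt (I * (w - τ)))) := by
  rw [psiHat, psiChar, ← tsum_mul_left (a := cexp _), hA]
  congr 1
  refine tsum_congr fun n => ?_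
  rw [psiTerm, mul_assoc (π : ℂ) I, sqrt_ofReal_mul Real.pi_pos, thetaTerm, e, e, hB,
    mul_assoc (_ * (-1 : ℂ) ^ n), ← Complex.exp_add,
    show 2 * π * I * ((n + 1 / 2) ^ 2 / 2 * τ) + 2 * π * I * ((n + 1 / 2) * (A * τ + B)) =
      -π * I * (A ^ 2 * τ + 2 * A * B) +
        π * I * ((n + 1 / 2 + A) ^ 2 * τ + 2 * (n + 1 / 2 + A) * B) by ring, Complex.exp_add]
  ring_nf

lemma THat_eq {z τ w A B : ℂ} (hA : ((z.im / τ.im : ℝ) : ℂ) = A) (hB : z = A * τ + B) :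
    THat z τ w = I * (cexp (-π * I * (A ^ 2 * τ + 2 * A * B)) *
      (thetaChar A B τ + psiChar A B τ (Complex.sqrt (I * (w - τ))))) := by
  rw [THat, psiHat_eq hA hB]
  nth_rewrite 1 [hB]
  rw [jacobiVartheta_eq]
  ring

/-- The difference of the two shifts by `1/3` of a function of the characteristics. -/
def shiftDiff (X : ℂ → ℂ → ℂ) (α β : ℂ) : ℂ := -X (α + 1 / 3) (3 * β) + X (α - 1 / 3) (3 * β)

/-- The sum of the theta series and the completed false theta series at `3τ`. -/
def thetaPsi (τ s A B : ℂ) : ℂ := thetaChar A B (3 * τ) + psiChar A B (3 * τ) s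

/-- The `τ`-coordinate of the point `z` with formal conjugate `u`. -/
def coordA (τ z u : ℂ) : ℂ := (z - u) / (τ - conj τ)

/-- The constant coordinate of the point `z` with formal conjugate `u`. -/
def coordB (τ z u : ℂ) : ℂ := (u * τ - z * conj τ) / (τ - conj τ)

/-- `Ĥ(z) / (2i sin πz)` with `z̄` replaced by an independent variable `u`. -/
def polarH (τ s z u : ℂ) : ℂ :=
  -(1 / 2) * cexp (-π * I * τ / 12) * cexp (-3 * π * I * coordA τ z u * (z + coordB τ z u)) *
    shiftDiff (thetaPsi τ s) (coordA τ z u) (coordB τ z u)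

lemma sub_conj_ne_zero (τ : ℍ) : (τ : ℂ) - conj (τ : ℂ) ≠ 0 := by
  rw [Complex.sub_conj]
  simp [τ.im_ne_zero]

lemma coordA_mul_add_coordB (τ : ℍ) (z u : ℂ) : coordA τ z u * τ + coordB τ z u = z := by
  have := sub_conj_ne_zero τ
  rw [coordA, coordB]
  field_simp
  ring

/-- The parameter `√(i(3w - 3τ))` of the completed false theta series in `Ĥ`. -/
def sqrtDiff (τ w : ℂ) : ℂ := Complex.sqrt (I * (3 * w - 3 * τ))

lemma sqrtDiff_sq (τ w : ℂ) : sqrtDiff τ w ^ 2 = I * (3 * w - 3 * τ) := sqrt_sq _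

lemma e_half_sub_e_neg_half (z : ℂ) : e (z / 2) - e (-z / 2) = 2 * I * Complex.sin (π * z) := by
  rw [Complex.sin, e, e, show 2 * π * I * (z / 2) = π * z * I by ring,
    show 2 * π * I * (-z / 2) = -(π * z) * I by ring]
  linear_combination (-(cexp (-(π * z) * I) - cexp (π * z * I))) * I_mul_I

/-- The translations by ±τ at modulus 3τ are shifts of A by ±1/3. The exponential prefactors of the
two terms agree because they depend on the sign σ only through σ² = 1. -/
theorem HHat_eq (τ w : ℍ) (z : ℂ) :
    HHat z τ w = 2 * I * Complex.sin (π * z) * polarH τ (sqrtDiff τ w) z (conj z) := by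
  have hz := coordA_mul_add_coordB τ z (conj z)
  have hα : coordA τ z (conj z) = ((z.im / (τ : ℂ).im : ℝ) : ℂ) := by
    rw [coordA, Complex.sub_conj, Complex.sub_conj]
    have h1 : ((τ : ℂ).im : ℂ) ≠ 0 := by exact_mod_cast τ.im_ne_zero
    push_cast
    field_simp
  have him : (τ : ℂ).im ≠ 0 := τ.im_ne_zero
  rw [HHat, polarH]
  set α := coordA τ z (conj z)
  set β := coordB τ z (conj z)
  have hp : THat (3 * z + τ) (3 * τ) (3 * w) = I * (cexp (-π * I * ((α + 1 / 3) ^ 2 * (3 * τ) +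
      2 * (α + 1 / 3) * (3 * β))) * thetaPsi τ (sqrtDiff τ w) (α + 1 / 3) (3 * β)) := by
    refine THat_eq ?_ (by rw [← hz]; ring)
    rw [hα]
    simp only [Complex.add_im, Complex.mul_im, Complex.re_ofNat, Complex.im_ofNat, zero_mul, add_zero]
    push_cast
    have h1 : ((τ : ℂ).im : ℂ) ≠ 0 := by exact_mod_cast him
    field_simp
  have hm : THat (3 * z - τ) (3 * τ) (3 * w) = I * (cexp (-π * I * ((α - 1 / 3) ^ 2 * (3 * τ) +
      2 * (α - 1 / 3) * (3 * β))) * thetaPsi τ (sqrtDiff τ w) (α - 1 / 3) (3 * β)) := by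
    refine THat_eq ?_ (by rw [← hz]; ring)
    rw [hα]
    simp only [Complex.sub_im, Complex.mul_im, Complex.re_ofNat, Complex.im_ofNat, zero_mul, add_zero]
    push_cast
    have h1 : ((τ : ℂ).im : ℂ) ≠ 0 := by exact_mod_cast him
    field_simp
  rw [hp, hm, e_half_sub_e_neg_half, shiftDiff]
  have key : ∀ σ : ℂ, σ ^ 2 = 1 → e (τ / 8) * (e (σ * z) * cexp (-π * I * ((α + σ / 3) ^ 2 * (3 * τ) +
      2 * (α + σ / 3) * (3 * β)))) =
      cexp (-π * I * τ / 12) * cexp (-3 * π * I * α * (z + β)) := by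
    intro σ hσ
    rw [e, e, ← Complex.exp_add, ← Complex.exp_add, ← Complex.exp_add]
    congr 1
    rw [← hz]
    linear_combination (-(π * I * τ / 3)) * hσ
  have k1 := key 1 (by ring)
  have k2 := key (-1) (by ring)
  rw [one_mul] at k1
  rw [neg_one_mul, show α + -1 / 3 = α - 1 / 3 by ring] at k2
  linear_combination (2 * I * Complex.sin (π * z) * I / 2 * -thetaPsi τ (sqrtDiff τ w) (α + 1 / 3) (3 * β) * I) * k1 +
    (2 * I * Complex.sin (π * z) * I / 2 * thetaPsi τ (sqrtDiff τ w) (α - 1 / 3) (3 * β) * I) * k2 +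
    (2 * I * Complex.sin (π * z) / 2 * (-thetaPsi τ (sqrtDiff τ w) (α + 1 / 3) (3 * β) +
      thetaPsi τ (sqrtDiff τ w) (α - 1 / 3) (3 * β)) *
      (cexp (-π * I * τ / 12) * cexp (-3 * π * I * α * (z + β)))) * I_mul_I

/-- The point `3τ` of the upper half-plane. -/
def triple (τ : ℍ) : ℍ := ⟨3 * τ, by simpa using τ.im_pos⟩

lemma coe_triple (τ : ℍ) : (triple τ : ℂ) = 3 * τ := rfl

lemma sqrtDiff_mem (τ w : ℍ) : sqrtDiff τ w ∈ sqDomain (3 * τ) :=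
  mem_sqDomain (τ := triple τ) (w := triple w) (sqrtDiff_sq τ w)

lemma differentiable_polarH_comp {τ : ℍ} {s : ℂ} (hs : s ∈ sqDomain (3 * τ)) {z u : ℂ → ℂ}
    (hz : Differentiable ℂ z) (hu : Differentiable ℂ u) :
    Differentiable ℂ fun x => polarH τ s (z x) (u x) := by
  have h3 : 0 < (3 * (τ : ℂ)).im := (triple τ).im_pos
  have hA : Differentiable ℂ fun x => coordA τ (z x) (u x) := by
    simp only [coordA]; fun_prop
  have hB : Differentiable ℂ fun x => coordB τ (z x) (u x) := by
    simp only [coordB]; fun_prop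
  have hT : ∀ c : ℂ, Differentiable ℂ fun x => thetaPsi τ s (coordA τ (z x) (u x) + c)
      (3 * coordB τ (z x) (u x)) := by
    intro c
    have h1 : Differentiable ℂ fun x => coordA τ (z x) (u x) + c := by fun_prop
    have h2 : Differentiable ℂ fun x => 3 * coordB τ (z x) (u x) := by fun_prop
    refine Differentiable.add ?_ (differentiable_psiChar h1 h2 h3 hs)
    exact differentiableOn_univ.mp (differentiableOn_thetaChar isOpen_univ h1.differentiableOn
      h2.differentiableOn (differentiableOn_const _) fun _ _ => h3)
  have h1 := hT (1 / 3)
  have h2 := hT (-(1 / 3))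
  simp only [← sub_eq_add_neg] at h2
  simp only [polarH, shiftDiff]
  fun_prop

lemma continuous_polarH {τ : ℍ} {s : ℂ} (hs : s ∈ sqDomain (3 * τ)) :
    Continuous fun p : ℂ × ℂ => polarH τ s p.1 p.2 := by
  have h3 : 0 < (3 * (τ : ℂ)).im := (triple τ).im_pos
  have hA : Continuous fun p : ℂ × ℂ => coordA τ p.1 p.2 := by
    simp only [coordA]; fun_prop
  have hB : Continuous fun p : ℂ × ℂ => coordB τ p.1 p.2 := by
    simp only [coordB]; fun_prop
  have hT : ∀ c : ℂ, Continuous fun p : ℂ × ℂ => thetaPsi τ s (coordA τ p.1 p.2 + c)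
      (3 * coordB τ p.1 p.2) := by
    intro c
    have h1 : Continuous fun p : ℂ × ℂ => coordA τ p.1 p.2 + c := by fun_prop
    have h2 : Continuous fun p : ℂ × ℂ => 3 * coordB τ p.1 p.2 := by fun_prop
    exact (continuous_thetaChar h1 h2 h3).add (continuous_psiChar h1 h2 h3 hs)
  have h1 := hT (1 / 3)
  have h2 := hT (-(1 / 3))
  simp only [← sub_eq_add_neg] at h2
  simp only [polarH, shiftDiff]
  fun_prop

/-- At the origin the even error function series cancels in the difference and the odd theta series
doubles. The value is independent of w, and it is nonzero because η is. -/
lemma polarH_zero (τ : ℍ) (s : ℂ) :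
    polarH τ s 0 0 = -(cexp (-π * I * τ / 12) * ModularForm.eta τ) := by
  have h1 := thetaChar_neg (1 / 3) 0 (3 * τ)
  have h2 := psiChar_neg (1 / 3) 0 (3 * τ) s
  rw [neg_zero] at h1 h2
  simp only [polarH, shiftDiff, thetaPsi, coordA, coordB, sub_zero, zero_div, zero_mul, mul_zero,
    zero_add, zero_sub, Complex.exp_zero, mul_one]
  rw [h1, h2, thetaChar_one_third]
  ring

lemma polarH_zero_ne_zero (τ : ℍ) (s : ℂ) : polarH τ s 0 0 ≠ 0 := by
  rw [polarH_zero]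
  exact neg_ne_zero.mpr (mul_ne_zero (Complex.exp_ne_zero _) (ModularForm.eta_ne_zero τ.im_pos))

/-- Away from 0 there is no holomorphy in z, but the slope at 0 is that of 2i sin(πz) times a
continuous function. -/
lemma HHatDeriv_eq (τ w : ℍ) : HHatDeriv τ w = polarH τ (sqrtDiff τ w) 0 0 := by
  have hpi : (2 * π * I : ℂ) ≠ 0 := by simp [Real.pi_ne_zero, I_ne_zero]
  have hsin : HasDerivAt (fun x : ℂ => 2 * I * Complex.sin (π * x)) (2 * π * I) 0 := by
    have h1 : HasDerivAt (fun x : ℂ => (π : ℂ) * x) π 0 := by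
      simpa using (hasDerivAt_id (0 : ℂ)).const_mul (π : ℂ)
    refine ((h1.csin).const_mul (2 * I)).congr_deriv ?_
    simp
    ring
  have hcont : Continuous fun x : ℂ => polarH τ (sqrtDiff τ w) x (conj x) :=
    (continuous_polarH (sqrtDiff_mem τ w)).comp (f := fun x : ℂ => (x, conj x)) (by fun_prop)
  have hd : HasDerivAt (fun x : ℂ => HHat x τ w)
      (2 * π * I * polarH τ (sqrtDiff τ w) 0 (conj 0)) 0 := by
    rw [hasDerivAt_iff_tendsto_slope] at hsin ⊢
    refine (hsin.mul (hcont.continuousAt.tendsto.mono_left nhdsWithin_le_nhds)).congr fun x => ?_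
    simp only [slope_def_field, HHat_eq, mul_zero, Complex.sin_zero, zero_mul, sub_zero]
    ring
  rw [HHatDeriv, hd.deriv, map_zero]
  field_simp

/-! ### Transformation under Γ₀(3). -/

/-- The common transformation of `shiftDiff` under matrices with upper row `(a, 3b)` and lower row
`(c/3, d)`, for functions of the characteristics with the shift laws of theta series. -/
lemma exists_shiftDiff_law {a b c d : ℤ} (hdet : a * d - b * (3 * c) = 1) :
    ∃ κ : ℂ, κ ≠ 0 ∧ ∀ (X X₁ : ℂ → ℂ → ℂ) (μ : ℂ),
      (∀ A B, cexp (-π * I * A * B) * X₁ A B = μ * (cexp (-π * I * (a * A + c * B) *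
        ((3 * b : ℤ) * A + d * B)) * X (a * A + c * B) ((3 * b : ℤ) * A + d * B))) →
      (∀ (A B : ℂ) (m : ℤ), X (A + m) B = (-1) ^ m * X A B) →
      (∀ (A B : ℂ) (m : ℤ), X A (B + m) = (-1) ^ m * cexp (2 * π * I * A * m) * X A B) →
      ∀ α β α₁ β₁ : ℂ, α = a * α₁ + 3 * c * β₁ → β = b * α₁ + d * β₁ →
        shiftDiff X₁ α₁ β₁ = μ * κ * cexp (3 * π * I * (α₁ * β₁ - α * β)) * shiftDiff X α β := by
  have ha : a % 3 = 1 ∨ a % 3 = 2 := by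
    have : a % 3 ≠ 0 := by
      intro h
      obtain ⟨k, hk⟩ := Int.dvd_of_emod_eq_zero h
      have : (3 : ℤ) ∣ 1 := ⟨k * d - b * c, by rw [← hdet, hk]; ring⟩
      omega
    omega
  have hunit : ∀ n : ℤ, ((-1 : ℂ) ^ n) ≠ 0 := fun n => zpow_ne_zero _ (by norm_num)
  -- the shift by `σ / 3` is carried to the shift by `σ a / 3`
  have key : ∀ (X X₁ : ℂ → ℂ → ℂ) (μ : ℂ),
      (∀ A B, cexp (-π * I * A * B) * X₁ A B = μ * (cexp (-π * I * (a * A + c * B) *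
        ((3 * b : ℤ) * A + d * B)) * X (a * A + c * B) ((3 * b : ℤ) * A + d * B))) →
      (∀ (A B : ℂ) (m : ℤ), X A (B + m) = (-1) ^ m * cexp (2 * π * I * A * m) * X A B) →
      ∀ α β α₁ β₁ : ℂ, α = a * α₁ + 3 * c * β₁ → β = b * α₁ + d * β₁ → ∀ σ : ℤ, σ = 1 ∨ σ = -1 →
        X₁ (α₁ + σ / 3) (3 * β₁) = μ * ((-1) ^ b * cexp (π * I * a * b / 3)) *
          cexp (3 * π * I * (α₁ * β₁ - α * β)) * X (α + σ * a / 3) (3 * β) := by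
    intro X X₁ μ hlaw hr α β α₁ β₁ hα hβ σ hσ
    have h := hlaw (α₁ + σ / 3) (3 * β₁)
    have e1 : (a : ℂ) * (α₁ + σ / 3) + c * (3 * β₁) = α + σ * a / 3 := by rw [hα]; ring
    have e2 : ((3 * b : ℤ) : ℂ) * (α₁ + σ / 3) + d * (3 * β₁) = 3 * β + ((σ * b : ℤ) : ℂ) := by
      rw [hβ]; push_cast; ring
    have hd : (a : ℂ) * d - b * (3 * c) = 1 := by exact_mod_cast hdet
    rw [e1, e2, hr] at h
    have hs : (-1 : ℂ) ^ (σ * b) = (-1) ^ b := by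
      rcases hσ with rfl | rfl
      · rw [one_mul]
      · rw [neg_one_mul, zpow_neg, ← inv_zpow]; norm_num
    have hσ2 : (σ : ℂ) ^ 2 = 1 := by rcases hσ with rfl | rfl <;> norm_num
    rw [hs] at h
    have hE : cexp (-π * I * (α₁ + σ / 3) * (3 * β₁)) ≠ 0 := Complex.exp_ne_zero _
    apply mul_left_cancel₀ hE
    rw [h]
    have hexp : cexp (-π * I * (α + σ * a / 3) * (3 * β + ((σ * b : ℤ) : ℂ))) *
        cexp (2 * π * I * (α + σ * a / 3) * ((σ * b : ℤ) : ℂ)) =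
        cexp (-π * I * (α₁ + σ / 3) * (3 * β₁)) * (cexp (π * I * a * b / 3) *
          cexp (3 * π * I * (α₁ * β₁ - α * β))) := by
      simp only [← Complex.exp_add]
      congr 1
      rw [hα, hβ]
      push_cast
      linear_combination (π * I * a * b / 3) * hσ2 - (π * I * σ * β₁) * hd
    linear_combination (μ * (-1) ^ b * X (α + σ * a / 3) (3 * β)) * hexp
  -- Modulo integers the shifts ±a/3 are ±1/3 if a ≡ 1 and are interchanged if a ≡ -1 mod 3, which
  -- puts a minus sign into κ. Since κ does not depend on X, it is common to both series.
  rcases ha with h1 | h1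
  · obtain ⟨k, hk⟩ : ∃ k, a = 1 + 3 * k := ⟨a / 3, by omega⟩
    refine ⟨(-1) ^ b * cexp (π * I * a * b / 3) * (-1) ^ k,
      mul_ne_zero (mul_ne_zero (hunit _) (Complex.exp_ne_zero _)) (hunit _), ?_⟩
    intro X X₁ μ hlaw hl hr α β α₁ β₁ hα hβ
    have k1 := key X X₁ μ hlaw hr α β α₁ β₁ hα hβ 1 (Or.inl rfl)
    have k2 := key X X₁ μ hlaw hr α β α₁ β₁ hα hβ (-1) (Or.inr rfl)
    have ha' : (a : ℂ) = 1 + 3 * k := by exact_mod_cast hk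
    have e1 : α + ((1 : ℤ) : ℂ) * a / 3 = α + 1 / 3 + (k : ℤ) := by rw [ha']; push_cast; ring
    have e2 : α + ((-1 : ℤ) : ℂ) * a / 3 = α - 1 / 3 + ((-k : ℤ) : ℂ) := by rw [ha']; push_cast; ring
    rw [e1, hl, show α₁ + ((1 : ℤ) : ℂ) / 3 = α₁ + 1 / 3 by push_cast; ring] at k1
    rw [e2, hl, zpow_neg, ← inv_zpow, show (-1 : ℂ)⁻¹ = -1 by norm_num,
      show α₁ + ((-1 : ℤ) : ℂ) / 3 = α₁ - 1 / 3 by push_cast; ring] at k2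
    rw [shiftDiff, shiftDiff, k1, k2]
    ring
  · obtain ⟨k, hk⟩ : ∃ k, a = -1 + 3 * k := ⟨a / 3 + 1, by omega⟩
    refine ⟨-((-1) ^ b * cexp (π * I * a * b / 3) * (-1) ^ k),
      neg_ne_zero.mpr (mul_ne_zero (mul_ne_zero (hunit _) (Complex.exp_ne_zero _)) (hunit _)), ?_⟩
    intro X X₁ μ hlaw hl hr α β α₁ β₁ hα hβ
    have k1 := key X X₁ μ hlaw hr α β α₁ β₁ hα hβ 1 (Or.inl rfl)
    have k2 := key X X₁ μ hlaw hr α β α₁ β₁ hα hβ (-1) (Or.inr rfl)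
    have ha' : (a : ℂ) = -1 + 3 * k := by exact_mod_cast hk
    have e1 : α + ((1 : ℤ) : ℂ) * a / 3 = α - 1 / 3 + (k : ℤ) := by rw [ha']; push_cast; ring
    have e2 : α + ((-1 : ℤ) : ℂ) * a / 3 = α + 1 / 3 + ((-k : ℤ) : ℂ) := by rw [ha']; push_cast; ring
    rw [e1, hl, show α₁ + ((1 : ℤ) : ℂ) / 3 = α₁ + 1 / 3 by push_cast; ring] at k1
    rw [e2, hl, zpow_neg, ← inv_zpow, show (-1 : ℂ)⁻¹ = -1 by norm_num,
      show α₁ + ((-1 : ℤ) : ℂ) / 3 = α₁ - 1 / 3 by push_cast; ring] at k2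
    rw [shiftDiff, shiftDiff, k1, k2]
    ring

lemma shiftDiff_thetaPsi (τ s α β : ℂ) : shiftDiff (thetaPsi τ s) α β =
    shiftDiff (fun A B => thetaChar A B (3 * τ)) α β +
      shiftDiff (fun A B => psiChar A B (3 * τ) s) α β := by
  simp only [shiftDiff, thetaPsi]
  ring

lemma shiftDiff_thetaChar_neg (τ α β : ℂ) :
    shiftDiff (fun A B => thetaChar A B τ) (-α) (-β) = shiftDiff (fun A B => thetaChar A B τ) α β := by
  simp only [shiftDiff]
  rw [show -α + 1 / 3 = -(α - 1 / 3) by ring, show -α - 1 / 3 = -(α + 1 / 3) by ring,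
    show 3 * -β = -(3 * β) by ring, thetaChar_neg, thetaChar_neg]
  ring

lemma shiftDiff_psiChar_neg (τ s α β : ℂ) :
    shiftDiff (fun A B => psiChar A B τ s) (-α) (-β) =
      -shiftDiff (fun A B => psiChar A B τ s) α β := by
  simp only [shiftDiff]
  rw [show -α + 1 / 3 = -(α - 1 / 3) by ring, show -α - 1 / 3 = -(α + 1 / 3) by ring,
    show 3 * -β = -(3 * β) by ring, psiChar_neg, psiChar_neg]
  ring

lemma shiftDiff_psiChar_neg_right (τ s α β : ℂ) :
    shiftDiff (fun A B => psiChar A B τ (-s)) α β =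
      -shiftDiff (fun A B => psiChar A B τ s) α β := by
  simp only [shiftDiff, psiChar_neg_right]
  ring

lemma coordA_neg (τ z u : ℂ) : coordA τ (-z) (-u) = -coordA τ z u := by
  simp only [coordA]; ring

lemma coordB_neg (τ z u : ℂ) : coordB τ (-z) (-u) = -coordB τ z u := by
  simp only [coordB]; ring

/-- Negating s negates only the error function part. So does negating (z, u): the two shifts are
exchanged, so the odd theta series contributes an even difference and the even one an odd
difference, while the prefactor is even. -/
lemma polarH_neg (τ s z u : ℂ) : polarH τ (-s) z u = polarH τ s (-z) (-u) := by
  simp only [polarH, coordA_neg, coordB_neg, shiftDiff_thetaPsi, shiftDiff_thetaChar_neg,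
    shiftDiff_psiChar_neg, shiftDiff_psiChar_neg_right]
  ring_nf

lemma conj_den (γ : SL(2, ℤ)) (τ : ℂ) : conj (den γ τ) = den γ (conj τ) := by
  simp [den]

lemma coordA_smul (γ : SL(2, ℤ)) (τ : ℍ) (z : ℂ) :
    coordA (γ • τ : ℍ) (z / den γ τ) 0 = (γ 1 1 : ℤ) * coordA τ z 0 - (γ 1 0 : ℤ) * coordB τ z 0 := by
  have hj := den_ne_zero γ τ
  have hjc : den γ (conj (τ : ℂ)) ≠ 0 := by rw [← conj_den]; simpa using hj
  have hd := sub_conj_ne_zero τ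
  have hdet := sl2_det_complex γ
  have h1 : ((γ • τ : ℍ) : ℂ) - conj ((γ • τ : ℍ) : ℂ) =
      ((τ : ℂ) - conj (τ : ℂ)) / (den γ τ * den γ (conj (τ : ℂ))) := by
    rw [coe_sl2_smul, map_div₀, conj_den]
    simp only [map_add, map_mul, map_intCast]
    rw [div_sub_div _ _ hj hjc]
    congr 1
    simp only [den]
    linear_combination ((τ : ℂ) - conj (τ : ℂ)) * hdet
  rw [coordA, h1, coordA, coordB]
  field_simp
  simp only [den]
  ring

/-- As the formal conjugate u would be divided by cτ̄+d, the slice u = 0 is preserved. On it the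
coordinates of z in the basis τ, 1 change linearly under γ. -/
lemma coord_smul (γ : SL(2, ℤ)) (τ : ℍ) (z : ℂ) :
    coordA τ z 0 = (γ 0 0 : ℤ) * coordA (γ • τ : ℍ) (z / den γ τ) 0 +
      (γ 1 0 : ℤ) * coordB (γ • τ : ℍ) (z / den γ τ) 0 ∧
    coordB τ z 0 = (γ 0 1 : ℤ) * coordA (γ • τ : ℍ) (z / den γ τ) 0 +
      (γ 1 1 : ℤ) * coordB (γ • τ : ℍ) (z / den γ τ) 0 := by
  have hj := den_ne_zero γ τ
  have hdet := sl2_det_complex γ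
  have h1 := coordA_smul γ τ z
  have h2 := coordA_mul_add_coordB (γ • τ) (z / den γ τ) 0
  have h3 := coordA_mul_add_coordB τ z 0
  generalize coordA (γ • τ : ℍ) (z / den γ τ) 0 = α₁ at *
  generalize coordB (γ • τ : ℍ) (z / den γ τ) 0 = β₁ at *
  generalize coordA τ z 0 = α at *
  generalize coordB τ z 0 = β at *
  rw [coe_sl2_smul] at h2
  have hβ : β₁ = -((γ 0 1 : ℤ) : ℂ) * α + (γ 0 0 : ℤ) * β := by
    have h4 : β₁ * den γ τ = z - α₁ * (((γ 0 0 : ℤ) : ℂ) * τ + ((γ 0 1 : ℤ) : ℂ)) := by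
      field_simp at h2
      linear_combination h2
    apply mul_right_cancel₀ hj
    rw [h4, h1, ← h3]
    simp only [den]
    linear_combination (-(α * τ + β)) * hdet
  rw [h1, hβ]
  constructor
  · linear_combination (-α) * hdet
  · linear_combination (-β) * hdet

/-- The element `(a, 3b; c/3, d)` that acts on `3τ` as `(a, b; c, d)` acts on `τ`. -/
lemma exists_conj_triple {γ : SL(2, ℤ)} (hγ : γ ∈ CongruenceSubgroup.Gamma0 3) :
    ∃ γ' : SL(2, ℤ), γ' 0 0 = γ 0 0 ∧ γ' 0 1 = 3 * γ 0 1 ∧ γ 1 0 = 3 * γ' 1 0 ∧ γ' 1 1 = γ 1 1 := by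
  have h3 : (3 : ℤ) ∣ γ 1 0 := by
    rw [CongruenceSubgroup.Gamma0_mem] at hγ
    exact_mod_cast (ZMod.intCast_zmod_eq_zero_iff_dvd (γ 1 0) 3).mp hγ
  obtain ⟨c, hc⟩ := h3
  have hdet := sl2_det γ
  refine ⟨⟨!![γ 0 0, 3 * γ 0 1; c, γ 1 1], ?_⟩, rfl, rfl, hc, rfl⟩
  rw [Matrix.det_fin_two_of]
  rw [hc] at hdet
  linear_combination hdet

/-- This is where χ enters: it compares the principal root at the transformed pair with the root for
which the Eichler integral is modular. The positive factor 3 leaves the sign unaffected. -/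
lemma sqrtDiff_smul (γ : SL(2, ℤ)) {τ w : ℍ} (h : τ ≠ w) :
    sqrtDiff (γ • τ : ℍ) (γ • w : ℍ) = chi τ w γ *
      (sqrtDiff τ w / (Complex.sqrt (den γ τ) * Complex.sqrt (den γ w))) := by
  have hne : (w : ℂ) - τ ≠ 0 := sub_ne_zero.mpr fun he => h (UpperHalfPlane.ext he.symm)
  have h1 : Complex.sqrt (den γ τ) ≠ 0 := sqrt_ne_zero (den_ne_zero γ τ)
  have h2 : Complex.sqrt (den γ w) ≠ 0 := sqrt_ne_zero (den_ne_zero γ w)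
  have h3 : Complex.sqrt (I * (w - τ)) ≠ 0 := sqrt_ne_zero (mul_ne_zero I_ne_zero hne)
  have e1 : sqrtDiff τ w = (√(3 : ℝ) : ℝ) * Complex.sqrt (I * (w - τ)) := by
    rw [← sqrt_ofReal_mul (by norm_num), sqrtDiff]
    congr 1
    push_cast
    ring
  have e2 : sqrtDiff (γ • τ : ℍ) (γ • w : ℍ) = (√(3 : ℝ) : ℝ) *
      Complex.sqrt (I * (w - τ) / (den γ τ * den γ w)) := by
    rw [← sqrt_ofReal_mul (by norm_num), sqrtDiff]
    congr 1
    have := coe_smul_sub_coe_smul γ τ w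
    push_cast
    linear_combination (3 * I) * this
  rw [e1, e2, chi]
  field_simp

lemma chi_eq_one_or (γ : SL(2, ℤ)) {τ w : ℍ} (h : τ ≠ w) : chi τ w γ = 1 ∨ chi τ w γ = -1 := by
  have hne : (w : ℂ) - τ ≠ 0 := sub_ne_zero.mpr fun he => h (UpperHalfPlane.ext he.symm)
  have h1 := den_ne_zero γ τ
  have h2 := den_ne_zero γ w
  have hI := I_ne_zero
  rw [← sq_eq_one_iff, chi, div_pow, mul_pow, mul_pow, sqrt_sq, sqrt_sq, sqrt_sq, sqrt_sq]
  field_simp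

/-- Modularity of `Ĥ / (2i sin πz)` with `z̄` set to `0`. -/
theorem exists_polarH_smul {γ : SL(2, ℤ)} (hγ : γ ∈ CongruenceSubgroup.Gamma0 3) {τ w : ℍ}
    (h : τ ≠ w) : ∃ K : ℂ, K ≠ 0 ∧ ∀ z : ℂ,
      polarH (γ • τ : ℍ) (sqrtDiff (γ • τ : ℍ) (γ • w : ℍ)) z 0 =
        K * cexp (3 * π * I * (γ 1 0 : ℤ) * den γ τ * z ^ 2) *
          polarH τ (sqrtDiff τ w) (chi τ w γ * den γ τ * z) 0 := by
  obtain ⟨γ', h00, h01, h10, h11⟩ := exists_conj_triple hγ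
  obtain ⟨m, hm0, hm⟩ := exists_theta_psi_smul γ'
  have hj := den_ne_zero γ τ
  have hden : ∀ v : ℍ, den γ' (3 * (v : ℂ)) = den γ v := by
    intro v
    simp only [den, h10, h11]
    push_cast
    ring
  have htri : ∀ v : ℍ, ((γ' • triple v : ℍ) : ℂ) = 3 * (γ • v : ℍ) := by
    intro v
    rw [coe_sl2_smul, coe_sl2_smul, coe_triple, hden, h00, h01]
    push_cast
    ring
  obtain ⟨κ, hκ0, hκ⟩ := exists_shiftDiff_law (a := γ 0 0) (b := γ 0 1) (c := γ' 1 0) (d := γ 1 1)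
    (by rw [← h10]; exact sl2_det γ)
  set s := sqrtDiff τ w with hs
  set s₁ := s / (Complex.sqrt (den γ τ) * Complex.sqrt (den γ w)) with hs₁
  set μ := m * Complex.sqrt (den γ τ) with hμ
  have hμ0 : μ ≠ 0 := mul_ne_zero hm0 (sqrt_ne_zero hj)
  have hlaw := fun A B => hm (triple τ) (triple w) s A B (sqrtDiff_sq τ w)
  simp only [hden, htri, h00, h01, h11, coe_triple] at hlaw
  simp only [← hs₁, ← hμ] at hlaw
  have main : ∀ z : ℂ, polarH (γ • τ : ℍ) s₁ (z / den γ τ) 0 =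
      (cexp (-π * I * (γ • τ : ℍ) / 12) / cexp (-π * I * τ / 12) * (μ * κ)) *
        cexp (3 * π * I * (γ 1 0 : ℤ) * z ^ 2 / den γ τ) * polarH τ s z 0 := by
    intro z
    obtain ⟨hα, hβ⟩ := coord_smul γ τ z
    have hA := coordA_smul γ τ z
    have hz := coordA_mul_add_coordB τ z 0
    simp only [polarH, shiftDiff_thetaPsi]
    set α₁ := coordA (γ • τ : ℍ) (z / den γ τ) 0
    set β₁ := coordB (γ • τ : ℍ) (z / den γ τ) 0
    set α := coordA τ z 0
    set β := coordB τ z 0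
    rw [h10] at hα
    have hα' : α = ((γ 0 0 : ℤ) : ℂ) * α₁ + 3 * ((γ' 1 0 : ℤ) : ℂ) * β₁ := by
      rw [hα]; push_cast; ring
    have e1 := hκ (fun A B => thetaChar A B (3 * τ)) (fun A B => thetaChar A B (3 * (γ • τ : ℍ))) μ
      (fun A B => (hlaw A B).1) (fun A B m => thetaChar_add_int_left A B _ m)
      (fun A B m => thetaChar_add_int_right A B _ m) α β α₁ β₁ hα' hβ
    have e2 := hκ (fun A B => psiChar A B (3 * τ) s) (fun A B => psiChar A B (3 * (γ • τ : ℍ)) s₁) μ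
      (fun A B => (hlaw A B).2) (fun A B m => psiChar_add_int_left A B _ _ m)
      (fun A B m => psiChar_add_int_right A B _ _ m) α β α₁ β₁ hα' hβ
    rw [e1, e2]
    have hE : cexp (-π * I * τ / 12) ≠ 0 := Complex.exp_ne_zero _
    -- The anomaly in z² comes from α₁ = α(cτ+d) - cz.
    have hexp : cexp (-3 * π * I * α₁ * (z / den γ τ + β₁)) *
        cexp (3 * π * I * (α₁ * β₁ - α * β)) =
        cexp (3 * π * I * (γ 1 0 : ℤ) * z ^ 2 / den γ τ) * cexp (-3 * π * I * α * (z + β)) := by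
      rw [← Complex.exp_add, ← Complex.exp_add]
      congr 1
      have : α₁ = α * den γ τ - (γ 1 0 : ℤ) * z := by
        rw [hA, ← hz, den]; ring
      rw [this]
      field_simp
      ring
    rw [div_mul_eq_mul_div, div_mul_eq_mul_div, div_mul_eq_mul_div, eq_div_iff hE]
    linear_combination (-(1 / 2) * cexp (-π * I * (γ • τ : ℍ) / 12) * μ * κ * cexp (-π * I * τ / 12) *
      (shiftDiff (fun A B => thetaChar A B (3 * τ)) α β +
        shiftDiff (fun A B => psiChar A B (3 * τ) s) α β)) * hexp
  refine ⟨_, mul_ne_zero (div_ne_zero (Complex.exp_ne_zero (-π * I * (γ • τ : ℍ) / 12))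
    (Complex.exp_ne_zero (-π * I * τ / 12))) (mul_ne_zero hμ0 hκ0), fun z => ?_⟩
  rw [sqrtDiff_smul γ h, ← hs, ← hs₁]
  -- If χ = -1, the wrong root is traded for z ↦ -z by `polarH_neg`, which is the factor χ in the
  -- argument.
  rcases chi_eq_one_or γ h with hχ | hχ
  · have := main (den γ τ * z)
    rw [mul_div_cancel_left₀ _ hj] at this
    rw [hχ, one_mul, one_mul, this]
    congr 3
    field_simp
  · have := main (den γ τ * -z)
    rw [mul_div_cancel_left₀ _ hj] at this
    rw [hχ, neg_one_mul, polarH_neg, neg_zero, this, show -1 * den γ τ * z = den γ τ * -z by ring]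
    congr 3
    field_simp

/-! ### The completed coefficients ĥ_k. -/

/-- The coefficient functions `ĥ_k`. -/
def completedEisenstein (k : ℕ+) (τ w : ℍ) : ℂ :=
  -(logCoeff (fun z => polarH τ (sqrtDiff τ w) z 0) k / (2 * π * I) ^ (k : ℕ))

/-- The quadratic exponent 3πi c(cτ+d)z² contributes 6πi c(cτ+d) to the second derivative; division
by -(2πi)² gives 3ic(cτ+d)/(2π). -/
theorem completedEisenstein_smul (k : ℕ+) {γ : SL(2, ℤ)} (hγ : γ ∈ CongruenceSubgroup.Gamma0 3)
    {τ w : ℍ} (h : τ ≠ w) : completedEisenstein k (γ • τ) (γ • w) =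
      chi τ w γ ^ (k : ℕ) * den γ τ ^ (k : ℕ) * completedEisenstein k τ w +
        (if k = 2 then 3 * I * ((γ 1 0 : ℤ) : ℂ) / (2 * π) * den γ τ else 0) := by
  obtain ⟨K, hK, hlaw⟩ := exists_polarH_smul hγ h
  have hd : Differentiable ℂ fun z => polarH τ (sqrtDiff τ w) z 0 :=
    differentiable_polarH_comp (sqrtDiff_mem τ w) differentiable_fun_id (differentiable_const 0)
  have := logCoeff_congr_exp_sq (hd.analyticAt 0) (polarH_zero_ne_zero τ _) hK hlaw k
  rw [completedEisenstein, completedEisenstein, this, mul_pow]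
  have hpi : (π : ℂ) ≠ 0 := by simp [Real.pi_ne_zero]
  have hI := I_ne_zero
  have h2 := two_pi_I_ne_zero
  split_ifs with hk
  · subst hk
    rw [show ((2 : ℕ+) : ℕ) = 2 from rfl]
    have e : (2 * π * I : ℂ) ^ 2 = -(4 * π ^ 2) := by
      linear_combination (4 * π ^ 2 : ℂ) * I_mul_I
    rw [e]
    field_simp
    ring
  · rw [add_zero, add_zero]
    ring

/-- The double exponential Taylor expansion of `Ĥ`. -/
theorem exists_isCompletedCoeffs (τ w : ℍ) : ∃ c : ℕ × ℕ → ℂ, IsCompletedCoeffs τ w c ∧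
    ∀ k : ℕ+, c ((k : ℕ), 0) = completedEisenstein k τ w := by
  have hs := sqrtDiff_mem τ w
  obtain ⟨a, ha0, R, hR, ha⟩ := exists_hasSum_log_double
    (G := fun z u => polarH τ (sqrtDiff τ w) z u) (continuous_polarH hs)
    (fun u => differentiable_polarH_comp hs differentiable_fun_id (differentiable_const u))
    (fun z => differentiable_polarH_comp hs (differentiable_const z) differentiable_fun_id)
    (polarH_zero_ne_zero τ _)
  have h2 := two_pi_I_ne_zero
  have hfac : ∀ n : ℕ, (n.factorial : ℂ) ≠ 0 := fun n => by exact_mod_cast n.factorial_ne_zero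
  refine ⟨fun p => -(a p * (p.1.factorial * p.2.factorial) / (2 * π * I) ^ (p.1 + p.2)), ⟨?_, ?_⟩,
    fun k => ?_⟩
  · simp [ha0, logCoeff, div_self (polarH_zero_ne_zero τ _)]
  · filter_upwards [Metric.ball_mem_nhds (0 : ℂ) hR] with z hz
    have hz' : ‖z‖ < R := by simpa using hz
    obtain ⟨hne, hsum⟩ := ha z (conj z) hz' (by rwa [Complex.norm_conj])
    refine ⟨-Complex.log (polarH τ (sqrtDiff τ w) z (conj z) / polarH τ (sqrtDiff τ w) 0 0), ?_, ?_⟩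
    · refine Eq.subst (motive := fun f => HasSum f _) (funext fun p => ?_) hsum.neg
      have h3 := hfac p.1
      have h4 := hfac p.2
      rw [mul_pow (2 * π * I : ℂ) z, mul_pow (2 * π * I : ℂ) (conj z), pow_add]
      have h5 := pow_ne_zero p.1 h2
      have h6 := pow_ne_zero p.2 h2
      generalize (2 * π * I : ℂ) ^ p.1 = x at h5 ⊢
      generalize (2 * π * I : ℂ) ^ p.2 = y at h6 ⊢
      field_simp
    · have h0 := polarH_zero_ne_zero τ (sqrtDiff τ w)
      rw [neg_neg, Complex.exp_log (div_ne_zero hne h0), HHatDeriv_eq, HHat_eq]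
      field_simp
  · have h3 := hfac k
    simp only [completedEisenstein, ha0]
    simp only [add_zero, Nat.factorial_zero, Nat.cast_one, mul_one]
    field_simp

/-! ### The limit w → τ + i∞ and the false Eisenstein series. -/

/-- The Gaussian integral along the ray through Z. It writes erf Z - 1 as the tail over r > 1; Re Z
> 0 selects Z among the two roots of Z². -/
lemma mul_integral_gaussian_Ioi {Z : ℂ} (hZ : 0 < Z.re) (hZ2 : 0 < (Z ^ 2).re) :
    2 / (√π : ℝ) * ∫ r in Set.Ioi (0 : ℝ), Z * cexp (-(Z ^ 2) * r ^ 2) = 1 := by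
  have hZ0 : Z ≠ 0 := by
    rintro rfl
    simp at hZ
  have hre : 0 < (((√π : ℝ) : ℂ) / Z).re := by
    rw [Complex.div_re]
    have := Complex.normSq_pos.mpr hZ0
    have := Real.sqrt_pos.mpr Real.pi_pos
    simp only [Complex.ofReal_re, Complex.ofReal_im, zero_mul, zero_div, add_zero]
    positivity
  have h1 : ((π : ℂ) / Z ^ 2) ^ (1 / 2 : ℂ) = ((√π : ℝ) : ℂ) / Z := by
    rw [← sqrt_pi_sq, ← div_pow, one_div, Complex.sq_cpow_two_inv hre]
  rw [MeasureTheory.integral_const_mul, integral_gaussian_complex_Ioi hZ2, h1]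
  have := sqrt_pi_ne_zero
  field_simp

/-- The tail bound for the error function in the sector `|arg Z| < π/4`. -/
lemma norm_erf_sub_one_le {Z : ℂ} (hZ : 0 < Z.re) (hZ2 : 0 < (Z ^ 2).re) :
    ‖erf Z - 1‖ ≤ 2 * ‖Z‖ / (Z ^ 2).re * Real.exp (-(Z ^ 2).re) := by
  set c := (Z ^ 2).re with hc
  have hint : MeasureTheory.Integrable fun r : ℝ => Z * cexp (-(Z ^ 2) * r ^ 2) :=
    (integrable_cexp_neg_mul_sq hZ2).const_mul Z
  have herf : erf Z - 1 = -(2 / (√π : ℝ) * ∫ r in Set.Ioi (1 : ℝ), Z * cexp (-(Z ^ 2) * r ^ 2)) := by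
    have h1 := intervalIntegral.integral_interval_add_Ioi (a := 0) (b := 1)
      hint.integrableOn hint.integrableOn
    have h2 : erf Z = 2 / (√π : ℝ) * ∫ r in (0 : ℝ)..1, Z * cexp (-(Z ^ 2) * r ^ 2) := by
      rw [erf]
      congr 1
      refine intervalIntegral.integral_congr fun r _ => ?_
      congr 2
      ring
    rw [← mul_integral_gaussian_Ioi hZ hZ2, ← h1, h2]
    ring
  have hsq : (1 : ℝ) ≤ √π := Real.one_le_sqrt.mpr (by linarith [Real.pi_gt_three])
  -- Beyond r = 1 one has r² ≥ r, so an exponential tail dominates the Gaussian one.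
  have hbound : ‖∫ r in Set.Ioi (1 : ℝ), Z * cexp (-(Z ^ 2) * r ^ 2)‖ ≤
      ∫ r in Set.Ioi (1 : ℝ), ‖Z‖ * Real.exp (-c * r) := by
    refine MeasureTheory.norm_integral_le_of_norm_le
      ((integrableOn_exp_mul_Ioi (neg_neg_of_pos hZ2) 1).const_mul _) ?_
    filter_upwards [MeasureTheory.ae_restrict_mem measurableSet_Ioi] with r hr
    have hr1 : (1 : ℝ) < r := hr
    rw [norm_mul, Complex.norm_exp]
    refine mul_le_mul_of_nonneg_left (Real.exp_le_exp.mpr ?_) (norm_nonneg _)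
    rw [← Complex.ofReal_pow, Complex.re_mul_ofReal, Complex.neg_re]
    nlinarith [mul_pos hZ2 (sub_pos.mpr hr1)]
  rw [MeasureTheory.integral_const_mul (‖Z‖), integral_exp_mul_Ioi (neg_neg_of_pos hZ2)] at hbound
  rw [herf, norm_neg, norm_mul, norm_div, Complex.norm_real, Real.norm_of_nonneg (by positivity),
    Complex.norm_ofNat]
  have h2 : 2 / √π ≤ 2 := div_le_self (by norm_num) hsq
  refine (mul_le_mul h2 hbound (norm_nonneg _) (by norm_num)).trans (le_of_eq ?_)
  rw [mul_one]
  field_simp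

lemma norm_erf_sub_one_le_of_sq_le {Z : ℂ} (hZ : 0 < Z.re) (h1 : 1 ≤ (Z ^ 2).re)
    (h2 : ‖Z‖ ^ 2 ≤ 16 * (Z ^ 2).re) : ‖erf Z - 1‖ ≤ 8 * Real.exp (-(Z ^ 2).re) := by
  refine (norm_erf_sub_one_le hZ (by linarith)).trans
    (mul_le_mul_of_nonneg_right ?_ (Real.exp_pos _).le)
  rw [div_le_iff₀ (by linarith)]
  have : ‖Z‖ ≤ 4 * (Z ^ 2).re := abs_le_of_sq_le_sq' (by nlinarith) (by linarith) |>.2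
  linarith

lemma sqrtDiff_add (τ : ℂ) (t ε : ℝ) :
    sqrtDiff τ (τ + I * t + ε) = Complex.sqrt ((-(3 * t) : ℝ) + (3 * ε : ℝ) * I) := by
  rw [sqrtDiff]
  congr 1
  push_cast
  linear_combination (3 * t : ℂ) * I_mul_I

/-- The arguments of the error function approach `±∞` inside the sector `|arg Z| < π/4`. -/
lemma norm_erf_sqrtDiff_sub_one_le (τ : ℂ) {ε t : ℝ} (hε : 0 < ε) (ht : 2 * ε ≤ t) (ht' : 64 ≤ t)
    {x : ℂ} (hx : 1 / 8 ≤ x.re) (hx' : |x.im| ≤ x.re / 2) :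
    ‖erf (-I * (√π : ℝ) * sqrtDiff τ (τ + I * t + ε) * x) - 1‖ ≤ 8 * Real.exp (-(t / 64)) := by
  set s := sqrtDiff τ (τ + I * t + ε) with hs
  have hs' := hs
  rw [sqrtDiff_add] at hs'
  set v : ℂ := (-(3 * t) : ℝ) + (3 * ε : ℝ) * I with hv
  have hvre : v.re = -(3 * t) := by simp [hv]
  have hvim : v.im = 3 * ε := by simp [hv]
  have hre : s.re = √((‖v‖ + v.re) / 2) := by rw [hs', Complex.sqrt, Complex.cpow_inv_two_re]
  -- Here ε > 0 matters: v = -3t + 3iε lies in the upper half-plane, so its principal root is close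
  -- to +i√(3t), and Z is close to √(3πt) x, in the right half-plane.
  have him : s.im = √((‖v‖ - v.re) / 2) := by
    rw [hs', Complex.sqrt, Complex.cpow_inv_two_im_eq_sqrt (by rw [hvim]; positivity)]
  have him0 : 0 < s.im := by
    rw [him]
    exact Real.sqrt_pos.mpr (by rw [hvre]; linarith [norm_nonneg v])
  have hre0 : 0 ≤ s.re := by rw [hre]; exact Real.sqrt_nonneg _
  have hle : s.re ≤ s.im := by
    rw [hre, him]
    exact Real.sqrt_le_sqrt (by rw [hvre]; linarith)
  have hs2 : s ^ 2 = v := by rw [hs', sqrt_sq]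
  obtain ⟨hq1, hq2⟩ := abs_le.mp hx'
  set Z : ℂ := -I * (√π : ℝ) * s * x with hZ
  have hZre : Z.re = √π * (s.im * x.re + s.re * x.im) := by
    simp [hZ]
    ring
  have hZ2 : Z ^ 2 = ((3 * π : ℝ) : ℂ) * ((t - ε * I) * x ^ 2) := by
    rw [hZ, mul_pow, mul_pow, mul_pow, sqrt_pi_sq, hs2, hv]
    push_cast
    linear_combination (π * (-(3 * t) + 3 * ε * I) * x ^ 2 : ℂ) * I_mul_I
  have hZ2re : (Z ^ 2).re = 3 * π * (t * (x.re ^ 2 - x.im ^ 2) + 2 * ε * (x.re * x.im)) := by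
    rw [hZ2, Complex.re_ofReal_mul]
    simp [pow_two]
    ring
  have hpi := Real.pi_gt_three
  have hp : 0 < x.re := by linarith
  have him2 : x.im ^ 2 ≤ x.re ^ 2 / 4 := by nlinarith
  have hprod : -(x.re ^ 2 / 2) ≤ x.re * x.im := by nlinarith
  have hlow : t * x.re ^ 2 / 4 ≤ t * (x.re ^ 2 - x.im ^ 2) + 2 * ε * (x.re * x.im) := by
    have h1 : t * (3 / 4 * x.re ^ 2) ≤ t * (x.re ^ 2 - x.im ^ 2) :=
      mul_le_mul_of_nonneg_left (by linarith) (by linarith)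
    have h2 : 2 * ε * -(x.re ^ 2 / 2) ≤ 2 * ε * (x.re * x.im) :=
      mul_le_mul_of_nonneg_left hprod (by linarith)
    have h3 : 2 * ε * x.re ^ 2 ≤ t * x.re ^ 2 := mul_le_mul_of_nonneg_right ht (sq_nonneg _)
    linarith
  have hp2 : 1 / 64 ≤ x.re ^ 2 := by nlinarith
  -- The 9 comes from 3π ≥ 9. With (Re x)² ≥ 1/64 this gives Re Z² ≥ t/64, which is at least 1 as t
  -- ≥ 64.
  have hc : 9 * (t * x.re ^ 2 / 4) ≤ (Z ^ 2).re := by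
    rw [hZ2re]
    refine mul_le_mul (by linarith) hlow (by positivity) (by positivity)
  have htp : t / 64 ≤ t * x.re ^ 2 := by nlinarith
  have hnorm : ‖Z‖ ^ 2 ≤ 16 * (Z ^ 2).re := by
    have h1 : ‖(t - ε * I : ℂ)‖ ≤ 2 * t := by
      refine (norm_sub_le _ _).trans ?_
      rw [norm_mul, Complex.norm_I, mul_one, Complex.norm_real, Complex.norm_real,
        Real.norm_of_nonneg (by linarith), Real.norm_of_nonneg hε.le]
      linarith
    have h2 : ‖x‖ ^ 2 ≤ 5 / 4 * x.re ^ 2 := by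
      rw [← Complex.normSq_eq_norm_sq, Complex.normSq_apply]
      nlinarith
    rw [← norm_pow, hZ2re, hZ2, norm_mul, norm_mul, norm_pow, Complex.norm_real,
      Real.norm_of_nonneg (by positivity)]
    have h3 : ‖(t - ε * I : ℂ)‖ * ‖x‖ ^ 2 ≤ 2 * t * (5 / 4 * x.re ^ 2) :=
      mul_le_mul h1 h2 (by positivity) (by linarith)
    have h4 : ‖(t - ε * I : ℂ)‖ * ‖x‖ ^ 2 ≤
        16 * (t * (x.re ^ 2 - x.im ^ 2) + 2 * ε * (x.re * x.im)) := by nlinarith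
    calc 3 * π * (‖(t - ε * I : ℂ)‖ * ‖x‖ ^ 2) ≤
        3 * π * (16 * (t * (x.re ^ 2 - x.im ^ 2) + 2 * ε * (x.re * x.im))) :=
          mul_le_mul_of_nonneg_left h4 (by positivity)
      _ = _ := by ring
  have hZpos : 0 < Z.re := by
    rw [hZre]
    refine mul_pos (Real.sqrt_pos.mpr Real.pi_pos) ?_
    have h1 : s.re * -(x.re / 2) ≤ s.re * x.im := mul_le_mul_of_nonneg_left (by linarith) hre0
    have h2 : s.re * x.re ≤ s.im * x.re := mul_le_mul_of_nonneg_right hle hp.le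
    nlinarith [mul_pos him0 hp]
  refine (norm_erf_sub_one_le_of_sq_le hZpos (by linarith) hnorm).trans ?_
  gcongr
  linarith

/-- The half of the theta series over `n ≥ 0`. -/
def thetaHalf (A B τ : ℂ) : ℂ := ∑' n : ℕ, thetaTerm A B τ n

lemma hasSum_thetaHalf (A B : ℂ) {τ : ℂ} (hτ : 0 < τ.im) :
    HasSum (fun n : ℕ => thetaTerm A B τ n) (thetaHalf A B τ) :=
  ((hasSum_thetaChar A B hτ).summable.comp_injective Nat.cast_injective).hasSum

lemma hasSum_indicator_thetaHalf (A B : ℂ) {τ : ℂ} (hτ : 0 < τ.im) :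
    HasSum (fun n : ℤ => if 0 ≤ n then 2 * thetaTerm A B τ n else 0) (2 * thetaHalf A B τ) := by
  have h := (hasSum_thetaHalf A B hτ).mul_left 2
  refine (Nat.cast_injective.hasSum_iff
    (f := fun n : ℤ => if 0 ≤ n then 2 * thetaTerm A B τ n else 0) ?_).mp ?_
  · intro n hn
    refine if_neg fun h0 => hn ⟨n.toNat, Int.toNat_of_nonneg h0⟩
  · simpa [Function.comp_def] using h

/-- The completed series approach the false theta series as `w → τ + i∞`. -/
lemma exists_norm_thetaPsi_sub_le (τ : ℍ) {R : ℝ} (hR : 0 ≤ R) {ε : ℝ} (hε : 0 < ε) :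
    ∃ C : ℝ, 0 ≤ C ∧ ∀ t : ℝ, 2 * ε ≤ t → 64 ≤ t → ∀ A B : ℂ, |A.re| ≤ 3 / 8 → |A.im| ≤ 1 / 24 →
      ‖A‖ ≤ R → ‖B‖ ≤ R → ‖thetaPsi τ (sqrtDiff τ (τ + I * t + ε)) A B -
        2 * thetaHalf A B (3 * τ)‖ ≤ C * Real.exp (-(t / 64)) := by
  have him : 0 < (3 * (τ : ℂ)).im := (triple τ).im_pos
  obtain ⟨u, hu, hb⟩ := exists_summable_thetaTerm_bound (R := R + ‖3 * (τ : ℂ)‖)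
    (by positivity) him
  have hu0 : ∀ n, 0 ≤ u n := fun n => (norm_nonneg _).trans
    (hb n 0 0 (3 * τ) (by simp; positivity) (by simp; positivity) (by linarith) le_rfl).1
  refine ⟨8 * ∑' n, u n, mul_nonneg (by norm_num) (tsum_nonneg hu0), ?_⟩
  intro t ht ht' A B hA hA' hAR hBR
  have hs : sqrtDiff τ (τ + I * t + ε) ∈ sqDomain (3 * τ) := by
    have hw : 0 < ((τ : ℂ) + I * t + ε).im := by
      have := τ.im_pos
      simp
      linarith
    exact sqrtDiff_mem τ ⟨_, hw⟩
  have hsum := ((hasSum_thetaChar A B him).add (hasSum_psiChar A B him hs)).sub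
    (hasSum_indicator_thetaHalf A B him)
  have hterm : ∀ n : ℤ, ‖thetaTerm A B (3 * τ) n +
      psiTerm A B (3 * τ) (sqrtDiff τ (τ + I * t + ε)) n -
      (if 0 ≤ n then 2 * thetaTerm A B (3 * τ) n else 0)‖ ≤ 8 * Real.exp (-(t / 64)) * u n := by
    intro n
    have hn := (hb n A B (3 * τ) (by linarith [norm_nonneg (3 * (τ : ℂ))])
      (by linarith [norm_nonneg (3 * (τ : ℂ))]) (by linarith) le_rfl).1
    obtain ⟨hA1, hA2⟩ := abs_le.mp hA
    have hre : ((n : ℂ) + 1 / 2 + A).re = n + 1 / 2 + A.re := by simp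
    have him' : ((n : ℂ) + 1 / 2 + A).im = A.im := by simp
    rw [psiTerm]
    -- As |Re A| ≤ 3/8, the real part of x is at least 1/8 for n ≥ 0 and at most -1/8 for n < 0, and
    -- |Im A| ≤ 1/24 < 1/16 keeps x or -x in the sector. Thus 1 + erf is near 2 or 0.
    split_ifs with h0
    · have hn0 : (0 : ℝ) ≤ n := by exact_mod_cast h0
      have h := norm_erf_sqrtDiff_sub_one_le τ hε ht ht' (x := (n : ℂ) + 1 / 2 + A)
        (by rw [hre]; linarith) (by rw [hre, him']; linarith)
      rw [← one_add_mul, ← sub_mul, norm_mul,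
        show ∀ y : ℂ, 1 + y - 2 = y - 1 from fun y => by ring]
      exact mul_le_mul h hn (norm_nonneg _) (by positivity)
    · have hn0 : (n : ℝ) ≤ -1 := by
        have : n ≤ -1 := by omega
        exact_mod_cast this
      have h := norm_erf_sqrtDiff_sub_one_le τ hε ht ht' (x := -((n : ℂ) + 1 / 2 + A))
        (by rw [Complex.neg_re, hre]; linarith)
        (by rw [Complex.neg_re, Complex.neg_im, hre, him', abs_neg]; linarith)
      rw [mul_neg, erf_neg, ← norm_neg] at h
      rw [sub_zero, ← one_add_mul, norm_mul]
      refine mul_le_mul (le_trans (le_of_eq ?_) h) hn (norm_nonneg _) (by positivity)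
      congr 1
      ring
  have hsum' := hu.hasSum.mul_left (8 * Real.exp (-(t / 64)))
  have := hsum.norm_le_of_bounded hsum' hterm
  rw [thetaPsi]
  calc _ ≤ _ := this
    _ = _ := by ring

/-- The limit of `Ĥ / (2i sin πz)`, with `z̄` set to `0`, as `w → τ + i∞`. -/
def polarLimit (τ z : ℂ) : ℂ :=
  -(1 / 2) * cexp (-π * I * τ / 12) * cexp (-3 * π * I * coordA τ z 0 * (z + coordB τ z 0)) *
    shiftDiff (fun A B => 2 * thetaHalf A B (3 * τ)) (coordA τ z 0) (coordB τ z 0)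

lemma exists_tendstoUniformlyOn_polarH (τ : ℍ) : ∃ r : ℝ, 0 < r ∧ ∀ ε : ℝ, 0 < ε →
    TendstoUniformlyOn (fun (t : ℝ) z => polarH τ (sqrtDiff τ (τ + I * t + ε)) z 0) (polarLimit τ)
      atTop (Metric.ball 0 r) := by
  have hd := sub_conj_ne_zero τ
  have hd' : 0 < ‖(τ : ℂ) - conj (τ : ℂ)‖ := norm_pos_iff.mpr hd
  -- This radius gives |α| ≤ 1/24, so the shifted characteristics α ± 1/3 have real part at most 1/3
  -- + 1/24 = 3/8 in absolute value.
  set r : ℝ := ‖(τ : ℂ) - conj (τ : ℂ)‖ / 24 with hr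
  refine ⟨r, by positivity, fun ε hε => ?_⟩
  set pre : ℂ → ℂ := fun z => -(1 / 2) * cexp (-π * I * τ / 12) *
    cexp (-3 * π * I * coordA τ z 0 * (z + coordB τ z 0)) with hpre
  have hprec : Continuous pre := by
    simp only [hpre, coordA, coordB]
    fun_prop
  obtain ⟨M, hM⟩ := (isCompact_closedBall (0 : ℂ) r).exists_bound_of_continuousOn
    hprec.continuousOn
  have hM0 : 0 ≤ M := (norm_nonneg _).trans (hM 0 (by simp; positivity))
  obtain ⟨C, hC0, hC⟩ := exists_norm_thetaPsi_sub_le τ (R := 1 + ‖(τ : ℂ)‖) (by positivity) hε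
  have hlim : Tendsto (fun t : ℝ => M * (2 * (C * Real.exp (-(t / 64))))) atTop (𝓝 0) := by
    have h1 : Tendsto (fun t : ℝ => Real.exp (-(t / 64))) atTop (𝓝 0) :=
      Real.tendsto_exp_neg_atTop_nhds_zero.comp (tendsto_id.atTop_div_const (by norm_num))
    simpa using ((h1.const_mul C).const_mul 2).const_mul M
  rw [Metric.tendstoUniformlyOn_iff]
  intro δ hδ
  filter_upwards [hlim.eventually_lt_const hδ, eventually_ge_atTop (2 * ε),
    eventually_ge_atTop 64] with t h1 h2 h3 z hz
  refine lt_of_le_of_lt ?_ h1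
  have hzr : ‖z‖ < r := by simpa using hz
  have hα : ‖coordA τ z 0‖ ≤ 1 / 24 := by
    rw [coordA, sub_zero, norm_div, div_le_iff₀ hd']
    linarith
  have hβ : ‖3 * coordB τ z 0‖ ≤ 1 + ‖(τ : ℂ)‖ := by
    have : coordB τ z 0 = -(coordA τ z 0 * conj (τ : ℂ)) := by
      rw [coordA, coordB]
      ring
    rw [this, norm_mul, norm_neg, norm_mul, Complex.norm_conj, Complex.norm_ofNat]
    nlinarith [norm_nonneg (τ : ℂ)]
  have hre := (Complex.abs_re_le_norm (coordA τ z 0)).trans hα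
  have him := (Complex.abs_im_le_norm (coordA τ z 0)).trans hα
  have hshift : ∀ σ : ℝ, |σ| = 1 / 3 → ‖thetaPsi τ (sqrtDiff τ (τ + I * t + ε))
      (coordA τ z 0 + σ) (3 * coordB τ z 0) - 2 * thetaHalf (coordA τ z 0 + σ)
        (3 * coordB τ z 0) (3 * τ)‖ ≤ C * Real.exp (-(t / 64)) := by
    intro σ hσ
    refine hC t h2 h3 _ _ ?_ ?_ ?_ hβ
    · rw [Complex.add_re, Complex.ofReal_re]
      exact (abs_add_le _ _).trans (by linarith)
    · rw [Complex.add_im, Complex.ofReal_im, add_zero]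
      exact him
    · refine (norm_add_le _ _).trans ?_
      rw [Complex.norm_real, Real.norm_eq_abs, hσ]
      linarith [norm_nonneg (τ : ℂ)]
  have k1 := hshift (1 / 3) (by norm_num)
  have k2 := hshift (-(1 / 3)) (by norm_num)
  push_cast at k1 k2
  rw [← sub_eq_add_neg] at k2
  have hM' := hM z (by simpa using hzr.le)
  rw [dist_comm, dist_eq_norm]
  have heq : polarH τ (sqrtDiff τ (τ + I * t + ε)) z 0 - polarLimit τ z = pre z *
      ((thetaPsi τ (sqrtDiff τ (τ + I * t + ε)) (coordA τ z 0 - 1 / 3) (3 * coordB τ z 0) -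
        2 * thetaHalf (coordA τ z 0 - 1 / 3) (3 * coordB τ z 0) (3 * τ)) -
      (thetaPsi τ (sqrtDiff τ (τ + I * t + ε)) (coordA τ z 0 + 1 / 3) (3 * coordB τ z 0) -
        2 * thetaHalf (coordA τ z 0 + 1 / 3) (3 * coordB τ z 0) (3 * τ))) := by
    simp only [polarH, polarLimit, shiftDiff, hpre]
    ring
  rw [heq, norm_mul]
  refine mul_le_mul hM' ((norm_sub_le _ _).trans ?_) (norm_nonneg _) hM0
  linarith

/-- For each n ≥ 0 the shift -1/3 gives ζ^{3n} q^{n(3n+1)/2} and the shift +1/3 gives the same times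
ζ²q^{2n+1}. Without error functions only ατ + β = z matters, so no trace of τ̄ remains. -/
lemma falseTheta_eq (τ : ℍ) (z : ℂ) :
    falseTheta (e z) (e τ) = 2 * I * Complex.sin (π * z) * polarLimit τ z := by
  have him : 0 < (3 * (τ : ℂ)).im := (triple τ).im_pos
  have hz := coordA_mul_add_coordB τ z 0
  set α := coordA τ z 0 with hα
  set β := coordB τ z 0 with hβ
  have hterm : ∀ n : ℕ, cexp (-π * I * τ / 12) * cexp (-3 * π * I * α * (z + β)) *
      (thetaTerm (α - 1 / 3) (3 * β) (3 * τ) n - thetaTerm (α + 1 / 3) (3 * β) (3 * τ) n) =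
      e (z / 2) * ((-1 : ℂ) ^ n * e z ^ (3 * n) * e τ ^ (n * (3 * n + 1) / 2) *
        (1 - e z ^ 2 * e τ ^ (2 * n + 1))) := by
    intro n
    have hcast : (((n * (3 * n + 1) / 2 : ℕ) : ℂ)) = n * (3 * n + 1) / 2 := by
      have h2 : 2 ∣ n * (3 * n + 1) := by
        rcases Nat.even_or_odd n with h | h
        · exact (even_iff_two_dvd.mp h).mul_right _
        · refine Dvd.dvd.mul_left ?_ _
          obtain ⟨k, hk⟩ := h
          omega
      rw [Nat.cast_div h2 (by norm_num)]
      push_cast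
      ring
    have e1 : cexp (-π * I * τ / 12) * cexp (-3 * π * I * α * (z + β)) *
        cexp (π * I * (((n : ℤ) + 1 / 2 + (α - 1 / 3)) ^ 2 * (3 * τ) +
          2 * ((n : ℤ) + 1 / 2 + (α - 1 / 3)) * (3 * β))) =
        e (z / 2) * (e z ^ (3 * n) * e τ ^ (n * (3 * n + 1) / 2)) := by
      simp only [e, ← Complex.exp_nat_mul, ← Complex.exp_add]
      congr 1
      rw [hcast, ← hz]
      push_cast
      ring
    have e2 : cexp (-π * I * τ / 12) * cexp (-3 * π * I * α * (z + β)) *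
        cexp (π * I * (((n : ℤ) + 1 / 2 + (α + 1 / 3)) ^ 2 * (3 * τ) +
          2 * ((n : ℤ) + 1 / 2 + (α + 1 / 3)) * (3 * β))) =
        e (z / 2) * (e z ^ (3 * n) * e τ ^ (n * (3 * n + 1) / 2)) *
          (e z ^ 2 * e τ ^ (2 * n + 1)) := by
      simp only [e, ← Complex.exp_nat_mul, ← Complex.exp_add]
      congr 1
      rw [hcast, ← hz]
      push_cast
      ring
    simp only [thetaTerm, zpow_natCast]
    linear_combination ((-1 : ℂ) ^ n) * e1 - ((-1 : ℂ) ^ n) * e2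
  have hone : (1 - e z) = -((e (z / 2) - e (-z / 2)) * e (z / 2)) := by
    rw [sub_mul]
    simp only [e, ← Complex.exp_add]
    rw [show 2 * π * I * (-z / 2) + 2 * π * I * (z / 2) = 0 by ring, Complex.exp_zero,
      show 2 * π * I * (z / 2) + 2 * π * I * (z / 2) = 2 * π * I * z by ring]
    ring
  have hsum := (((hasSum_thetaHalf (α - 1 / 3) (3 * β) him).sub
    (hasSum_thetaHalf (α + 1 / 3) (3 * β) him)).mul_left
      (cexp (-π * I * τ / 12) * cexp (-3 * π * I * α * (z + β)))).tsum_eq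
  simp only [hterm] at hsum
  rw [tsum_mul_left (a := e (z / 2))] at hsum
  rw [falseTheta, hone, e_half_sub_e_neg_half, polarLimit, shiftDiff, ← hα, ← hβ]
  linear_combination (-(2 * I * Complex.sin (π * z))) * hsum

lemma polarLimit_spec (τ : ℍ) :
    AnalyticAt ℂ (polarLimit τ) 0 ∧ polarLimit τ 0 = -(cexp (-π * I * τ / 12) * ModularForm.eta τ) ∧
    polarLimit τ 0 ≠ 0 ∧ ∀ (k : ℕ) (ε : ℝ), 0 < ε →
      Tendsto (fun t : ℝ => logCoeff (fun z => polarH τ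
        (sqrtDiff τ (ofComplex ((τ : ℂ) + I * t + ε))) z 0) k) atTop
        (𝓝 (logCoeff (polarLimit τ) k)) := by
  obtain ⟨r, hr, hlim⟩ := exists_tendstoUniformlyOn_polarH τ
  have hlim' : ∀ ε : ℝ, 0 < ε → TendstoUniformlyOn (fun (t : ℝ) z => polarH τ
      (sqrtDiff τ (ofComplex ((τ : ℂ) + I * t + ε))) z 0) (polarLimit τ) atTop
      (Metric.ball 0 r) := by
    intro ε hε
    refine (hlim ε hε).congr ?_
    filter_upwards [eventually_gt_atTop 0] with t ht z _
    have hw : 0 < ((τ : ℂ) + I * t + ε).im := by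
      have := τ.im_pos
      simp
      linarith
    simp only [ofComplex_apply_of_im_pos hw]
  have hd : ∀ w : ℍ, Differentiable ℂ fun z => polarH τ (sqrtDiff τ w) z 0 := fun w =>
    differentiable_polarH_comp (sqrtDiff_mem τ w) differentiable_fun_id (differentiable_const 0)
  have hdiff : DifferentiableOn ℂ (polarLimit τ) (Metric.ball 0 r) :=
    (hlim' 1 one_pos).tendstoLocallyUniformlyOn.differentiableOn
      (Eventually.of_forall fun t => (hd _).differentiableOn) Metric.isOpen_ball
  -- By `polarH_zero` the approximating values at 0 do not depend on w, so the limit is known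
  -- without evaluating a partial theta series.
  have h0 : polarLimit τ 0 = -(cexp (-π * I * τ / 12) * ModularForm.eta τ) := by
    refine tendsto_nhds_unique ((hlim' 1 one_pos).tendsto_at (Metric.mem_ball_self hr)) ?_
    simp only [polarH_zero]
    exact tendsto_const_nhds
  have h0' : polarLimit τ 0 ≠ 0 := by
    rw [h0, ← polarH_zero τ 0]
    exact polarH_zero_ne_zero τ 0
  exact ⟨hdiff.analyticAt (Metric.ball_mem_nhds 0 hr), h0, h0', fun k ε hε =>
    tendsto_logCoeff hr (hlim' ε hε) (fun t => hd _) hdiff.continuousOn h0' k⟩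

/-- The false Eisenstein series are the Taylor coefficients of the logarithm of the limit. -/
lemma isFalseEisensteinSeq_polarLimit (τ : ℍ) : IsFalseEisensteinSeq τ fun k =>
    -(logCoeff (polarLimit τ) k / (2 * π * I) ^ (k : ℕ)) := by
  obtain ⟨han, h0, h0', -⟩ := polarLimit_spec τ
  have hne : ∀ᶠ z in 𝓝 (0 : ℂ), polarLimit τ z ≠ 0 := han.continuousAt.eventually_ne h0'
  filter_upwards [hasSum_logCoeff han h0', hne] with z hz hz0
  refine ⟨-Complex.log (polarLimit τ z / polarLimit τ 0), ?_, ?_⟩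
  · refine Eq.subst (motive := fun f => HasSum f _) (funext fun k => ?_) hz.neg
    have h3 : ((k : ℕ).factorial : ℂ) ≠ 0 := by exact_mod_cast (k : ℕ).factorial_ne_zero
    have h2 := pow_ne_zero (k : ℕ) two_pi_I_ne_zero
    rw [mul_pow (2 * π * I : ℂ) z]
    generalize (2 * π * I : ℂ) ^ (k : ℕ) = x at h2 ⊢
    field_simp
  · have he : e (-τ / 24) = cexp (-π * I * τ / 12) := by
      rw [e]
      congr 1
      ring
    rw [neg_neg, Complex.exp_log (div_ne_zero hz0 h0'), falseTheta_eq, he]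
    have : -2 * I * Complex.sin (π * z) * cexp (-π * I * τ / 12) * ModularForm.eta τ =
        2 * I * Complex.sin (π * z) * polarLimit τ 0 := by
      rw [h0]
      ring
    rw [this]
    field_simp

lemma isFalseEisensteinSeq_falseEisenstein (τ : ℍ) :
    IsFalseEisensteinSeq τ fun k => falseEisenstein k τ :=
  Classical.epsilon_spec (p := IsFalseEisensteinSeq (τ : ℂ)) ⟨_, isFalseEisensteinSeq_polarLimit τ⟩

/-- `falseEisenstein` is a choice of solution; uniqueness identifies it with the logarithmic
coefficients of `polarLimit`, to which those of `polarH` converge. -/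
theorem tendsto_completedEisenstein (k : ℕ+) (τ : ℍ) {ε : ℝ} (hε : 0 < ε) :
    Tendsto (fun t : ℝ => completedEisenstein k τ (ofComplex ((τ : ℂ) + I * t + ε))) atTop
      (𝓝 (falseEisenstein k τ)) := by
  have h : falseEisenstein k τ = -(logCoeff (polarLimit τ) k / (2 * π * I) ^ (k : ℕ)) :=
    congrFun ((isFalseEisensteinSeq_falseEisenstein τ).unique τ.im_pos
      (isFalseEisensteinSeq_polarLimit τ)) k
  rw [h]
  exact (((polarLimit_spec τ).2.2.2 k ε hε).div_const _).neg

end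

end FalseEis

theorem theorem1p2 :
    -- the false Eisenstein series satisfy the identity that defines them
    (∀ τ : ℍ, FalseEis.IsFalseEisensteinSeq τ (fun k => FalseEis.falseEisenstein k τ)) ∧
    ∃ hHat : ℕ+ → ℍ → ℍ → ℂ,
      -- `hHat k` is the exponential Taylor coefficient of `z^k` wherever that is defined
      (∀ τ w : ℍ, τ ≠ w → FalseEis.HHatDeriv τ w ≠ 0 →
        ∃ c : ℕ × ℕ → ℂ, FalseEis.IsCompletedCoeffs τ w c ∧
          ∀ k : ℕ+, c ((k : ℕ), 0) = hHat k τ w) ∧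
      -- transformation under the simultaneous action
      (∀ (k : ℕ+) (γ : SL(2, ℤ)), γ ∈ CongruenceSubgroup.Gamma0 3 →
        ∀ τ w : ℍ, τ ≠ w →
          hHat k (γ • τ) (γ • w) =
            FalseEis.chi τ w γ ^ (k : ℕ) * FalseEis.den γ τ ^ (k : ℕ) * hHat k τ w +
              (if k = 2 then 3 * I * ((γ 1 0 : ℤ) : ℂ) / (2 * π) * FalseEis.den γ τ else 0)) ∧
      -- recovery of the false Eisenstein series; `τ + it + ε` lies in `ℍ` for `t > 0`
      (∀ (k : ℕ+) (τ : ℍ) (ε : ℝ), 0 < ε →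
        Tendsto (fun t : ℝ => hHat k τ (UpperHalfPlane.ofComplex ((τ : ℂ) + I * t + ε))) atTop
          (𝓝 (FalseEis.falseEisenstein k τ))) := by
  refine ⟨FalseEis.isFalseEisensteinSeq_falseEisenstein, FalseEis.completedEisenstein, ?_, ?_, ?_⟩
  · exact fun τ w _ _ => FalseEis.exists_isCompletedCoeffs τ w
  · exact fun k γ hγ τ w h => FalseEis.completedEisenstein_smul k hγ h
  · exact fun k τ ε hε => FalseEis.tendsto_completedEisenstein k τ hε
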